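/- **Setting.** Let $X$ be a paracompact Hausdorff space and $\mathcal A$ a soft sheaf of (unital, not necessarily commutative) rings on $X$, i.e. for every closed $K\subset X$ every section over $K$ (an element of $\varinjlim_{V\supset K}\mathcal A(V)$, $V$ open in $X$) extends to a section over $X$. For $U\subset X$ open put $\mathcal A^0(U)=\varinjlim_{V\supset\overline U}\mathcal A(V)$, the limit over all open $V$ that contain the closure of $U$; thus $\mathcal A^0(X)=\mathcal A(X)$. For $U\subset W$ the restriction of an $\mathcal A^0(W)$-module $M$ is $M|_U=\mathcal A^0(U)\otimes_{\mathcal A^0(W)}M$. Modules are left modules; the case of right modules is obtained by replacing $\mathcal A$ by the opposite sheaf of rings. Let $\mathcal C_{\mathcal A^0}(U)$ be the dg-category of cochain complexes of $\mathcal A^0(U)$-modules, and $\mathcal P_{\mathcal A^0}(U)$ the full dg-subcategory of bounded complexes of finitely generated projective modules. Let $\mathcal U=\{U_i\}$ be a finite open cover of $X$ that is good: every non-empty finite intersection $U_{i_0\ldots i_p}=U_{i_0}\cap\dots\cap U_{i_p}$ is contractible. **Twisted complexes.** For families of complexes $E_i,F_i\in\mathcal C_{\mathcal A^0}(U_i)$,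 a cochain $u$ of total degree $d$ has components $u^{p,q}$, $p\ge 0$, $p+q=d$, where $u^{p,q}$ assigns to every tuple $(i_0,\dots,i_p)$ a map $u^{p,q}_{i_0\ldots i_p}$ of graded modules of degree $q$ from $E_{i_p}|_{U_{i_0\ldots i_p}}$ to $F_{i_0}|_{U_{i_0\ldots i_p}}$. Put $$(u\cdot v)_{i_0\ldots i_{p+r}}=\sum(-1)^{qr}u^{p,q}_{i_0\ldots i_p}\,v^{r,s}_{i_p\ldots i_{p+r}},\qquad(\delta u)_{i_0\ldots i_{p+1}}=\sum_{k=1}^{p}(-1)^k\,u_{i_0\ldots\widehat{i_k}\ldots i_{p+1}}|_{U_{i_0\ldots i_{p+1}}}.$$ A twisted complex with values in $\mathcal C_{\mathcal A^0}$ is a family $F_i\in\mathcal C_{\mathcal A^0}(U_i)$ with a cochain $b=\sum_{k\ge0}b^{k,1-k}$ of total degree $1$ such that $\delta b+b\cdot b=0$, $b^{0,1}_i$ is the differential of $F_i$, and $b^{1,0}_{ii}$ is invertible up to homotopy. The morphisms of degree $d$ from $(E_i,a)$ to $(F_i,b)$ are the cochains of total degree $d$, with differential $d\phi=\delta\phi+b\cdot\phi-(-1)^{|\phi|}\phi\cdot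 a$. A homotopy equivalence is a closed morphism of degree $0$ that has a closed inverse of degree $0$ up to boundaries of morphisms of degree $-1$. Let $\mathrm{Tw}(X,\mathcal P_{\mathcal A^0},U_i)$ be the twisted complexes with all $F_i\in\mathcal P_{\mathcal A^0}(U_i)$. **The functors.** For $E\in\mathcal C_{\mathcal A^0}(X)$ let $\mathcal T(E)$ be the twisted complex with $\mathcal T(E)_i=E|_{U_i}$, $a^{0,1}$ the differential, $a^{1,0}_{ij}=\mathrm{id}$ and $a^{k,1-k}=0$ for $k\ge2$; a morphism $\phi$ of complexes goes to the morphism $\mathcal T(\phi)$ with $\mathcal T(\phi)_i=\phi|_{U_i}$ in Čech degree $0$ and zero in higher Čech degree. For a twisted complex $\mathcal F=(F_i,b)$ let $\mathcal S(\mathcal F)$ be the complex of $\mathcal A^0(X)$-modules $$\mathcal S^n(\mathcal F)=\prod_{p+q=n}\ \prod_{i_0\ldots i_p}F^q_{i_0}|_{U_{i_0\ldots i_p}}$$ with differential $c\mapsto\delta c+b\cdot c$, where $(\delta c)_{i_0\ldots i_p}=\sum_{k=1}^{p}(-1)^kc_{i_0\ldots\widehat{i_k}\ldots i_p}|_{U_{i_0\ldots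 i_p}}$ and $(b\cdot c)_{i_0\ldots i_p}=\sum_{t=0}^{p}(-1)^{(1-t)(p-t)}b^{t,1-t}_{i_0\ldots i_t}c_{i_t\ldots i_p}$. Let $\eta_{\mathcal F}:\mathcal T(\mathcal S(\mathcal F))\to\mathcal F$ be the morphism of degree $0$ whose component at $(i_0,\dots,i_p)$ is the $\mathcal A^0(U_{i_0\ldots i_p})$-linear extension of $c\mapsto c_{i_0\ldots i_p}$ (the counit of the adjunction between $\mathcal T$ and $\mathcal S$). **Proposition.** For every $\mathcal F\in\mathrm{Tw}(X,\mathcal P_{\mathcal A^0},U_i)$ there are a bounded complex $\mathcal E$ of finitely generated projective $\mathcal A^0(X)$-modules and a quasi-isomorphism $\phi:\mathcal E\to\mathcal S(\mathcal F)$ of complexes of $\mathcal A^0(X)$-modules such that $\eta_{\mathcal F}\circ\mathcal T(\phi):\mathcal T(\mathcal E)\to\mathcal F$ is a homotopy equivalence of twisted complexes. -/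

import Mathlib

open CategoryTheory TopologicalSpace Opposite
open scoped TensorProduct

universe u

noncomputable section

namespace TwistedDescent

/-! ### Extension of scalars for rings that need not be commutative -/

section BaseChange

variable {R S T : Type u} [Ring R] [Ring S] [Ring T]

/-- The relations that turn `S ⊗[ℤ] M` into the tensor product of `S` and `M` over `R`. -/
def baseChangeRel (f : R →+* S) (M : Type u) [AddCommGroup M] [Module R M] :
    Submodule S (S ⊗[ℤ] M) :=
  Submodule.span S {x | ∃ (s : S) (r : R) (m : M), x = (s * f r) ⊗ₜ[ℤ] m - s ⊗ₜ[ℤ] (r • m)}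

/-- The extension of scalars `S ⊗_R M` of a left `R`-module along `f : R →+* S`. -/
def BaseChange (f : R →+* S) (M : Type u) [AddCommGroup M] [Module R M] : Type u :=
  (S ⊗[ℤ] M) ⧸ baseChangeRel f M

namespace BaseChange

variable (f : R →+* S) {M N : Type u} [AddCommGroup M] [Module R M]

instance : AddCommGroup (BaseChange f M) :=
  inferInstanceAs (AddCommGroup ((S ⊗[ℤ] M) ⧸ baseChangeRel f M))

instance : Module S (BaseChange f M) :=
  inferInstanceAs (Module S ((S ⊗[ℤ] M) ⧸ baseChangeRel f M))

/-- The quotient map `S ⊗[ℤ] M → S ⊗_R M`. -/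
def quot : S ⊗[ℤ] M →ₗ[S] BaseChange f M := (baseChangeRel f M).mkQ

/-- The pure tensor `s ⊗ m`. -/
def tmul (s : S) (m : M) : BaseChange f M := quot f (s ⊗ₜ[ℤ] m)

theorem tmul_zero (s : S) : tmul f s (0 : M) = 0 := by
  rw [tmul, TensorProduct.tmul_zero, map_zero]

theorem tmul_add (s : S) (m m' : M) : tmul f s (m + m') = tmul f s m + tmul f s m' := by
  rw [tmul, TensorProduct.tmul_add, map_add, tmul, tmul]

theorem smul_tmul (s s' : S) (m : M) : s • tmul f s' m = tmul f (s * s') m := by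
  rw [tmul, ← map_smul, TensorProduct.smul_tmul', smul_eq_mul, tmul]

theorem tmul_map (s : S) (r : R) (m : M) : tmul f (s * f r) m = tmul f s (r • m) := by
  rw [← sub_eq_zero, tmul, tmul, ← map_sub]
  exact (Submodule.Quotient.mk_eq_zero _).2 (Submodule.subset_span ⟨s, r, m, rfl⟩)

theorem tmul_eq_smul (s : S) (m : M) : tmul f s m = s • tmul f 1 m := by
  rw [smul_tmul, mul_one]

theorem induction {P : BaseChange f M → Prop} (h0 : P 0) (ht : ∀ s m, P (tmul f s m))
    (ha : ∀ x y, P x → P y → P (x + y)) (x : BaseChange f M) : P x := by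
  obtain ⟨y, rfl⟩ : ∃ y, quot f y = x := (baseChangeRel f M).mkQ_surjective x
  induction y with
  | zero => rwa [map_zero]
  | tmul s m => exact ht s m
  | add a b iha ihb =>
    rw [map_add]
    exact ha _ _ iha ihb

variable [AddCommGroup N] [Module T N]

/-- The additive map `s ⊗ m ↦ g s • k m` on the tensor product over `ℤ`. -/
def preLiftAdd (g : S →+* T) (k : M →+ N) : S ⊗[ℤ] M →+ N :=
  TensorProduct.liftAddHom
    (AddMonoidHom.mk' (fun s : S => AddMonoidHom.mk' (fun m : M => g s • k m)
      (fun m m' => by rw [map_add, smul_add]))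
      (fun s s' => by ext m; simp [add_smul]))
    (fun n s m => by
      simp only [AddMonoidHom.mk'_apply, map_zsmul]
      rfl)

/-- The same map as a semilinear map. -/
def preLift (g : S →+* T) (k : M →+ N) : S ⊗[ℤ] M →ₛₗ[g] N where
  toFun := preLiftAdd g k
  map_add' x y := map_add _ x y
  map_smul' s x := by
    induction x with
    | zero => rw [smul_zero, map_zero, smul_zero]
    | tmul s' m =>
      change g (s * s') • k m = g s • g s' • k m
      rw [map_mul, mul_smul]
    | add a b iha ihb => rw [smul_add, map_add, iha, ihb, map_add, smul_add]

theorem preLift_tmul (g : S →+* T) (k : M →+ N) (s : S) (m : M) :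
    preLift g k (s ⊗ₜ[ℤ] m) = g s • k m := rfl

/-- The universal property: an additive map `k : M → N` that is semilinear along `g ∘ f` extends
to a map `s ⊗ m ↦ g s • k m` that is semilinear along `g`. -/
def lift (g : S →+* T) (k : M →+ N) (hk : ∀ r m, k (r • m) = g (f r) • k m) :
    BaseChange f M →ₛₗ[g] N :=
  (baseChangeRel f M).liftQ (preLift g k) (by
    rw [baseChangeRel, Submodule.span_le]
    rintro _ ⟨s, r, m, rfl⟩
    simp [preLift_tmul, hk, mul_smul])

@[simp]
theorem lift_tmul (g : S →+* T) (k : M →+ N) (hk : ∀ r m, k (r • m) = g (f r) • k m)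
    (s : S) (m : M) : lift f g k hk (tmul f s m) = g s • k m := rfl

variable {f}

theorem hom_ext {g : S →+* T} {k l : BaseChange f M →ₛₗ[g] N}
    (h : ∀ m, k (tmul f 1 m) = l (tmul f 1 m)) : k = l := by
  ext x
  induction x using BaseChange.induction with
  | h0 => simp
  | ht s m => rw [tmul_eq_smul, map_smulₛₗ, map_smulₛₗ, h]
  | ha x y hx hy => rw [map_add, map_add, hx, hy]

variable (f) {P Q : Type u} [AddCommGroup P] [Module R P] [AddCommGroup Q] [Module R Q]

/-- The map `M → S ⊗_R M`, `m ↦ 1 ⊗ m`. -/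
def unit : M →+ BaseChange f M where
  toFun m := tmul f 1 m
  map_zero' := tmul_zero f 1
  map_add' := tmul_add f 1

@[simp] theorem unit_apply (m : M) : unit f m = tmul f 1 m := rfl

theorem unit_smul (r : R) (m : M) : unit f (r • m) = f r • unit f m := by
  rw [unit_apply, unit_apply, smul_tmul, mul_one, ← tmul_map, one_mul]

/-- Extension of scalars on linear maps: `s ⊗ m ↦ s ⊗ k m`. -/
def map (k : P →ₗ[R] Q) : BaseChange f P →ₗ[S] BaseChange f Q :=
  lift f (RingHom.id S) ((unit f).comp k.toAddMonoidHom) (fun r m => by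
    simp [unit_smul f r (k m), -unit_apply])

@[simp]
theorem map_tmul (k : P →ₗ[R] Q) (s : S) (m : P) : map f k (tmul f s m) = tmul f s (k m) := by
  rw [map, lift_tmul]
  simp [smul_tmul]

end BaseChange

/-- Extension of scalars as a functor between categories of left modules. -/
def baseChange (f : R →+* S) : ModuleCat.{u} R ⥤ ModuleCat.{u} S where
  obj M := ModuleCat.of S (BaseChange f M)
  map k := ModuleCat.ofHom (BaseChange.map f k.hom)
  map_id M := by
    apply ModuleCat.hom_ext
    apply BaseChange.hom_ext
    simp
  map_comp k l := by
    apply ModuleCat.hom_ext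
    apply BaseChange.hom_ext
    simp

instance (f : R →+* S) : (baseChange f).Additive where
  map_add {M N k l} := by
    apply ModuleCat.hom_ext
    apply BaseChange.hom_ext
    intro m
    change BaseChange.map f (k + l).hom (BaseChange.tmul f 1 m) =
      BaseChange.map f k.hom (BaseChange.tmul f 1 m) +
        BaseChange.map f l.hom (BaseChange.tmul f 1 m)
    simp [BaseChange.tmul_add]

end BaseChange

/-! ### Sections over closed sets, soft sheaves, good covers -/

section Sections

variable {X : TopCat.{u}} (𝒜 : TopCat.Sheaf RingCat.{u} X)

/-- The open neighbourhoods of a set, ordered by reverse inclusion. -/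
abbrev Nhds (K : Set X) : Type u := {V : (Opens X)ᵒᵈ // K ⊆ (OrderDual.ofDual V : Opens X)}

instance (K : Set X) : Nonempty (Nhds K) := ⟨⟨OrderDual.toDual ⊤, fun _ _ => trivial⟩⟩

instance (K : Set X) : IsDirectedOrder (Nhds K) where
  directed V W := ⟨⟨OrderDual.toDual (OrderDual.ofDual V.1 ⊓ OrderDual.ofDual W.1),
    fun _ hx => ⟨V.2 hx, W.2 hx⟩⟩,
    fun _ hx => hx.1, fun _ hx => hx.2⟩

/-- The ring of sections over an open neighbourhood. -/
abbrev nhdsRing (K : Set X) (V : Nhds K) : Type u :=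
  𝒜.presheaf.obj (op (OrderDual.ofDual V.1))

/-- Restriction of sections to a smaller neighbourhood. -/
abbrev nhdsMap (K : Set X) (V W : Nhds K) (h : V ≤ W) : nhdsRing 𝒜 K V →+* nhdsRing 𝒜 K W :=
  (𝒜.presheaf.map (homOfLE (OrderDual.ofDual_le_ofDual.2 h)).op).hom

instance (K : Set X) : DirectedSystem (nhdsRing 𝒜 K) (nhdsMap 𝒜 K · · ·) where
  map_self V x := by
    exact congrArg (fun g => g.hom x) (𝒜.presheaf.map_id (op (OrderDual.ofDual V.1)))
  map_map W V Y hij hjk x := by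
    exact (congrArg (fun g => g.hom x) (𝒜.presheaf.map_comp
      (homOfLE (OrderDual.ofDual_le_ofDual.2 hij)).op
      (homOfLE (OrderDual.ofDual_le_ofDual.2 hjk)).op)).symm

/-- The ring of sections of `𝒜` over a subset `K`: the direct limit of the `𝒜(V)` over all open
`V ⊇ K`. -/
def Sec (K : Set X) : Type u := DirectLimit (nhdsRing 𝒜 K) (nhdsMap 𝒜 K)

instance (K : Set X) : Ring (Sec 𝒜 K) :=
  inferInstanceAs (Ring (DirectLimit (nhdsRing 𝒜 K) (nhdsMap 𝒜 K)))

/-- The class in `Sec 𝒜 K` of a section over an open neighbourhood `V` of `K`. -/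
def Sec.mk {K : Set X} (V : Nhds K) (t : nhdsRing 𝒜 K V) : Sec 𝒜 K :=
  (⟦⟨V, t⟩⟧ : DirectLimit (nhdsRing 𝒜 K) (nhdsMap 𝒜 K))

/-- Restriction of sections along `K ⊆ L`. -/
def Sec.res {K L : Set X} (h : K ⊆ L) : Sec 𝒜 L →+* Sec 𝒜 K where
  toFun := DirectLimit.lift _ (fun V t => Sec.mk 𝒜 ⟨V.1, h.trans V.2⟩ t)
    (fun V W hVW t => DirectLimit.eq_of_le (f := nhdsMap 𝒜 K)
      (⟨⟨V.1, h.trans V.2⟩, t⟩ : Σ V : Nhds K, nhdsRing 𝒜 K V) ⟨W.1, h.trans W.2⟩ hVW)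
  map_one' := (DirectLimit.one_def (f := nhdsMap 𝒜 K)
    ⟨(Classical.arbitrary (Nhds L)).1, h.trans (Classical.arbitrary (Nhds L)).2⟩).symm
  map_zero' := (DirectLimit.zero_def (f := nhdsMap 𝒜 K)
    ⟨(Classical.arbitrary (Nhds L)).1, h.trans (Classical.arbitrary (Nhds L)).2⟩).symm
  map_add' := DirectLimit.induction₂ (nhdsMap 𝒜 L) fun V x y => by
    erw [DirectLimit.add_def]
    exact (DirectLimit.add_def (f := nhdsMap 𝒜 K) ⟨V.1, h.trans V.2⟩ x y).symm
  map_mul' := DirectLimit.induction₂ (nhdsMap 𝒜 L) fun V x y => by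
    erw [DirectLimit.mul_def]
    exact (DirectLimit.mul_def (f := nhdsMap 𝒜 K) ⟨V.1, h.trans V.2⟩ x y).symm

theorem Sec.res_res {K L P : Set X} (h : K ⊆ L) (h' : L ⊆ P) (x : Sec 𝒜 P) :
    Sec.res 𝒜 h (Sec.res 𝒜 h' x) = Sec.res 𝒜 (h.trans h') x := by
  induction x using DirectLimit.induction with
  | _ V t => rfl

theorem Sec.res_self {K : Set X} (x : Sec 𝒜 K) : Sec.res 𝒜 (subset_refl K) x = x := by
  induction x using DirectLimit.induction with
  | _ V t => rfl

/-- A sheaf is soft if every section over every closed subset extends to a global section. -/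
def IsSoft : Prop :=
  ∀ K : Set X, IsClosed K → Function.Surjective (Sec.res 𝒜 (Set.subset_univ K))

/-- The ring `𝒜(U)` of an open set `U`: the direct limit of the sections of `𝒜` over all open
sets that contain the closure of `U`. -/
abbrev ringOn (V : Opens X) : Type u := Sec 𝒜 (closure (V : Set X))

/-- The restriction homomorphism `𝒜(W) → 𝒜(V)` for `V ≤ W`. -/
abbrev res {V W : Opens X} (h : V ≤ W) : ringOn 𝒜 W →+* ringOn 𝒜 V :=
  Sec.res 𝒜 (closure_mono h)

variable {V V' W Y Z : Opens X}

/-- The restriction `M|_V = 𝒜(V) ⊗_{𝒜(W)} M` of an `𝒜(W)`-module to `V ≤ W`. -/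
abbrev Restr (h : V ≤ W) (M : Type u) [AddCommGroup M] [Module (ringOn 𝒜 W) M] : Type u :=
  BaseChange (res 𝒜 h) M

section

variable {M N : Type u} [AddCommGroup M] [Module (ringOn 𝒜 W) M]
  [AddCommGroup N] [Module (ringOn 𝒜 Y) N]

/-- The restriction map `M|_V → M|_{V'}` for `V' ≤ V ≤ W`. -/
def shrink (h : V' ≤ V) (hV : V ≤ W) (hV' : V' ≤ W) : Restr 𝒜 hV M →ₛₗ[res 𝒜 h] Restr 𝒜 hV' M :=
  BaseChange.lift (res 𝒜 hV) (res 𝒜 h) (BaseChange.unit (res 𝒜 hV')) (fun r m => by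
    rw [Sec.res_res, BaseChange.unit_smul])

@[simp]
theorem shrink_tmul (h : V' ≤ V) (hV : V ≤ W) (hV' : V' ≤ W) (s : ringOn 𝒜 V) (m : M) :
    shrink 𝒜 h hV hV' (BaseChange.tmul (res 𝒜 hV) s m) =
      BaseChange.tmul (res 𝒜 hV') (res 𝒜 h s) m := by
  simp [shrink, BaseChange.smul_tmul]

theorem shrink_comp_smul (h : V' ≤ V) (hV : V ≤ W) (hV' : V' ≤ W) (hY : V ≤ Y) (hY' : V' ≤ Y)
    (k : Restr 𝒜 hV M →ₗ[ringOn 𝒜 V] Restr 𝒜 hY N) (r : ringOn 𝒜 W) (m : M) :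
    ((shrink 𝒜 h hY hY').toAddMonoidHom.comp
        (k.toAddMonoidHom.comp (BaseChange.unit (res 𝒜 hV)))) (r • m) =
      RingHom.id _ (res 𝒜 hV' r) • ((shrink 𝒜 h hY hY').toAddMonoidHom.comp
        (k.toAddMonoidHom.comp (BaseChange.unit (res 𝒜 hV)))) m := by
  change shrink 𝒜 h hY hY' (k (BaseChange.unit (res 𝒜 hV) (r • m))) =
    res 𝒜 hV' r • shrink 𝒜 h hY hY' (k (BaseChange.unit (res 𝒜 hV) m))
  rw [BaseChange.unit_smul, map_smul, map_smulₛₗ, Sec.res_res]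

/-- The restriction `u|_{V'} : M|_{V'} → N|_{V'}` of a linear map `u : M|_V → N|_V`. -/
def shrinkHom (h : V' ≤ V) (hV : V ≤ W) (hV' : V' ≤ W) (hY : V ≤ Y) (hY' : V' ≤ Y)
    (k : Restr 𝒜 hV M →ₗ[ringOn 𝒜 V] Restr 𝒜 hY N) :
    Restr 𝒜 hV' M →ₗ[ringOn 𝒜 V'] Restr 𝒜 hY' N :=
  BaseChange.lift (res 𝒜 hV') (RingHom.id _)
    ((shrink 𝒜 h hY hY').toAddMonoidHom.comp
      (k.toAddMonoidHom.comp (BaseChange.unit (res 𝒜 hV))))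
    (shrink_comp_smul 𝒜 h hV hV' hY hY' k)

theorem shrinkHom_tmul (h : V' ≤ V) (hV : V ≤ W) (hV' : V' ≤ W) (hY : V ≤ Y) (hY' : V' ≤ Y)
    (k : Restr 𝒜 hV M →ₗ[ringOn 𝒜 V] Restr 𝒜 hY N) (s : ringOn 𝒜 V') (m : M) :
    shrinkHom 𝒜 h hV hV' hY hY' k (BaseChange.tmul (res 𝒜 hV') s m) =
      s • shrink 𝒜 h hY hY' (k (BaseChange.tmul (res 𝒜 hV) 1 m)) :=
  rfl

theorem shrinkHom_shrink (h : V' ≤ V) (hV : V ≤ W) (hV' : V' ≤ W) (hY : V ≤ Y) (hY' : V' ≤ Y)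
    (k : Restr 𝒜 hV M →ₗ[ringOn 𝒜 V] Restr 𝒜 hY N) (x : Restr 𝒜 hV M) :
    shrinkHom 𝒜 h hV hV' hY hY' k (shrink 𝒜 h hV hV' x) = shrink 𝒜 h hY hY' (k x) := by
  induction x using BaseChange.induction with
  | h0 => simp only [map_zero]
  | ht s m =>
    rw [shrink_tmul, shrinkHom_tmul, BaseChange.tmul_eq_smul (res 𝒜 hV) s, map_smul, map_smulₛₗ]
  | ha x y hx hy => simp only [map_add, hx, hy]

end

end Sections


/-! ### Tuples of indices -/

section Chains

variable {ι : Type u}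

/-- A tuple `(i₀, …, i_p)` of indices with `i₀ = i` and `i_p = j`. It is stored as the sequence
`i₀, …, i_p, i_p, i_p, …`, which is constant from place `p` on. -/
@[ext]
structure Chain (i j : ι) (p : ℕ) where
  vertex : ℕ → ι
  first : vertex 0 = i
  last : ∀ x, p ≤ x → vertex x = j

variable {i j : ι} {p : ℕ}

/-- The tuple `(i_{f 0}, …, i_{f q})`. -/
def Chain.sub (σ : Chain i j p) (f : ℕ → ℕ) (q : ℕ) {v w : ι} (hv : σ.vertex (f 0) = v)
    (hw : σ.vertex (f q) = w) : Chain v w q where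
  vertex x := σ.vertex (f (min x q))
  first := by rw [Nat.zero_min, hv]
  last x hx := by rw [min_eq_right hx, hw]

/-- The increasing map `ℕ → ℕ` that omits the value `s`. -/
def skip (s x : ℕ) : ℕ := if x < s then x else x + 1

theorem skip_zero (s : ℕ) : skip (s + 1) 0 = 0 := if_pos (Nat.succ_pos s)

/-- The tuple `(i₀, …, i_t)`. -/
def Chain.front (σ : Chain i j p) (t : ℕ) : Chain i (σ.vertex t) t :=
  σ.sub (fun x => x) t σ.first rfl

/-- The tuple `(i_t, …, i_p)`. -/
def Chain.back (σ : Chain i j p) (t : Fin (p + 1)) : Chain (σ.vertex t) j (p - t) :=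
  σ.sub (fun x => t + x) (p - t) rfl (σ.last _ (by omega))

/-- The tuple `(i₀, …, i_p)` with the entry `i_{s+1}` omitted; here `1 ≤ s + 1 ≤ p`. -/
def Chain.face (σ : Chain i j p) (s : Fin p) : Chain i (σ.vertex (skip (s + 1) (p - 1))) (p - 1) :=
  σ.sub (skip (s + 1)) (p - 1) (by rw [skip_zero, σ.first]) rfl

/-- The tuple `(i₀, …, i_p)` with the entry `i_{s+1}` omitted; here `1 ≤ s + 1 ≤ p - 1`, so the
first and the last entry stay. -/
def Chain.innerFace (σ : Chain i j p) (s : Fin (p - 1)) : Chain i j (p - 1) :=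
  σ.sub (skip (s + 1)) (p - 1) (by rw [skip_zero, σ.first])
    (σ.last _ (by have := s.2; rw [skip, if_neg (by omega)]; omega))

variable {X : TopCat.{u}} (U : ι → Opens X)

/-- The intersection `U_{i₀} ∩ ⋯ ∩ U_{i_p}`. -/
def Chain.inter (σ : Chain i j p) : Opens X := (Finset.range (p + 1)).inf fun x => U (σ.vertex x)

theorem Chain.inter_le (σ : Chain i j p) (x : ℕ) : σ.inter U ≤ U (σ.vertex x) := by
  have h : σ.vertex x = σ.vertex (min x p) := by
    rcases le_total x p with hx | hx
    · rw [min_eq_left hx]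
    · rw [min_eq_right hx, σ.last x hx, σ.last p le_rfl]
  rw [h]
  exact Finset.inf_le (f := fun x => U (σ.vertex x)) (Finset.mem_range.2 (by omega))

theorem Chain.inter_le_first (σ : Chain i j p) : σ.inter U ≤ U i :=
  (σ.inter_le U 0).trans_eq (by rw [σ.first])

theorem Chain.inter_le_last (σ : Chain i j p) : σ.inter U ≤ U j :=
  (σ.inter_le U p).trans_eq (by rw [σ.last p le_rfl])

theorem Chain.inter_le_sub (σ : Chain i j p) (f : ℕ → ℕ) (q : ℕ) {v w : ι}
    (hv : σ.vertex (f 0) = v) (hw : σ.vertex (f q) = w) :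
    σ.inter U ≤ (σ.sub f q hv hw).inter U :=
  Finset.le_inf fun _ _ => σ.inter_le U _

theorem Chain.inter_le_front (σ : Chain i j p) (t : ℕ) : σ.inter U ≤ (σ.front t).inter U :=
  σ.inter_le_sub U _ _ _ _

theorem Chain.inter_le_back (σ : Chain i j p) (t : Fin (p + 1)) :
    σ.inter U ≤ (σ.back t).inter U :=
  σ.inter_le_sub U _ _ _ _

theorem Chain.inter_le_face (σ : Chain i j p) (s : Fin p) : σ.inter U ≤ (σ.face s).inter U :=
  σ.inter_le_sub U _ _ _ _

theorem Chain.inter_le_innerFace (σ : Chain i j p) (s : Fin (p - 1)) :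
    σ.inter U ≤ (σ.innerFace s).inter U :=
  σ.inter_le_sub U _ _ _ _

/-- A good cover: the sets `U i` cover `X` and every non-empty finite intersection
`U_{i₀} ∩ ⋯ ∩ U_{i_p}` is contractible. -/
structure IsGoodCover : Prop where
  covers : ⨆ i, U i = ⊤
  contractible : ∀ (i j : ι) (p : ℕ) (σ : Chain i j p),
    (σ.inter U : Set X).Nonempty → ContractibleSpace (σ.inter U)

end Chains

/-! ### Twisted complexes -/

section Twisted

variable {X : TopCat.{u}} (𝒜 : TopCat.Sheaf RingCat.{u} X)

/-- The complexes of `𝒜(V)`-modules, the objects of the dg-category `C_𝒜(V)`. The sheaf of rings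
`𝒜` need not be commutative; right modules are left modules over the opposite sheaf of rings. -/
abbrev Cpx (V : Opens X) := CochainComplex (ModuleCat.{u} (ringOn 𝒜 V)) ℤ

variable {𝒜} in
/-- The objects of the dg-category `P_𝒜(V)`: bounded complexes of finitely generated projective
`𝒜(V)`-modules. -/
structure IsCohesive {V : Opens X} (E : Cpx 𝒜 V) : Prop where
  bounded : ∃ N : ℤ, ∀ n : ℤ, N < |n| → Subsingleton (E.X n)
  finite : ∀ n, Module.Finite (ringOn 𝒜 V) (E.X n)
  projective : ∀ n, Module.Projective (ringOn 𝒜 V) (E.X n)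

/-- The restriction functor `C_𝒜(W) → C_𝒜(V)` on complexes, for `V ≤ W`. -/
abbrev restrCpx {V W : Opens X} (h : V ≤ W) : Cpx 𝒜 W ⥤ Cpx 𝒜 V :=
  (baseChange (res 𝒜 h)).mapHomologicalComplex _

variable {ι : Type u} (U : ι → Opens X)

/-- The elements of total degree `d` of `C^•(𝒰, Mor^•(E, F))`: the component of bidegree `(p, q)`,
where `p + q = d`, is for each tuple `(i₀, …, i_p)` a homogeneous map of degree `q` from the
restriction of `E_{i_p}` to the restriction of `F_{i₀}` over `U_{i₀} ∩ ⋯ ∩ U_{i_p}`. -/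
def TwHom (E F : ∀ i, Cpx 𝒜 (U i)) (d : ℤ) : Type u :=
  ∀ (p : ℕ) (i j : ι) (σ : Chain i j p) (m n : ℤ), m + d = n + p →
    (Restr 𝒜 (σ.inter_le_last U) ((E j).X m) →ₗ[ringOn 𝒜 (σ.inter U)]
      Restr 𝒜 (σ.inter_le_first U) ((F i).X n))

namespace TwHom

variable {𝒜 U} {E F G : ∀ i, Cpx 𝒜 (U i)}

/-- The Čech differential `(δu)_{i₀…i_p} = ∑_{s=1}^{p-1} (-1)^s u_{i₀…î_s…i_p}`. -/
def delta {d e : ℤ} (u : TwHom 𝒜 U E F d) (h : d + 1 = e) : TwHom 𝒜 U E F e :=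
  fun p i j σ m n hmn => ∑ s : Fin (p - 1), (-1 : ℤ) ^ ((s : ℕ) + 1) •
    shrinkHom 𝒜 (σ.inter_le_innerFace U s) _ _ _ _
      (u (p - 1) i j (σ.innerFace s) m n (by have := s.2; omega))

/-- The composition `(u · v)_{i₀…i_p} = ∑_t (-1)^{q r} u_{i₀…i_t} v_{i_t…i_p}`, where `q` is the
inner degree of the component of `u` and `r = p - t` the Čech degree of the component of `v`. -/
def comp {d₁ d₂ d : ℤ} (u : TwHom 𝒜 U F G d₁) (v : TwHom 𝒜 U E F d₂) (h : d₁ + d₂ = d) :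
    TwHom 𝒜 U E G d :=
  fun p i j σ m n hmn => ∑ t : Fin (p + 1), ((d₁ - (t : ℕ)) * ((p - t : ℕ) : ℤ)).negOnePow •
    (shrinkHom 𝒜 (σ.inter_le_front U t) _ (σ.inter_le U t) _ _
        (u t i (σ.vertex t) (σ.front t) (m + d₂ - (p - t : ℕ)) n (by omega)) ∘ₗ
      shrinkHom 𝒜 (σ.inter_le_back U t) _ _ _ (σ.inter_le U t)
        (v (p - t) (σ.vertex t) j (σ.back t) m (m + d₂ - (p - t : ℕ)) (by omega)))

variable (E) in
/-- The identity of `E_i^m`, restricted to `V`, with the indices written in two ways. -/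
def idMap {V : Opens X} {i j : ι} (hji : j = i) {m n : ℤ} (hmn : m = n) (hj : V ≤ U j)
    (hi : V ≤ U i) : Restr 𝒜 hj ((E j).X m) →ₗ[ringOn 𝒜 V] Restr 𝒜 hi ((E i).X n) := by
  subst hji hmn
  exact LinearMap.id

variable (E) in
/-- The identity: its component of bidegree `(0, 0)` is the identity, the others vanish. -/
def id : TwHom 𝒜 U E E 0 := fun p _ _ σ _ _ _ =>
  if hp : p = 0 then
    idMap E ((σ.last 0 hp.le).symm.trans σ.first) (by omega) _ _
  else 0

end TwHom

/-- A twisted complex `(E_i, a)`, `a = ∑_k a^{k,1-k}`, with values in `C_𝒜`. -/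
structure TwistedComplex where
  /-- The complexes `E_i`. -/
  obj : ∀ i, Cpx 𝒜 (U i)
  /-- The cochain `a` of total degree one. -/
  a : TwHom 𝒜 U obj obj 1
  /-- `a^{0,1}_i` is the differential of `E_i`. -/
  a_zero : ∀ (i : ι) (σ : Chain i i 0) (m n : ℤ) (h : m + 1 = n + (0 : ℕ)),
    a 0 i i σ m n h = BaseChange.map (res 𝒜 (σ.inter_le_first U)) ((obj i).d m n).hom
  /-- The Maurer-Cartan equation `δa + a · a = 0`. -/
  maurer_cartan : ∀ (p : ℕ) (i j : ι) (σ : Chain i j p) (m n : ℤ) (h : m + 2 = n + p),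
    a.delta (e := 2) rfl p i j σ m n h + a.comp a (d := 2) rfl p i j σ m n h = 0
  /-- `a^{1,0}_{ii}` is invertible up to homotopy. -/
  a_one : ∀ (i : ι) (σ : Chain i i 1),
    ∃ g : HomotopyEquiv ((restrCpx 𝒜 (σ.inter_le_first U)).obj (obj i))
      ((restrCpx 𝒜 (σ.inter_le_first U)).obj (obj i)),
    ∀ n, (g.hom.f n).hom = a 1 i i σ n n rfl

variable {𝒜 U}

/-- The twisted complexes with values in `P_𝒜`. -/
def TwistedComplex.IsPerfect (F : TwistedComplex 𝒜 U) : Prop := ∀ i, IsCohesive (F.obj i)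

namespace TwistedComplex

/-- The differential `dφ = δφ + b · φ - (-1)^{|φ|} φ · a` on the morphisms from `(E, a)` to
`(F, b)`. -/
def diff (E F : TwistedComplex 𝒜 U) {d e : ℤ} (φ : TwHom 𝒜 U E.obj F.obj d) (h : d + 1 = e) :
    TwHom 𝒜 U E.obj F.obj e := fun p i j σ m n hmn =>
  φ.delta h p i j σ m n hmn + F.a.comp φ (by omega) p i j σ m n hmn -
    d.negOnePow • φ.comp E.a h p i j σ m n hmn

/-- A morphism of degree zero is a homotopy equivalence if it is closed and has a closed inverse
up to homotopy. -/
def IsHomotopyEquiv (E F : TwistedComplex 𝒜 U) (φ : TwHom 𝒜 U E.obj F.obj 0) : Prop :=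
  (∀ p i j σ m n h, diff E F φ (e := 1) rfl p i j σ m n h = 0) ∧
  ∃ ψ : TwHom 𝒜 U F.obj E.obj 0,
    (∀ p i j σ m n h, diff F E ψ (e := 1) rfl p i j σ m n h = 0) ∧
    (∃ η : TwHom 𝒜 U E.obj E.obj (-1), ∀ p i j σ m n h,
      ψ.comp φ (d := 0) rfl p i j σ m n h - TwHom.id E.obj p i j σ m n h =
        diff E E η (e := 0) rfl p i j σ m n h) ∧
    (∃ η : TwHom 𝒜 U F.obj F.obj (-1), ∀ p i j σ m n h,
      φ.comp ψ (d := 0) rfl p i j σ m n h - TwHom.id F.obj p i j σ m n h =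
        diff F F η (e := 0) rfl p i j σ m n h)

/-! ### The sheafification functor -/

/-- The index set of the product that defines `S^n`: tuples `(i₀, …, i_p)` and `q` with
`p + q = n`. -/
structure SIdx (ι : Type u) (n : ℤ) where
  {p : ℕ}
  {i : ι}
  {j : ι}
  σ : Chain i j p
  q : ℤ
  h : q + p = n

variable (F : TwistedComplex 𝒜 U)

/-- `S^n(F) = ∏_{p+q=n} ∏_{i₀…i_p} F^q_{i₀}|_{U_{i₀…i_p}}`. -/
def SMod (n : ℤ) : Type u :=
  ∀ x : SIdx ι n, Restr 𝒜 (x.σ.inter_le_first U) ((F.obj x.i).X x.q)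

instance (n : ℤ) : AddCommGroup (F.SMod n) := inferInstanceAs (AddCommGroup
  (∀ x : SIdx ι n, Restr 𝒜 (x.σ.inter_le_first U) ((F.obj x.i).X x.q)))

variable {F} in
/-- The component `c_{i₀…i_p}` of bidegree `(p, q)`. -/
def SMod.comp {n : ℤ} (c : F.SMod n) {p : ℕ} {i j : ι} (σ : Chain i j p) (q : ℤ) (h : q + p = n) :
    Restr 𝒜 (σ.inter_le_first U) ((F.obj i).X q) :=
  c ⟨σ, q, h⟩

variable {F} in
/-- The product of `r ∈ 𝒜(X)` and `c`: `𝒜(X)` acts on the factors through the restriction maps. -/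
def SMod.smul {n : ℤ} (r : ringOn 𝒜 ⊤) (c : F.SMod n) : F.SMod n := fun x =>
  res 𝒜 (le_top : x.σ.inter U ≤ ⊤) r • c x

instance (n : ℤ) : Module (ringOn 𝒜 ⊤) (F.SMod n) where
  smul := SMod.smul
  one_smul c := funext fun x => by
    change res 𝒜 (le_top : x.σ.inter U ≤ ⊤) 1 • c x = c x
    rw [map_one, one_smul]
  mul_smul r s c := funext fun x => by
    change res 𝒜 (le_top : x.σ.inter U ≤ ⊤) (r * s) • c x =
      res 𝒜 (le_top : x.σ.inter U ≤ ⊤) r • res 𝒜 (le_top : x.σ.inter U ≤ ⊤) s • c x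
    rw [map_mul, mul_smul]
  smul_zero r := funext fun x => smul_zero (res 𝒜 (le_top : x.σ.inter U ≤ ⊤) r)
  smul_add r c c' := funext fun x => smul_add (res 𝒜 (le_top : x.σ.inter U ≤ ⊤) r) (c x) (c' x)
  add_smul r s c := funext fun x => by
    change res 𝒜 (le_top : x.σ.inter U ≤ ⊤) (r + s) • c x =
      res 𝒜 (le_top : x.σ.inter U ≤ ⊤) r • c x + res 𝒜 (le_top : x.σ.inter U ≤ ⊤) s • c x
    rw [map_add, add_smul]
  zero_smul c := funext fun x => by
    change res 𝒜 (le_top : x.σ.inter U ≤ ⊤) 0 • c x = 0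
    rw [map_zero, zero_smul]

variable {F}

theorem SMod.comp_add {n : ℤ} (c c' : F.SMod n) {p : ℕ} {i j : ι} (σ : Chain i j p) (q : ℤ)
    (h : q + p = n) : (c + c').comp σ q h = c.comp σ q h + c'.comp σ q h := rfl

theorem SMod.comp_smul {n : ℤ} (r : ringOn 𝒜 ⊤) (c : F.SMod n) {p : ℕ} {i j : ι}
    (σ : Chain i j p) (q : ℤ) (h : q + p = n) :
    (r • c).comp σ q h = res 𝒜 (le_top : σ.inter U ≤ ⊤) r • c.comp σ q h := rfl

theorem SMod.ext {n : ℤ} {c c' : F.SMod n}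
    (H : ∀ (p : ℕ) (i j : ι) (σ : Chain i j p) (q : ℤ) (h : q + p = n),
      c.comp σ q h = c'.comp σ q h) : c = c' :=
  funext fun x => H x.p x.i x.j x.σ x.q x.h

/-- The Čech part `(δc)_{i₀…i_p} = ∑_{s=1}^{p} (-1)^s c_{i₀…î_s…i_p}` of the differential. -/
def sDelta {n n' : ℤ} (hn : n + 1 = n') (c : F.SMod n) {p : ℕ} {i j : ι} (σ : Chain i j p) (q : ℤ)
    (h : q + p = n') : Restr 𝒜 (σ.inter_le_first U) ((F.obj i).X q) :=
  ∑ s : Fin p, (-1 : ℤ) ^ ((s : ℕ) + 1) •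
    shrink 𝒜 (σ.inter_le_face U s) _ (σ.inter_le_first U)
      (c.comp (σ.face s) q (by have := s.2; omega))

/-- The part `(a · c)_{i₀…i_p} = ∑_t (-1)^{(1-t)(p-t)} a_{i₀…i_t} c_{i_t…i_p}` of the
differential. -/
def sMul {n n' : ℤ} (hn : n + 1 = n') (c : F.SMod n) {p : ℕ} {i j : ι} (σ : Chain i j p) (q : ℤ)
    (h : q + p = n') : Restr 𝒜 (σ.inter_le_first U) ((F.obj i).X q) :=
  ∑ t : Fin (p + 1), ((1 - (t : ℕ)) * ((p - t : ℕ) : ℤ)).negOnePow •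
    shrinkHom 𝒜 (σ.inter_le_front U t) _ (σ.inter_le U t) _ (σ.inter_le_first U)
      (F.a t i (σ.vertex t) (σ.front t) (q + (t : ℕ) - 1) q (by omega))
      (shrink 𝒜 (σ.inter_le_back U t) _ (σ.inter_le U t)
        (c.comp (σ.back t) (q + (t : ℕ) - 1) (by omega)))

theorem negOnePow_smul_comm {V : Opens X} {M : Type u} [AddCommGroup M] [Module (ringOn 𝒜 V) M]
    (ε : ℤˣ) (r : ringOn 𝒜 V) (m : M) : ε • r • m = r • ε • m := by
  rcases Int.units_eq_one_or ε with rfl | rfl <;> simp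

variable (F)

/-- The differential `δ + a` of `S(F)`. -/
def sDiff {n n' : ℤ} (hn : n + 1 = n') : F.SMod n →ₗ[ringOn 𝒜 ⊤] F.SMod n' where
  toFun c := fun x => sDelta hn c x.σ x.q x.h + sMul hn c x.σ x.q x.h
  map_add' c c' := by
    refine SMod.ext fun p i j σ q h => ?_
    change sDelta hn (c + c') σ q h + sMul hn (c + c') σ q h =
      sDelta hn c σ q h + sMul hn c σ q h + (sDelta hn c' σ q h + sMul hn c' σ q h)
    simp only [SMod.comp_add, sDelta, sMul, map_add, smul_add, Finset.sum_add_distrib]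
    abel
  map_smul' r c := by
    refine SMod.ext fun p i j σ q h => ?_
    change sDelta hn (r • c) σ q h + sMul hn (r • c) σ q h =
      res 𝒜 (le_top : σ.inter U ≤ ⊤) r • (sDelta hn c σ q h + sMul hn c σ q h)
    simp only [SMod.comp_smul, sDelta, sMul, map_smulₛₗ, smul_add,
      Finset.smul_sum, Sec.res_res, RingHom.id_apply]
    congr 1
    · refine Finset.sum_congr rfl fun s _ => ?_
      rw [smul_comm]
    · refine Finset.sum_congr rfl fun t _ => ?_
      rw [negOnePow_smul_comm]

theorem sDiff_comp {n n' : ℤ} (hn : n + 1 = n') (c : F.SMod n) {p : ℕ} {i j : ι}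
    (σ : Chain i j p) (q : ℤ) (h : q + p = n') :
    (F.sDiff hn c).comp σ q h = sDelta hn c σ q h + sMul hn c σ q h := rfl

end TwistedComplex
end Twisted


section Shrink

variable {X : TopCat.{u}} (𝒜 : TopCat.Sheaf RingCat.{u} X) {V V' V'' W Y Z : Opens X}
  {M N P : Type u} [AddCommGroup M] [Module (ringOn 𝒜 W) M]
  [AddCommGroup N] [Module (ringOn 𝒜 Y) N] [AddCommGroup P] [Module (ringOn 𝒜 Z) P]

theorem shrink_self (h : V ≤ V) (hV : V ≤ W) (x : Restr 𝒜 hV M) : shrink 𝒜 h hV hV x = x := by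
  induction x using BaseChange.induction with
  | h0 => rw [map_zero]
  | ht s m => rw [shrink_tmul, Sec.res_self]
  | ha x y hx hy => rw [map_add, hx, hy]

theorem shrink_shrink (h : V' ≤ V) (h' : V'' ≤ V') (h'' : V'' ≤ V) (hV : V ≤ W) (hV' : V' ≤ W)
    (hV'' : V'' ≤ W) (x : Restr 𝒜 hV M) :
    shrink 𝒜 h' hV' hV'' (shrink 𝒜 h hV hV' x) = shrink 𝒜 h'' hV hV'' x := by
  induction x using BaseChange.induction with
  | h0 => simp only [map_zero]
  | ht s m => simp only [shrink_tmul, Sec.res_res]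
  | ha x y hx hy => simp only [map_add, hx, hy]

theorem shrinkHom_ext (h : V' ≤ V) (hV : V ≤ W) (hV' : V' ≤ W) (hY' : V' ≤ Y)
    {k l : Restr 𝒜 hV' M →ₗ[ringOn 𝒜 V'] Restr 𝒜 hY' N}
    (H : ∀ x : Restr 𝒜 hV M, k (shrink 𝒜 h hV hV' x) = l (shrink 𝒜 h hV hV' x)) : k = l := by
  apply BaseChange.hom_ext
  intro m
  have := H (BaseChange.tmul (res 𝒜 hV) 1 m)
  rwa [shrink_tmul, map_one] at this

theorem shrinkHom_shrinkHom (h : V' ≤ V) (h' : V'' ≤ V') (h'' : V'' ≤ V) (hV : V ≤ W)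
    (hV' : V' ≤ W) (hV'' : V'' ≤ W) (hY : V ≤ Y) (hY' : V' ≤ Y) (hY'' : V'' ≤ Y)
    (k : Restr 𝒜 hV M →ₗ[ringOn 𝒜 V] Restr 𝒜 hY N) :
    shrinkHom 𝒜 h' hV' hV'' hY' hY'' (shrinkHom 𝒜 h hV hV' hY hY' k) =
      shrinkHom 𝒜 h'' hV hV'' hY hY'' k := by
  refine shrinkHom_ext 𝒜 h'' hV hV'' hY'' fun x => ?_
  rw [shrinkHom_shrink, ← shrink_shrink 𝒜 h h' h'' hV hV' hV'', shrinkHom_shrink,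
    shrinkHom_shrink, shrink_shrink 𝒜 h h' h'']

theorem shrinkHom_comp (h : V' ≤ V) (hV : V ≤ W) (hV' : V' ≤ W) (hY : V ≤ Y) (hY' : V' ≤ Y)
    (hZ : V ≤ Z) (hZ' : V' ≤ Z) (l : Restr 𝒜 hY N →ₗ[ringOn 𝒜 V] Restr 𝒜 hZ P)
    (k : Restr 𝒜 hV M →ₗ[ringOn 𝒜 V] Restr 𝒜 hY N) :
    shrinkHom 𝒜 h hV hV' hZ hZ' (l ∘ₗ k) =
      shrinkHom 𝒜 h hY hY' hZ hZ' l ∘ₗ shrinkHom 𝒜 h hV hV' hY hY' k := by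
  refine shrinkHom_ext 𝒜 h hV hV' hZ' fun x => ?_
  rw [shrinkHom_shrink, LinearMap.comp_apply, LinearMap.comp_apply, shrinkHom_shrink,
    shrinkHom_shrink]

theorem shrinkHom_add (h : V' ≤ V) (hV : V ≤ W) (hV' : V' ≤ W) (hY : V ≤ Y) (hY' : V' ≤ Y)
    (k l : Restr 𝒜 hV M →ₗ[ringOn 𝒜 V] Restr 𝒜 hY N) :
    shrinkHom 𝒜 h hV hV' hY hY' (k + l) =
      shrinkHom 𝒜 h hV hV' hY hY' k + shrinkHom 𝒜 h hV hV' hY hY' l := by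
  refine shrinkHom_ext 𝒜 h hV hV' hY' fun x => ?_
  rw [shrinkHom_shrink, LinearMap.add_apply, LinearMap.add_apply, shrinkHom_shrink,
    shrinkHom_shrink, map_add]

/-- Restriction of linear maps as an additive map. -/
def shrinkHomAdd (h : V' ≤ V) (hV : V ≤ W) (hV' : V' ≤ W) (hY : V ≤ Y) (hY' : V' ≤ Y) :
    (Restr 𝒜 hV M →ₗ[ringOn 𝒜 V] Restr 𝒜 hY N) →+
      (Restr 𝒜 hV' M →ₗ[ringOn 𝒜 V'] Restr 𝒜 hY' N) :=
  AddMonoidHom.mk' (shrinkHom 𝒜 h hV hV' hY hY') (shrinkHom_add 𝒜 h hV hV' hY hY')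

end Shrink

namespace TwistedComplex

variable {X : TopCat.{u}} {𝒜 : TopCat.Sheaf RingCat.{u} X} {ι : Type u} {U : ι → Opens X}
  {F : TwistedComplex 𝒜 U}

section Square

variable {i j : ι} {K : ℕ} (σ : Chain i j K)

/-- The restriction to `U_{i₀…i_K}` of the component of `c` at `(i_{f 0}, …, i_{f p})`. -/
def cAt {n : ℤ} (c : F.SMod n) (f : ℕ → ℕ) (p : ℕ) {v : ι} (hV : σ.inter U ≤ U v) (q : ℤ) :
    Restr 𝒜 hV ((F.obj v).X q) :=
  open Classical in
  if h : σ.vertex (f 0) = v ∧ q + p = n then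
    shrink 𝒜 (σ.inter_le_sub U f p h.1 rfl) _ hV (c.comp (σ.sub f p h.1 rfl) q h.2)
  else 0

/-- The restriction to `U_{i₀…i_K}` of the component of `a` at `(i_{f 0}, …, i_{f p})`. -/
def aAt (f : ℕ → ℕ) (p : ℕ) {v w : ι} (hV : σ.inter U ≤ U v) (hW : σ.inter U ≤ U w) (m q : ℤ) :
    Restr 𝒜 hW ((F.obj w).X m) →ₗ[ringOn 𝒜 (σ.inter U)] Restr 𝒜 hV ((F.obj v).X q) :=
  open Classical in
  if h : σ.vertex (f 0) = v ∧ σ.vertex (f p) = w ∧ m + 1 = q + p then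
    shrinkHom 𝒜 (σ.inter_le_sub U f p h.1 h.2.1) _ hW _ hV
      (F.a p v w (σ.sub f p h.1 h.2.1) m q h.2.2)
  else 0

variable {σ}

theorem cAt_eq {n : ℤ} (c : F.SMod n) (f : ℕ → ℕ) {p : ℕ} {v w : ι} (hV : σ.inter U ≤ U v) {q : ℤ}
    (hv : σ.vertex (f 0) = v) (hq : q + p = n) (τ : Chain v w p) (hτ : σ.inter U ≤ τ.inter U)
    (H : ∀ x ≤ p, τ.vertex x = σ.vertex (f x)) :
    shrink 𝒜 hτ _ hV (c.comp τ q hq) = cAt σ c f p hV q := by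
  have hw : w = σ.vertex (f p) := by rw [← H p le_rfl, τ.last p le_rfl]
  subst hw
  have hτ' : τ = σ.sub f p hv rfl := by
    ext x
    rcases le_total x p with hx | hx
    · simp [Chain.sub, min_eq_left hx, H x hx]
    · simp [Chain.sub, min_eq_right hx, τ.last x hx]
  subst hτ'
  rw [cAt, dif_pos ⟨hv, hq⟩]

theorem aAt_eq (f : ℕ → ℕ) {p : ℕ} {v w : ι} (hV : σ.inter U ≤ U v) (hW : σ.inter U ≤ U w)
    {m q : ℤ} (hq : m + 1 = q + p) (τ : Chain v w p) (hτ : σ.inter U ≤ τ.inter U)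
    (H : ∀ x ≤ p, τ.vertex x = σ.vertex (f x)) :
    shrinkHom 𝒜 hτ _ hW _ hV (F.a p v w τ m q hq) = aAt σ f p hV hW m q := by
  have hv : σ.vertex (f 0) = v := by rw [← H 0 (Nat.zero_le _), τ.first]
  have hw : σ.vertex (f p) = w := by rw [← H p le_rfl, τ.last p le_rfl]
  have hτ' : τ = σ.sub f p hv hw := by
    ext x
    rcases le_total x p with hx | hx
    · simp [Chain.sub, min_eq_left hx, H x hx]
    · simp [Chain.sub, min_eq_right hx, τ.last x hx, hw]
  subst hτ'
  rw [aAt, dif_pos ⟨hv, hw, hq⟩]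

theorem cAt_congr {n : ℤ} (c : F.SMod n) {f g : ℕ → ℕ} {p : ℕ} {v : ι} (hV : σ.inter U ≤ U v)
    {q : ℤ} (H : ∀ x ≤ p, σ.vertex (f x) = σ.vertex (g x)) :
    cAt σ c f p hV q = cAt σ c g p hV q := by
  by_cases h : σ.vertex (f 0) = v ∧ q + p = n
  · rw [cAt, dif_pos h]
    refine cAt_eq c g hV ((H 0 (Nat.zero_le _)).symm.trans h.1) h.2 _ _ fun x hx => ?_
    simp [Chain.sub, min_eq_left hx, H x hx]
  · rw [cAt, cAt, dif_neg h, dif_neg]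
    rwa [← H 0 (Nat.zero_le _)]

theorem aAt_congr {f g : ℕ → ℕ} {p : ℕ} {v w : ι} (hV : σ.inter U ≤ U v) (hW : σ.inter U ≤ U w)
    {m q : ℤ} (H : ∀ x ≤ p, σ.vertex (f x) = σ.vertex (g x)) :
    aAt (F := F) σ f p hV hW m q = aAt σ g p hV hW m q := by
  by_cases h : σ.vertex (f 0) = v ∧ σ.vertex (f p) = w ∧ m + 1 = q + p
  · rw [aAt, dif_pos h]
    refine aAt_eq g hV hW h.2.2 _ _ fun x hx => ?_
    simp [Chain.sub, min_eq_left hx, H x hx]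
  · rw [aAt, aAt, dif_neg h, dif_neg]
    rwa [← H 0 (Nat.zero_le _), ← H p le_rfl]

/-- The product of the components of `a` and of `c` at two tuples that meet in `v`. -/
theorem aAt_cAt_congr {n : ℤ} (c : F.SMod n) {f f' g g' : ℕ → ℕ} {p r r' : ℕ} {v w w' : ι}
    (hV : σ.inter U ≤ U v) (hW : σ.inter U ≤ U w) (hW' : σ.inter U ≤ U w') {m m' q : ℤ}
    (hw : w = w') (hm : m = m') (hr : r = r')
    (H : ∀ x ≤ p, σ.vertex (f x) = σ.vertex (f' x))
    (H' : ∀ x ≤ r, σ.vertex (g x) = σ.vertex (g' x)) :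
    aAt σ f p hV hW m q (cAt σ c g r hW m) = aAt σ f' p hV hW' m' q (cAt σ c g' r' hW' m') := by
  subst hw hm hr
  rw [aAt_congr hV hW H, cAt_congr c hW H']

theorem cAt_sDiff {n n' : ℤ} (hn : n + 1 = n') (c : F.SMod n) (f : ℕ → ℕ) (p : ℕ) {v : ι}
    (hV : σ.inter U ≤ U v) (q : ℤ) (hv : σ.vertex (f 0) = v) (hq : q + p = n') :
    cAt σ (F.sDiff hn c) f p hV q =
      ∑ s ∈ Finset.range p, (-1 : ℤ) ^ (s + 1) •
        cAt σ c (fun x => f (skip (s + 1) x)) (p - 1) hV q +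
      ∑ t ∈ Finset.range (p + 1), ((1 - (t : ℕ)) * ((p - t : ℕ) : ℤ)).negOnePow •
        aAt σ f t hV (σ.inter_le U (f t)) (q + t - 1) q
          (cAt σ c (fun x => f (t + x)) (p - t) (σ.inter_le U (f t)) (q + t - 1)) := by
  rw [cAt, dif_pos ⟨hv, hq⟩, sDiff_comp, map_add, sDelta, sMul, map_sum, map_sum,
    ← Fin.sum_univ_eq_sum_range (fun s => (-1 : ℤ) ^ (s + 1) •
        cAt σ c (fun x => f (skip (s + 1) x)) (p - 1) hV q),
    ← Fin.sum_univ_eq_sum_range (fun t => ((1 - (t : ℕ)) * ((p - t : ℕ) : ℤ)).negOnePow •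
        aAt σ f t hV (σ.inter_le U (f t)) (q + t - 1) q
          (cAt σ c (fun x => f (t + x)) (p - t) (σ.inter_le U (f t)) (q + t - 1)))]
  congr 1
  · refine Finset.sum_congr rfl fun s _ => ?_
    rw [map_zsmul]
    congr 1
    rw [shrink_shrink 𝒜 _ _ ((σ.inter_le_sub U f p hv rfl).trans (Chain.inter_le_face U _ s))]
    refine cAt_eq c _ hV (by rw [skip_zero, hv]) _ _ _ fun x hx => ?_
    have hs := s.2
    simp only [Chain.face, Chain.sub]
    rw [min_eq_left hx, min_eq_left]
    unfold skip; split_ifs <;> omega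
  · refine Finset.sum_congr rfl fun t _ => ?_
    have ht : (t : ℕ) ≤ p := by omega
    rw [Units.smul_def, Units.smul_def, map_zsmul]
    congr 1
    have hvt : (σ.sub f p hv rfl).vertex t = σ.vertex (f t) := by
      simp [Chain.sub, min_eq_left ht]
    have hW : σ.inter U ≤ U ((σ.sub f p hv rfl).vertex t) := by
      rw [hvt]; exact σ.inter_le U (f t)
    rw [← shrinkHom_shrink 𝒜 (σ.inter_le_sub U f p hv rfl) _ hW _ hV,
      shrink_shrink 𝒜 _ _ ((σ.inter_le_sub U f p hv rfl).trans (Chain.inter_le_back U _ t)),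
      shrinkHom_shrinkHom 𝒜 _ _ ((σ.inter_le_sub U f p hv rfl).trans (Chain.inter_le_front U _ t)),
      aAt_eq f hV hW, cAt_eq c (fun x => f (t + x)) hW hvt.symm]
    · exact aAt_cAt_congr c hV hW (σ.inter_le U (f t)) hvt rfl rfl (fun _ _ => rfl) (fun _ _ => rfl)
    · intro x hx
      simp only [Chain.back, Chain.sub]
      rw [min_eq_left hx, min_eq_left (by omega)]
    · intro x hx
      simp only [Chain.front, Chain.sub]
      rw [min_eq_left hx, min_eq_left (by omega)]

theorem mc_at (T : ℕ) {v : ι} (hV : σ.inter U ≤ U i) (hW : σ.inter U ≤ U v)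
    (hv : σ.vertex T = v) (m q : ℤ) (hm : m + 2 = q + T) :
    ∑ s ∈ Finset.range (T - 1), (-1 : ℤ) ^ (s + 1) •
        aAt (F := F) σ (fun x => skip (s + 1) x) (T - 1) hV hW m q +
      ∑ t ∈ Finset.range (T + 1), ((1 - (t : ℕ)) * ((T - t : ℕ) : ℤ)).negOnePow •
        (aAt σ (fun x => x) t hV (σ.inter_le U t) (q + t - 1) q ∘ₗ
          aAt σ (fun x => t + x) (T - t) (σ.inter_le U t) hW m (q + t - 1)) = 0 := by
  subst hv
  have key := congrArg (shrinkHomAdd 𝒜 (σ.inter_le_front U T) _ hW _ hV)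
    (F.maurer_cartan T i (σ.vertex T) (σ.front T) m q hm)
  rw [map_zero, map_add, TwHom.delta, TwHom.comp, map_sum, map_sum] at key
  rw [← key, ← Fin.sum_univ_eq_sum_range (fun s => (-1 : ℤ) ^ (s + 1) •
        aAt (F := F) σ (fun x => skip (s + 1) x) (T - 1) hV hW m q),
    ← Fin.sum_univ_eq_sum_range (fun t => ((1 - (t : ℕ)) * ((T - t : ℕ) : ℤ)).negOnePow •
        (aAt (F := F) σ (fun x => x) t hV (σ.inter_le U t) (q + t - 1) q ∘ₗ
          aAt σ (fun x => t + x) (T - t) (σ.inter_le U t) hW m (q + t - 1)))]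
  congr 1
  · refine Finset.sum_congr rfl fun s _ => ?_
    have hs := s.2
    rw [map_zsmul]
    congr 1
    change _ = shrinkHom 𝒜 _ _ _ _ _ _
    rw [shrinkHom_shrinkHom 𝒜 _ _ ((σ.inter_le_front U T).trans (Chain.inter_le_innerFace U _ s))]
    refine (aAt_eq _ hV hW _ _ _ fun x hx => ?_).symm
    simp only [Chain.innerFace, Chain.front, Chain.sub]
    rw [min_eq_left hx, min_eq_left]
    unfold skip; split_ifs <;> omega
  · refine Finset.sum_congr rfl fun t _ => ?_
    have ht : (t : ℕ) ≤ T := by omega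
    rw [Units.smul_def, Units.smul_def, map_zsmul]
    congr 1
    have hvt : (σ.front T).vertex t = σ.vertex t := by
      simp [Chain.front, Chain.sub, min_eq_left ht]
    have hW' : σ.inter U ≤ U ((σ.front T).vertex t) := by
      rw [hvt]; exact σ.inter_le U t
    have hm' : m + 1 - ((T - t : ℕ) : ℤ) = q + t - 1 := by omega
    change _ = shrinkHom 𝒜 _ _ _ _ _ _
    rw [shrinkHom_comp 𝒜 _ _ hW _ hW' _ hV,
      shrinkHom_shrinkHom 𝒜 _ _ ((σ.inter_le_front U T).trans (Chain.inter_le_front U _ t)),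
      shrinkHom_shrinkHom 𝒜 _ _ ((σ.inter_le_front U T).trans (Chain.inter_le_back U _ t)),
      aAt_eq (fun x => x) hV hW', aAt_eq (fun x => t + x) hW' hW]
    · generalize (σ.front T).vertex t = w at hvt hW'
      generalize m + 1 - ((T - t : ℕ) : ℤ) = m' at hm'
      subst hvt hm'
      rfl
    · intro x hx
      simp only [Chain.back, Chain.front, Chain.sub]
      rw [min_eq_left hx, min_eq_left (by omega)]
    · intro x hx
      simp only [Chain.front, Chain.sub]
      rw [min_eq_left hx, min_eq_left (by omega)]

end Square

end TwistedComplex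


section Signs

variable {N : Type u} [AddCommGroup N]

theorem alternating_sum_eq_zero (K : ℕ) (H : ℕ → ℕ → N)
    (hH : ∀ s s', s ≤ s' → H s s' = H (s' + 1) s) :
    ∑ s ∈ Finset.range K, (-1 : ℤ) ^ (s + 1) •
      ∑ s' ∈ Finset.range (K - 1), (-1 : ℤ) ^ (s' + 1) • H s s' = 0 := by
  simp only [Finset.smul_sum, smul_smul]
  rw [← Finset.sum_product']
  refine Finset.sum_involution
    (fun x _ => if x.1 ≤ x.2 then (x.2 + 1, x.1) else (x.2, x.1 - 1)) ?_ ?_ ?_ ?_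
  · rintro ⟨s, s'⟩ _
    by_cases h : s ≤ s'
    · simp only [h, if_true, hH s s' h, ← add_smul]
      convert zero_smul ℤ _
      ring
    · obtain ⟨r, rfl⟩ : ∃ r, s = r + 1 := ⟨s - 1, by omega⟩
      have h' : s' ≤ r := by omega
      simp only [h, if_false, Nat.add_sub_cancel, hH s' r h', ← add_smul]
      convert zero_smul ℤ _
      ring
  · rintro ⟨s, s'⟩ _ _ h
    by_cases h' : s ≤ s'
    · simp only [h', if_true, Prod.mk.injEq] at h; omega
    · simp only [h', if_false, Prod.mk.injEq] at h; omega
  · rintro ⟨s, s'⟩ h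
    simp only [Finset.mem_product, Finset.mem_range] at h ⊢
    split_ifs <;> simp only <;> omega
  · rintro ⟨s, s'⟩ h
    by_cases h' : s ≤ s'
    · simp [h']
    · simp only [h', if_false]
      rw [if_pos (by omega)]
      exact Prod.ext (show s - 1 + 1 = s by omega) rfl

theorem negOnePow_natCast_smul (k : ℕ) (x : N) : (-1 : ℤ) ^ k • x = (k : ℤ).negOnePow • x := by
  rw [Units.smul_def, Int.coe_negOnePow_natCast]

theorem triple_sum_eq_zero (K : ℕ) (B C M R : ℕ → ℕ → N)
    (hB : ∀ s t, s < t → t < K → B s t = M (t + 1) s)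
    (hB' : ∀ s t, t ≤ s → s < K → B s t = C t (s - t))
    (hM : ∀ T ≤ K, ∑ s ∈ Finset.range (T - 1), (-1 : ℤ) ^ (s + 1) • M T s +
      ∑ t ∈ Finset.range (T + 1), ((1 - (t : ℤ)) * ((T - t : ℕ) : ℤ)).negOnePow • R t (T - t) = 0) :
    ∑ s ∈ Finset.range K, (-1 : ℤ) ^ (s + 1) • ∑ t ∈ Finset.range (K - 1 + 1),
        ((1 - (t : ℤ)) * ((K - 1 - t : ℕ) : ℤ)).negOnePow • B s t +
      (∑ t ∈ Finset.range (K + 1), ((1 - (t : ℤ)) * ((K - t : ℕ) : ℤ)).negOnePow •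
        ∑ s ∈ Finset.range (K - t), (-1 : ℤ) ^ (s + 1) • C t s +
      ∑ t ∈ Finset.range (K + 1), ((1 - (t : ℤ)) * ((K - t : ℕ) : ℤ)).negOnePow •
        ∑ t' ∈ Finset.range (K - t + 1),
          ((1 - (t' : ℤ)) * ((K - t - t' : ℕ) : ℤ)).negOnePow • R t t') = 0 := by
  have hsum : ∑ T ∈ Finset.range (K + 1), ((2 - (T : ℤ)) * ((K - T : ℕ) : ℤ)).negOnePow •
      (∑ s ∈ Finset.range (T - 1), (-1 : ℤ) ^ (s + 1) • M T s +
      ∑ t ∈ Finset.range (T + 1), ((1 - (t : ℤ)) * ((T - t : ℕ) : ℤ)).negOnePow •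
        R t (T - t)) = 0 :=
    Finset.sum_eq_zero fun T hT => by
      rw [hM T (by simpa [Nat.lt_succ_iff] using hT), smul_zero]
  simp only [negOnePow_natCast_smul, Finset.smul_sum, smul_add, Finset.sum_add_distrib, smul_smul,
    ← Int.negOnePow_add] at hsum ⊢
  have e1 : ∑ x ∈ Finset.range K, ∑ y ∈ Finset.range (K - 1 + 1),
      (((x + 1 : ℕ) : ℤ) + (1 - (y : ℤ)) * ((K - 1 - y : ℕ) : ℤ)).negOnePow • B x y =
      ∑ x ∈ Finset.range K ×ˢ Finset.range K,
      (((x.1 + 1 : ℕ) : ℤ) + (1 - (x.2 : ℤ)) * ((K - 1 - x.2 : ℕ) : ℤ)).negOnePow • B x.1 x.2 := by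
    rw [Finset.sum_product]
    rcases Nat.eq_zero_or_pos K with rfl | hK
    · simp
    · rw [Nat.sub_add_cancel hK]
  have e2 : ∑ x ∈ (Finset.range K ×ˢ Finset.range K) with x.1 < x.2,
      (((x.1 + 1 : ℕ) : ℤ) + (1 - (x.2 : ℤ)) * ((K - 1 - x.2 : ℕ) : ℤ)).negOnePow • B x.1 x.2 =
      ∑ T ∈ Finset.range (K + 1), ∑ s ∈ Finset.range (T - 1),
        ((2 - (T : ℤ)) * ((K - T : ℕ) : ℤ) + ((s + 1 : ℕ) : ℤ)).negOnePow • M T s := by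
    rw [Finset.sum_sigma']
    refine Finset.sum_nbij' (fun x => ⟨x.2 + 1, x.1⟩) (fun x => (x.2, x.1 - 1)) ?_ ?_ ?_ ?_ ?_
    · rintro ⟨s, t⟩ h
      simp only [Finset.mem_filter, Finset.mem_product, Finset.mem_range, Finset.mem_sigma] at h ⊢
      omega
    · rintro ⟨T, s⟩ h
      simp only [Finset.mem_filter, Finset.mem_product, Finset.mem_range, Finset.mem_sigma] at h ⊢
      omega
    · rintro ⟨s, t⟩ h
      simp
    · rintro ⟨T, s⟩ h
      simp only [Finset.mem_range, Finset.mem_sigma] at h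
      simp only [Nat.sub_add_cancel (show 1 ≤ T by omega)]
    · rintro ⟨s, t⟩ h
      simp only [Finset.mem_filter, Finset.mem_product, Finset.mem_range] at h
      rw [hB s t h.2 h.1.2]
      congr 1
      rw [Int.negOnePow_eq_iff]
      obtain ⟨k, rfl⟩ : ∃ k, K = t + 1 + k := ⟨K - (t + 1), by omega⟩
      rw [show t + 1 + k - 1 - t = k by omega, show t + 1 + k - (t + 1) = k by omega]
      push_cast
      exact ⟨0, by ring⟩
  have e3 : ∑ x ∈ (Finset.range K ×ˢ Finset.range K) with ¬ x.1 < x.2,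
      (((x.1 + 1 : ℕ) : ℤ) + (1 - (x.2 : ℤ)) * ((K - 1 - x.2 : ℕ) : ℤ)).negOnePow • B x.1 x.2 =
      - ∑ t ∈ Finset.range (K + 1), ∑ s ∈ Finset.range (K - t),
        ((1 - (t : ℤ)) * ((K - t : ℕ) : ℤ) + ((s + 1 : ℕ) : ℤ)).negOnePow • C t s := by
    rw [Finset.sum_sigma', ← Finset.sum_neg_distrib]
    refine Finset.sum_nbij' (fun x => ⟨x.2, x.1 - x.2⟩) (fun x => (x.2 + x.1, x.1)) ?_ ?_ ?_ ?_ ?_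
    · rintro ⟨s, t⟩ h
      simp only [Finset.mem_filter, Finset.mem_product, Finset.mem_range, Finset.mem_sigma] at h ⊢
      omega
    · rintro ⟨T, s⟩ h
      simp only [Finset.mem_filter, Finset.mem_product, Finset.mem_range, Finset.mem_sigma] at h ⊢
      omega
    · rintro ⟨s, t⟩ h
      simp only [Finset.mem_filter, Finset.mem_product, Finset.mem_range] at h
      exact Prod.ext (show s - t + t = s by omega) rfl
    · rintro ⟨T, s⟩ h
      simp
    · rintro ⟨s, t⟩ h
      simp only [Finset.mem_filter, Finset.mem_product, Finset.mem_range] at h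
      rw [hB' s t (by omega) (by omega), ← Units.neg_smul, ← Int.negOnePow_succ]
      congr 1
      rw [Int.negOnePow_eq_iff]
      obtain ⟨r, rfl⟩ : ∃ r, s = t + r := ⟨s - t, by omega⟩
      obtain ⟨k, rfl⟩ : ∃ k, K = t + 1 + k := ⟨K - (t + 1), by omega⟩
      simp only
      rw [show t + 1 + k - 1 - t = k by omega, show t + 1 + k - t = k + 1 by omega,
        show t + r - t = r by omega]
      push_cast
      exact ⟨t - 1, by ring⟩
  have e4 : ∑ T ∈ Finset.range (K + 1), ∑ t ∈ Finset.range (T + 1),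
        ((2 - (T : ℤ)) * ((K - T : ℕ) : ℤ) + (1 - (t : ℤ)) * ((T - t : ℕ) : ℤ)).negOnePow •
          R t (T - t) =
      ∑ t ∈ Finset.range (K + 1), ∑ t' ∈ Finset.range (K - t + 1),
        ((1 - (t : ℤ)) * ((K - t : ℕ) : ℤ) +
          (1 - (t' : ℤ)) * ((K - t - t' : ℕ) : ℤ)).negOnePow • R t t' := by
    rw [Finset.sum_sigma', Finset.sum_sigma']
    refine Finset.sum_nbij' (fun x => ⟨x.2, x.1 - x.2⟩) (fun x => ⟨x.1 + x.2, x.1⟩) ?_ ?_ ?_ ?_ ?_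
    · rintro ⟨s, t⟩ h
      simp only [Finset.mem_range, Finset.mem_sigma] at h ⊢
      omega
    · rintro ⟨T, s⟩ h
      simp only [Finset.mem_range, Finset.mem_sigma] at h ⊢
      omega
    · rintro ⟨T, t⟩ h
      simp only [Finset.mem_range, Finset.mem_sigma] at h
      simp only [Nat.add_sub_cancel' (show t ≤ T by omega)]
    · rintro ⟨T, s⟩ h
      simp
    · rintro ⟨T, t⟩ h
      simp only [Finset.mem_range, Finset.mem_sigma] at h
      congr 1
      rw [Int.negOnePow_eq_iff]
      obtain ⟨r, rfl⟩ : ∃ r, T = t + r := ⟨T - t, by omega⟩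
      obtain ⟨k, rfl⟩ : ∃ k, K = t + r + k := ⟨K - (t + r), by omega⟩
      simp only
      rw [show t + r + k - (t + r) = k by omega, show t + r - t = r by omega,
        show t + r + k - t = r + k by omega, show r + k - r = k by omega]
      push_cast
      exact ⟨0, by ring⟩
  rw [e1, ← Finset.sum_filter_add_sum_filter_not _ (fun x => x.1 < x.2), e2, e3, ← e4]
  rw [← hsum]
  abel

end Signs

namespace TwistedComplex

variable {X : TopCat.{u}} {𝒜 : TopCat.Sheaf RingCat.{u} X} {ι : Type u} {U : ι → Opens X}
  (F : TwistedComplex 𝒜 U)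

theorem skip_skip {s s' : ℕ} (h : s ≤ s') (x : ℕ) :
    skip (s + 1) (skip (s' + 1) x) = skip (s' + 1 + 1) (skip (s + 1) x) := by
  unfold skip; split_ifs <;> omega

theorem sDiff_sDiff {n n' n'' : ℤ} (hn : n + 1 = n') (hn' : n' + 1 = n'') (c : F.SMod n) :
    F.sDiff hn' (F.sDiff hn c) = 0 := by
  refine SMod.ext fun K i j σ q hq => ?_
  have hV := σ.inter_le_first U
  have h0 := cAt_eq (σ := σ) (F.sDiff hn' (F.sDiff hn c)) (fun x => x) hV σ.first hq σ le_rfl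
    (fun _ _ => rfl)
  rw [shrink_self] at h0
  rw [h0, cAt_sDiff hn' _ _ _ hV q σ.first hq]
  have hA : ∀ s ∈ Finset.range K, (-1 : ℤ) ^ (s + 1) •
      cAt σ (F.sDiff hn c) (fun x => skip (s + 1) x) (K - 1) hV q =
      (-1 : ℤ) ^ (s + 1) • (∑ s' ∈ Finset.range (K - 1), (-1 : ℤ) ^ (s' + 1) •
        cAt σ c (fun x => skip (s + 1) (skip (s' + 1) x)) (K - 1 - 1) hV q) +
      (-1 : ℤ) ^ (s + 1) • ∑ t ∈ Finset.range (K - 1 + 1),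
        ((1 - (t : ℤ)) * ((K - 1 - t : ℕ) : ℤ)).negOnePow •
        aAt σ (fun x => skip (s + 1) x) t hV (σ.inter_le U (skip (s + 1) t)) (q + t - 1) q
          (cAt σ c (fun x => skip (s + 1) (t + x)) (K - 1 - t) (σ.inter_le U (skip (s + 1) t))
            (q + t - 1)) := by
    intro s hs
    have := Finset.mem_range.1 hs
    rw [cAt_sDiff hn c _ _ hV q (by rw [skip_zero, σ.first]) (by omega), smul_add]
  have hB : ∀ t ∈ Finset.range (K + 1), ((1 - (t : ℤ)) * ((K - t : ℕ) : ℤ)).negOnePow •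
        aAt σ (fun x => x) t hV (σ.inter_le U t) (q + t - 1) q
          (cAt σ (F.sDiff hn c) (fun x => t + x) (K - t) (σ.inter_le U t) (q + t - 1)) =
      ((1 - (t : ℤ)) * ((K - t : ℕ) : ℤ)).negOnePow •
        (∑ s ∈ Finset.range (K - t), (-1 : ℤ) ^ (s + 1) •
          aAt σ (fun x => x) t hV (σ.inter_le U t) (q + t - 1) q
          (cAt σ c (fun x => t + skip (s + 1) x) (K - t - 1) (σ.inter_le U t) (q + t - 1))) +
      ((1 - (t : ℤ)) * ((K - t : ℕ) : ℤ)).negOnePow •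
        ∑ t' ∈ Finset.range (K - t + 1),
          ((1 - (t' : ℤ)) * ((K - t - t' : ℕ) : ℤ)).negOnePow •
          aAt σ (fun x => x) t hV (σ.inter_le U t) (q + t - 1) q
          (aAt σ (fun x => t + x) t' (σ.inter_le U t) (σ.inter_le U (t + t')) (q + t - 1 + t' - 1)
            (q + t - 1)
            (cAt σ c (fun x => t + (t' + x)) (K - t - t') (σ.inter_le U (t + t'))
              (q + t - 1 + t' - 1))) := by
    intro t ht
    have := Finset.mem_range.1 ht
    rw [cAt_sDiff hn c _ _ (σ.inter_le U t) (q + t - 1) rfl (by omega), map_add, smul_add,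
      map_sum, map_sum]
    simp only [map_zsmul, Units.smul_def]
  rw [Finset.sum_congr rfl hA, Finset.sum_congr rfl hB, Finset.sum_add_distrib,
    Finset.sum_add_distrib, alternating_sum_eq_zero K
      (fun s s' => cAt σ c (fun x => skip (s + 1) (skip (s' + 1) x)) (K - 1 - 1) hV q)
      (fun s s' h => cAt_congr c hV fun x _ => by rw [skip_skip h]), zero_add]
  refine triple_sum_eq_zero K _ _ (fun T s =>
    aAt σ (fun x => skip (s + 1) x) (T - 1) hV (σ.inter_le U T) (q + T - 1 - 1) q
      (cAt σ c (fun x => T + x) (K - T) (σ.inter_le U T) (q + T - 1 - 1))) _ ?_ ?_ ?_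
  · intro s t hst htK
    refine aAt_cAt_congr c hV _ _ ?_ (by push_cast; ring) (by omega) (fun _ _ => rfl) ?_
    · congr 1; unfold skip; split_ifs <;> omega
    · intro x _
      congr 1; unfold skip; split_ifs <;> omega
  · intro s t hts hsK
    refine aAt_cAt_congr c hV _ _ ?_ rfl (by omega) ?_ ?_
    · congr 1; unfold skip; split_ifs <;> omega
    · intro x _
      congr 1; unfold skip; split_ifs <;> omega
    · intro x _
      congr 1; unfold skip; split_ifs <;> omega
  · intro T hT
    have h := congrArg (fun g => g (cAt σ c (fun x => T + x) (K - T) (σ.inter_le U T)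
      (q + T - 1 - 1))) (mc_at (F := F) (σ := σ) T hV (σ.inter_le U T) rfl (q + T - 1 - 1) q
        (by ring))
    rw [LinearMap.zero_apply, LinearMap.add_apply, LinearMap.sum_apply, LinearMap.sum_apply] at h
    rw [← h]
    congr 1
    refine Finset.sum_congr rfl fun t ht => ?_
    have ht' : t ≤ T := by have := Finset.mem_range.1 ht; omega
    rw [Units.smul_def, Units.smul_def, LinearMap.smul_apply, LinearMap.comp_apply]
    congr 2
    refine aAt_cAt_congr c _ _ _ ?_ ?_ (by omega) (fun _ _ => rfl) ?_
    · rw [Nat.add_sub_cancel' ht']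
    · push_cast [ht']; ring
    · intro x _
      congr 1; omega

/-- The complex `S(F)` of `𝒜(X)`-modules. -/
def sheafify : Cpx 𝒜 (⊤ : Opens X) where
  X n := ModuleCat.of (ringOn 𝒜 ⊤) (F.SMod n)
  d n n' := if h : n + 1 = n' then ModuleCat.ofHom (F.sDiff h) else 0
  shape n n' h := dif_neg h
  d_comp_d' n n' n'' h h' := by
    rw [dif_pos (show n + 1 = n' from h), dif_pos (show n' + 1 = n'' from h')]
    apply ModuleCat.hom_ext
    ext c
    exact F.sDiff_sDiff h h' c

end TwistedComplex


/-! ### The twisting functor and the counit -/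

section Spread

variable {X : TopCat.{u}} (𝒜 : TopCat.Sheaf RingCat.{u} X) {V V' W Y Z : Opens X}
  {M N P Q : Type u} [AddCommGroup M] [Module (ringOn 𝒜 ⊤) M]
  [AddCommGroup N] [Module (ringOn 𝒜 ⊤) N] [AddCommGroup P] [Module (ringOn 𝒜 ⊤) P]
  [AddCommGroup Q] [Module (ringOn 𝒜 V) Q]

/-- The `𝒜(V)`-linear map `(M|_W)|_V → Q`, `s ⊗ (t ⊗ m) ↦ s t • k m`, that extends an additive map
`k : M → Q` that is semilinear along `𝒜(X) → 𝒜(V)`. -/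
def spread (hW : V ≤ W) (k : M →+ Q)
    (hk : ∀ (r : ringOn 𝒜 ⊤) m, k (r • m) = res 𝒜 (le_top : V ≤ ⊤) r • k m) :
    Restr 𝒜 hW (Restr 𝒜 (le_top : W ≤ ⊤) M) →ₗ[ringOn 𝒜 V] Q :=
  BaseChange.lift (res 𝒜 hW) (RingHom.id _)
    (BaseChange.lift (res 𝒜 (le_top : W ≤ ⊤)) (res 𝒜 hW) k
      (fun r m => by rw [Sec.res_res, hk])).toAddMonoidHom
    (fun r x => (BaseChange.lift (res 𝒜 (le_top : W ≤ ⊤)) (res 𝒜 hW) k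
      (fun r m => by rw [Sec.res_res, hk])).map_smulₛₗ r x)

theorem spread_tmul (hW : V ≤ W) (k : M →+ Q)
    (hk : ∀ (r : ringOn 𝒜 ⊤) m, k (r • m) = res 𝒜 (le_top : V ≤ ⊤) r • k m)
    (s : ringOn 𝒜 V) (t : ringOn 𝒜 W) (m : M) :
    spread 𝒜 hW k hk (BaseChange.tmul (res 𝒜 hW) s (BaseChange.tmul (res 𝒜 le_top) t m)) =
      s • res 𝒜 hW t • k m := rfl

/-- The map `N → (N|_W)|_V`, `n ↦ 1 ⊗ (1 ⊗ n)`. -/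
def unit₂ (hW : V ≤ W) : N →+ Restr 𝒜 hW (Restr 𝒜 (le_top : W ≤ ⊤) N) :=
  (BaseChange.unit (res 𝒜 hW)).comp (BaseChange.unit (res 𝒜 (le_top : W ≤ ⊤)))

theorem unit₂_smul (hW : V ≤ W) (r : ringOn 𝒜 ⊤) (n : N) :
    unit₂ 𝒜 hW (r • n) = res 𝒜 (le_top : V ≤ ⊤) r • unit₂ 𝒜 hW n := by
  rw [unit₂, AddMonoidHom.comp_apply, AddMonoidHom.comp_apply, BaseChange.unit_smul,
    BaseChange.unit_smul, Sec.res_res]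

/-- The map `M|_V → N|_V` induced by an `𝒜(X)`-linear map `k : M → N`, where the restriction of
`M` is formed through `Y` and the one of `N` through `W`. -/
def spreadHom (hY : V ≤ Y) (hW : V ≤ W) (k : M →ₗ[ringOn 𝒜 ⊤] N) :
    Restr 𝒜 hY (Restr 𝒜 (le_top : Y ≤ ⊤) M) →ₗ[ringOn 𝒜 V]
      Restr 𝒜 hW (Restr 𝒜 (le_top : W ≤ ⊤) N) :=
  spread 𝒜 hY ((unit₂ 𝒜 hW).comp k.toAddMonoidHom) (fun r m => by
    change unit₂ 𝒜 hW (k (r • m)) = _ • unit₂ 𝒜 hW (k m)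
    rw [map_smul, unit₂_smul])

theorem spreadHom_unit₂ (hY : V ≤ Y) (hW : V ≤ W) (k : M →ₗ[ringOn 𝒜 ⊤] N) (m : M) :
    spreadHom 𝒜 hY hW k (unit₂ 𝒜 hY m) = unit₂ 𝒜 hW (k m) := by
  change (1 : ringOn 𝒜 V) • res 𝒜 hY 1 • unit₂ 𝒜 hW (k m) = unit₂ 𝒜 hW (k m)
  rw [map_one, one_smul, one_smul]

theorem spread_ext (hW : V ≤ W)
    {k l : Restr 𝒜 hW (Restr 𝒜 (le_top : W ≤ ⊤) M) →ₗ[ringOn 𝒜 V] Q}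
    (h : ∀ m, k (unit₂ 𝒜 hW m) = l (unit₂ 𝒜 hW m)) : k = l := by
  apply BaseChange.hom_ext
  intro x
  induction x using BaseChange.induction with
  | h0 => rw [BaseChange.tmul_zero, map_zero, map_zero]
  | ht t m =>
    rw [BaseChange.tmul_eq_smul (res 𝒜 le_top) t m, ← BaseChange.tmul_map, one_mul,
      BaseChange.tmul_eq_smul (res 𝒜 hW), map_smul, map_smul]
    exact congrArg (res 𝒜 hW t • ·) (h m)
  | ha x y hx hy => rw [BaseChange.tmul_add, map_add, map_add, hx, hy]

theorem spreadHom_comp (hY : V ≤ Y) (hW : V ≤ W) (hZ : V ≤ Z) (k : M →ₗ[ringOn 𝒜 ⊤] N)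
    (l : N →ₗ[ringOn 𝒜 ⊤] P) :
    spreadHom 𝒜 hW hZ l ∘ₗ spreadHom 𝒜 hY hW k = spreadHom 𝒜 hY hZ (l ∘ₗ k) :=
  spread_ext 𝒜 hY fun m => by
    rw [LinearMap.comp_apply, spreadHom_unit₂, spreadHom_unit₂, spreadHom_unit₂,
      LinearMap.comp_apply]

theorem spreadHom_zero (hY : V ≤ Y) (hW : V ≤ W) :
    spreadHom 𝒜 hY hW (0 : M →ₗ[ringOn 𝒜 ⊤] N) = 0 :=
  spread_ext 𝒜 hY fun m => by
    rw [spreadHom_unit₂, LinearMap.zero_apply, map_zero, LinearMap.zero_apply]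

theorem spreadHom_id (hY : V ≤ Y) :
    spreadHom 𝒜 hY hY (LinearMap.id : M →ₗ[ringOn 𝒜 ⊤] M) = LinearMap.id :=
  spread_ext 𝒜 hY fun m => by
    rw [spreadHom_unit₂, LinearMap.id_apply, LinearMap.id_apply]

theorem spreadHom_eq_map (hY : V ≤ Y) (k : M →ₗ[ringOn 𝒜 ⊤] N) :
    spreadHom 𝒜 hY hY k = BaseChange.map (res 𝒜 hY) (BaseChange.map (res 𝒜 le_top) k) :=
  spread_ext 𝒜 hY fun m => by
    rw [spreadHom_unit₂]
    simp [unit₂]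

theorem shrinkHom_spreadHom (h : V' ≤ V) (hY : V ≤ Y) (hY' : V' ≤ Y) (hW : V ≤ W) (hW' : V' ≤ W)
    (k : M →ₗ[ringOn 𝒜 ⊤] N) :
    shrinkHom 𝒜 h hY hY' hW hW' (spreadHom 𝒜 hY hW k) = spreadHom 𝒜 hY' hW' k := by
  have hu : ∀ {L : Type u} [AddCommGroup L] [Module (ringOn 𝒜 ⊤) L] {T : Opens X} (hT : V ≤ T)
      (hT' : V' ≤ T) (x : L), unit₂ 𝒜 hT' x = shrink 𝒜 h hT hT' (unit₂ 𝒜 hT x) := by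
    intro L _ _ T hT hT' x
    change _ = shrink 𝒜 h hT hT' (BaseChange.tmul (res 𝒜 hT) 1 _)
    rw [shrink_tmul, map_one]
    rfl
  refine spread_ext 𝒜 hY' fun m => ?_
  rw [spreadHom_unit₂, hu hY hY', shrinkHom_shrink, spreadHom_unit₂, hu hW hW']

end Spread

section Twist

variable {X : TopCat.{u}} {𝒜 : TopCat.Sheaf RingCat.{u} X} {ι : Type u} (U : ι → Opens X)

/-- The maps that define the twisted complex of a complex `E`: its differential in Čech degree
zero, the identity in Čech degree one, and zero in higher Čech degree. -/
def twistCoeff (E : Cpx 𝒜 (⊤ : Opens X)) (p : ℕ) (m n : ℤ) :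
    E.X m →ₗ[ringOn 𝒜 (⊤ : Opens X)] E.X n :=
  if p = 0 then (E.d m n).hom
  else if h : p = 1 ∧ m = n then (E.XIsoOfEq h.2).hom.hom
  else 0

/-- The cochain `a` of the twisted complex of a complex `E`. -/
def twistA (E : Cpx 𝒜 (⊤ : Opens X)) :
    TwHom 𝒜 U (fun i => (restrCpx 𝒜 (le_top : U i ≤ ⊤)).obj E)
      (fun i => (restrCpx 𝒜 (le_top : U i ≤ ⊤)).obj E) 1 :=
  fun p _ _ σ m n _ =>
    spreadHom 𝒜 (σ.inter_le_last U) (σ.inter_le_first U) (twistCoeff E p m n)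

theorem twistCoeff_of_two_le (E : Cpx 𝒜 (⊤ : Opens X)) {p : ℕ} (hp : 2 ≤ p) (m n : ℤ) :
    twistCoeff E p m n = 0 := by
  rw [twistCoeff, if_neg (by omega), dif_neg (by omega)]

theorem twistCoeff_one_self (E : Cpx 𝒜 (⊤ : Opens X)) (m : ℤ) :
    twistCoeff E 1 m m = LinearMap.id := by
  rw [twistCoeff, if_neg one_ne_zero, dif_pos ⟨rfl, rfl⟩]
  simp [HomologicalComplex.XIsoOfEq]

theorem twistCoeff_zero (E : Cpx 𝒜 (⊤ : Opens X)) (m n : ℤ) :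
    twistCoeff E 0 m n = (E.d m n).hom := if_pos rfl

theorem twistCoeff_comp (E : Cpx 𝒜 (⊤ : Opens X)) {p : ℕ} (hp : 3 ≤ p) (t : Fin (p + 1))
    (m k n : ℤ) : twistCoeff E t k n ∘ₗ twistCoeff E (p - t) m k = 0 := by
  by_cases ht : 2 ≤ (t : ℕ)
  · rw [twistCoeff_of_two_le E ht, LinearMap.zero_comp]
  · rw [twistCoeff_of_two_le E (p := p - t) (by omega), LinearMap.comp_zero]

theorem twist_sum_eq_zero {N : Type u} [AddCommGroup N] (p : ℕ) (D : N) (C : Fin (p + 1) → N)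
    (h0 : p = 0 → ∀ t, C t = 0) (h1 : p = 1 → C 0 = C (Fin.last p))
    (h2 : p = 2 → ∀ t : Fin (p + 1), (t : ℕ) ≠ 1 → C t = 0)
    (h2' : p = 2 → ∀ t : Fin (p + 1), (t : ℕ) = 1 → C t = D) (h3 : 3 ≤ p → D = 0)
    (h3' : 3 ≤ p → ∀ t, C t = 0) :
    ∑ s : Fin (p - 1), (-1 : ℤ) ^ ((s : ℕ) + 1) • D +
      ∑ t : Fin (p + 1), ((1 - (t : ℕ)) * ((p - t : ℕ) : ℤ)).negOnePow • C t = 0 := by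
  rcases (by omega : p = 0 ∨ p = 1 ∨ p = 2 ∨ 3 ≤ p) with rfl | rfl | rfl | hp
  · simp [h0 rfl]
  · have h := h1 rfl
    simp only [Fin.last] at h
    simp [Fin.sum_univ_two, h]
  · simp [Fin.sum_univ_three, h2 rfl 0 (by simp), h2' rfl 1 (by simp), h2 rfl 2 (by simp)]
  · simp [h3 hp, h3' hp]

theorem twistA_maurer_cartan (E : Cpx 𝒜 (⊤ : Opens X)) (p : ℕ) (i j : ι) (σ : Chain i j p)
    (m n : ℤ) (h : m + 2 = n + p) :
    (twistA U E).delta (e := 2) rfl p i j σ m n h +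
      (twistA U E).comp (twistA U E) (d := 2) rfl p i j σ m n h = 0 := by
  simp only [TwHom.delta, TwHom.comp, twistA]
  have h1 : ∀ s : Fin (p - 1), shrinkHom 𝒜 (σ.inter_le_innerFace U s)
      ((σ.innerFace s).inter_le_last U) (σ.inter_le_last U) ((σ.innerFace s).inter_le_first U)
      (σ.inter_le_first U) (spreadHom 𝒜 ((σ.innerFace s).inter_le_last U)
        ((σ.innerFace s).inter_le_first U) (twistCoeff E (p - 1) m n)) =
      spreadHom 𝒜 (σ.inter_le_last U) (σ.inter_le_first U) (twistCoeff E (p - 1) m n) :=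
    fun s => shrinkHom_spreadHom 𝒜 _ _ _ _ _ _
  have h2 : ∀ t : Fin (p + 1),
      (shrinkHom 𝒜 (σ.inter_le_front U t) ((σ.front t).inter_le_last U) (σ.inter_le U t)
        ((σ.front t).inter_le_first U) (σ.inter_le_first U)
        (spreadHom 𝒜 ((σ.front t).inter_le_last U) ((σ.front t).inter_le_first U)
          (twistCoeff E t (m + 1 - (p - t : ℕ)) n))) ∘ₗ
      (shrinkHom 𝒜 (σ.inter_le_back U t) ((σ.back t).inter_le_last U) (σ.inter_le_last U)
        ((σ.back t).inter_le_first U) (σ.inter_le U t)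
        (spreadHom 𝒜 ((σ.back t).inter_le_last U) ((σ.back t).inter_le_first U)
          (twistCoeff E (p - t) m (m + 1 - (p - t : ℕ))))) =
      spreadHom 𝒜 (σ.inter_le_last U) (σ.inter_le_first U)
        (twistCoeff E t (m + 1 - (p - t : ℕ)) n ∘ₗ
          twistCoeff E (p - t) m (m + 1 - (p - t : ℕ))) := fun t => by
    rw [shrinkHom_spreadHom, shrinkHom_spreadHom, spreadHom_comp]
  refine (congrArg₂ (· + ·) (Finset.sum_congr rfl fun s _ => congrArg _ (h1 s))
    (Finset.sum_congr rfl fun t _ => congrArg _ (h2 t))).trans ?_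
  clear h1 h2
  refine twist_sum_eq_zero p _ _ ?_ ?_ ?_ ?_ ?_ ?_
  · rintro rfl t
    obtain rfl : t = 0 := Fin.ext (by omega)
    have h3 : twistCoeff E 0 (m + 1 - (0 : ℕ)) n ∘ₗ twistCoeff E 0 m (m + 1 - (0 : ℕ)) = 0 := by
      rw [twistCoeff_zero, twistCoeff_zero, ← ModuleCat.hom_comp, E.d_comp_d]
      rfl
    exact (congrArg _ h3).trans (spreadHom_zero 𝒜 _ _)
  · rintro rfl
    refine congrArg _ ?_
    obtain rfl : m + 1 = n := by omega
    have h3 : ∀ k l, k = m → l = m + 1 →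
        twistCoeff E 0 k (m + 1) ∘ₗ twistCoeff E 1 m k =
        twistCoeff E 1 l (m + 1) ∘ₗ twistCoeff E 0 m l := by
      rintro _ _ rfl rfl
      rw [twistCoeff_one_self, twistCoeff_one_self, LinearMap.comp_id, LinearMap.id_comp]
    exact h3 _ _ (by simp) (by simp)
  · rintro rfl t ht
    have h3 := t.2
    refine (congrArg _ ?_).trans (spreadHom_zero 𝒜 _ _)
    rcases (by omega : (t : ℕ) = 0 ∨ (t : ℕ) = 2) with h4 | h4
    · rw [twistCoeff_of_two_le E (p := 2 - t) (by omega), LinearMap.comp_zero]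
    · rw [twistCoeff_of_two_le E (p := t) (by omega), LinearMap.zero_comp]
  · rintro rfl t ht
    obtain rfl : t = 1 := Fin.ext ht
    refine congrArg _ ?_
    obtain rfl : m = n := by omega
    have h3 : ∀ k, k = m → twistCoeff E 1 k m ∘ₗ twistCoeff E 1 m k = twistCoeff E 1 m m := by
      rintro _ rfl
      rw [twistCoeff_one_self, LinearMap.comp_id]
    exact h3 _ (by simp)
  · intro hp
    exact (congrArg _ (twistCoeff_of_two_le E (by omega) m n)).trans (spreadHom_zero 𝒜 _ _)
  · intro hp t
    exact (congrArg _ (twistCoeff_comp E hp t _ _ _)).trans (spreadHom_zero 𝒜 _ _)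

/-- The twisting functor on objects: `T(E)_i = E|_{U_i}`, `a^{0,1}` is the differential,
`a^{1,0} = id` and `a^{k,1-k} = 0` for `k ≥ 2`. -/
def twist (E : Cpx 𝒜 (⊤ : Opens X)) : TwistedComplex 𝒜 U where
  obj i := (restrCpx 𝒜 (le_top : U i ≤ ⊤)).obj E
  a := twistA U E
  a_zero i σ m n h := by
    rw [twistA, twistCoeff_zero]
    exact spreadHom_eq_map 𝒜 _ _
  maurer_cartan p i j σ m n h := twistA_maurer_cartan U E p i j σ m n h
  a_one i σ := ⟨HomotopyEquiv.refl _, fun n => by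
    rw [twistA, twistCoeff_one_self]
    exact (spreadHom_id 𝒜 _).symm⟩

/-- The twisting functor on a morphism of complexes, as a morphism of degree zero. -/
def twistMap {E E' : Cpx 𝒜 (⊤ : Opens X)} (φ : E ⟶ E') :
    TwHom 𝒜 U (twist U E).obj (twist U E').obj 0 :=
  fun p _ _ σ m n h =>
    if hp : p = 0 then
      spreadHom 𝒜 (σ.inter_le_last U) (σ.inter_le_first U)
        (φ.f m ≫ (E'.XIsoOfEq (show m = n by omega)).hom).hom
    else 0

variable {U} in
/-- The counit `η_F : T(S(F)) → F` of the adjunction: its component at `(i₀, …, i_p)` is the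
`𝒜(U_{i₀…i_p})`-linear extension of the projection `c ↦ c_{i₀…i_p}`. -/
def counit (F : TwistedComplex 𝒜 U) : TwHom 𝒜 U (twist U F.sheafify).obj F.obj 0 :=
  fun _ _ _ σ m n h =>
    spread 𝒜 (σ.inter_le_last U)
      (AddMonoidHom.mk' (fun c : F.SMod m => c.comp σ n (by omega)) (fun _ _ => rfl))
      (fun _ _ => rfl)

end Twist

end TwistedDescent

end

open TwistedDescent

/-! Softness turns the sheaf theory into algebra. For `V ≤ W` the restriction 𝒜⁰(W) → 𝒜⁰(V) is
surjective, and Urysohn functions provide, for finitely many elements of its kernel I, a common left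
unit inside I. Hence M|_V is M / IM, restriction is exact (`baseChange_preservesHomology`), and
vanishing, finite generation and projectivity of a module can be tested on a finite cover
(`IsSoft.isDescentFamily`). Projectivity is the delicate one; it rests on a patching argument for
two ideals with local units (`IsProjectiveMod.inf`).

The geometric input is that evaluation S(F)|_{U_k} → F_k is a quasi-isomorphism (`quasiIso_evAt`).
If ρ is supported in U_l, then appending l to a tuple and multiplying by ρ is a homotopy between
multiplication by ρ and c ↦ S_l(c_l), where S_l(y) has the components ±ρ a_{i₀…i_p l} y
(`sDiff_sHtpy_add`). Summation over a partition of unity reconstructs c, up to a boundary, from its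
components c_l. Over U_k only c_l on U_l ∩ U_k matters, and there closedness says that c_l is a_{lk}
c_k up to a boundary, which gives injectivity on cohomology. For surjectivity a cocycle x is spread
out as ∑ S_l(a_{lk} x₀) with a_{kk} x₀ cohomologous to x; the Maurer-Cartan equation on the tuples
(k, l, k) identifies its component at k.

So S(F) is locally quasi-isomorphic to a bounded complex of finitely generated projectives, and
`exists_perfect_of_local` makes this global by induction on the cohomological amplitude: the top
cohomology is killed by a finite free module, and a single remaining cohomology module is finitely
generated projective by descent. This yields φ : E → S(F).

The composite of the counit with T(φ) is the adjoint morphism `eval φ`, which is closed because φ is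
a map of complexes (`diff_eval`). Its Čech degree zero part over U_k is the restriction of φ
followed by evaluation: a quasi-isomorphism of bounded complexes of projectives, hence a homotopy
equivalence. Such a morphism θ is invertible up to homotopy: the cone of composition with θ is
complete and separated for the Čech filtration, closed elements are boundaries up to higher
filtration, and so they are boundaries (`ApproxInverse.exists_primitive`). Primitives for classes
built from the identities are the inverse and the homotopies. -/

noncomputable section

namespace TwistedDescent

/-! ### Germs, extension of sections and Urysohn functions for soft sheaves of rings. -/

section SoftSections

variable {X : TopCat.{u}} (𝒜 : TopCat.Sheaf RingCat.{u} X)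

/-- The class of a section over an open neighbourhood `V` of `K`. -/
def Sec.ofOpen {K : Set X} (V : Opens X) (hV : K ⊆ V) (t : 𝒜.presheaf.obj (op V)) : Sec 𝒜 K :=
  Sec.mk 𝒜 (⟨OrderDual.toDual V, hV⟩ : Nhds K) t

theorem Sec.exists_ofOpen {K : Set X} (r : Sec 𝒜 K) :
    ∃ (V : Opens X) (hV : K ⊆ V) (t : 𝒜.presheaf.obj (op V)), r = Sec.ofOpen 𝒜 V hV t := by
  induction r using DirectLimit.induction with
  | _ V t => exact ⟨OrderDual.ofDual V.1, V.2, t, rfl⟩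

theorem Sec.ofOpen_res {K : Set X} {V W : Opens X} (hW : K ⊆ W) (h : W ≤ V) (hV : K ⊆ V)
    (t : 𝒜.presheaf.obj (op V)) :
    Sec.ofOpen 𝒜 W hW ((𝒜.presheaf.map (homOfLE h).op).hom t) = Sec.ofOpen 𝒜 V hV t :=
  (DirectLimit.eq_of_le (f := nhdsMap 𝒜 K)
    (⟨⟨OrderDual.toDual V, hV⟩, t⟩ : Σ V : Nhds K, nhdsRing 𝒜 K V)
    ⟨OrderDual.toDual W, hW⟩ h).symm

theorem Sec.ofOpen_zero {K : Set X} (V : Opens X) (hV : K ⊆ V) : Sec.ofOpen 𝒜 V hV 0 = 0 :=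
  (DirectLimit.zero_def (f := nhdsMap 𝒜 K) ⟨OrderDual.toDual V, hV⟩).symm

theorem Sec.ofOpen_one {K : Set X} (V : Opens X) (hV : K ⊆ V) : Sec.ofOpen 𝒜 V hV 1 = 1 :=
  (DirectLimit.one_def (f := nhdsMap 𝒜 K) ⟨OrderDual.toDual V, hV⟩).symm

theorem Sec.res_ofOpen {K L : Set X} (h : K ⊆ L) (V : Opens X) (hV : L ⊆ V)
    (t : 𝒜.presheaf.obj (op V)) :
    Sec.res 𝒜 h (Sec.ofOpen 𝒜 V hV t) = Sec.ofOpen 𝒜 V (h.trans hV) t := rfl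

theorem Sec.ofOpen_eq_zero {K : Set X} {V : Opens X} (hV : K ⊆ V) {t : 𝒜.presheaf.obj (op V)}
    (h : Sec.ofOpen 𝒜 V hV t = 0) :
    ∃ (W : Opens X) (hWV : W ≤ V), K ⊆ W ∧ (𝒜.presheaf.map (homOfLE hWV).op).hom t = 0 := by
  rw [← Sec.ofOpen_zero 𝒜 V hV] at h
  obtain ⟨W, h1, h2, h3⟩ := Quotient.exact h
  refine ⟨OrderDual.ofDual W.1, h1, W.2, ?_⟩
  exact h3.trans (map_zero _)

/-- A section vanishes if all its germs vanish. -/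
theorem Sec.eq_zero_of_germ {K : Set X} (r : Sec 𝒜 K)
    (h : ∀ x (hx : x ∈ K), Sec.res 𝒜 (Set.singleton_subset_iff.2 hx) r = 0) : r = 0 := by
  obtain ⟨V, hV, t, rfl⟩ := Sec.exists_ofOpen 𝒜 r
  have h' : ∀ x : K, ∃ (W : Opens X) (hWV : W ≤ V), {x.1} ⊆ (W : Set X) ∧
      (𝒜.presheaf.map (homOfLE hWV).op).hom t = 0 := fun x =>
    Sec.ofOpen_eq_zero 𝒜 _ (h x.1 x.2)
  choose W hWV hxW hW using h'
  have hle : iSup W ≤ V := iSup_le hWV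
  have hK : K ⊆ (iSup W : Opens X) := fun x hx =>
    (le_iSup W ⟨x, hx⟩ : W ⟨x, hx⟩ ≤ iSup W) (hxW ⟨x, hx⟩ rfl)
  rw [← Sec.ofOpen_res 𝒜 hK hle hV, ← Sec.ofOpen_zero 𝒜 (iSup W) hK]
  congr 1
  refine TopCat.Sheaf.eq_of_locally_eq 𝒜 W _ _ fun i => ?_
  have h1 : (𝒜.presheaf.map (Opens.leSupr W i).op).hom
      ((𝒜.presheaf.map (homOfLE hle).op).hom t) = 0 := by
    rw [← hW i, ← RingHom.comp_apply, ← RingCat.hom_comp, ← Functor.map_comp]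
    rfl
  exact h1.trans (map_zero _).symm

theorem Sec.res_eq_zero_iff {K L : Set X} (h : K ⊆ L) (r : Sec 𝒜 L) :
    Sec.res 𝒜 h r = 0 ↔
      ∀ x (hx : x ∈ K), Sec.res 𝒜 (Set.singleton_subset_iff.2 (h hx)) r = 0 := by
  refine ⟨fun h0 x hx => ?_, fun h0 => Sec.eq_zero_of_germ 𝒜 _ fun x hx => ?_⟩
  · rw [← Sec.res_res 𝒜 (Set.singleton_subset_iff.2 hx) h, h0, map_zero]
  · rw [Sec.res_res]
    exact h0 x hx

variable {𝒜}

/-- The ring of global sections. -/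
abbrev GlobalRing (𝒜 : TopCat.Sheaf RingCat.{u} X) : Type u := ringOn 𝒜 (⊤ : Opens X)

theorem mem_closure_top (x : X) : x ∈ closure ((⊤ : Opens X) : Set X) :=
  subset_closure trivial

/-- The germ of a global section. -/
def germ (x : X) : GlobalRing 𝒜 →+* Sec 𝒜 {x} :=
  Sec.res 𝒜 (Set.singleton_subset_iff.2 (mem_closure_top x))

theorem eq_of_germ_eq {r s : GlobalRing 𝒜} (h : ∀ x, germ x r = germ x s) : r = s := by
  rw [← sub_eq_zero]
  refine Sec.eq_zero_of_germ 𝒜 _ fun x _ => ?_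
  change germ x (r - s) = 0
  rw [map_sub, h, sub_self]

theorem res_eq_zero_iff_germ {V : Opens X} (r : GlobalRing 𝒜) :
    res 𝒜 (le_top : V ≤ ⊤) r = 0 ↔ ∀ x ∈ closure (V : Set X), germ x r = 0 :=
  Sec.res_eq_zero_iff 𝒜 _ r

/-- A germ is an element of a direct limit, so it vanishes at x only if a representative vanishes on
a neighbourhood of x. -/
theorem isOpen_germ_eq_zero (r : GlobalRing 𝒜) : IsOpen {x | germ x r = 0} := by
  rw [isOpen_iff_forall_mem_open]
  intro x hx
  obtain ⟨V, hV, t, rfl⟩ := Sec.exists_ofOpen 𝒜 r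
  obtain ⟨W, hWV, hxW, hW⟩ := Sec.ofOpen_eq_zero 𝒜 _ hx
  refine ⟨W, fun y hy => ?_, W.2, hxW rfl⟩
  have h1 := Sec.ofOpen_res 𝒜 (Set.singleton_subset_iff.2 hy) hWV
    ((Set.singleton_subset_iff.2 (mem_closure_top y)).trans hV) t
  refine h1.symm.trans ?_
  exact (congrArg _ hW).trans (Sec.ofOpen_zero 𝒜 W _)

theorem IsSoft.surjective_res_closed (h𝒜 : IsSoft 𝒜) {K : Set X} (hK : IsClosed K)
    (h : K ⊆ closure ((⊤ : Opens X) : Set X)) : Function.Surjective (Sec.res 𝒜 h) := by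
  intro y
  obtain ⟨r, rfl⟩ := h𝒜 K hK y
  exact ⟨Sec.res 𝒜 (Set.subset_univ _) r, Sec.res_res 𝒜 _ _ r⟩

theorem IsSoft.surjective_res (h𝒜 : IsSoft 𝒜) {V W : Opens X} (h : V ≤ W) : Function.Surjective (res 𝒜 h) := by
  intro y
  obtain ⟨r, rfl⟩ := h𝒜.surjective_res_closed isClosed_closure (closure_mono le_top) y
  exact ⟨res 𝒜 le_top r, Sec.res_res 𝒜 _ _ r⟩

/-- Urysohn functions in a soft sheaf of rings. -/
theorem IsSoft.exists_urysohn (h𝒜 : IsSoft 𝒜) [NormalSpace X] {K L : Set X} (hK : IsClosed K) (hL : IsClosed L)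
    (hKL : Disjoint K L) :
    ∃ e : GlobalRing 𝒜, (∀ x ∈ K, germ x e = 0) ∧ ∀ x ∈ L, germ x e = 1 := by
  obtain ⟨V, W, hV, hW, hKV, hLW, hVW⟩ := normal_separation hK hL hKL
  -- The section to be extended is 0 near K and 1 near L, glued over disjoint neighbourhoods.
  let O : Bool → Opens X := fun b => cond b ⟨W, hW⟩ ⟨V, hV⟩
  let sf : ∀ b : Bool, 𝒜.presheaf.obj (op (O b)) := fun b => Bool.rec 0 1 b
  have hO : ∀ i j, i ≠ j → O i ⊓ O j = ⊥ := by
    have h0 : O true ⊓ O false = ⊥ :=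
      le_bot_iff.1 fun x hx => hVW.le_bot ⟨hx.2, hx.1⟩
    have h1 : O false ⊓ O true = ⊥ :=
      le_bot_iff.1 fun x hx => hVW.le_bot hx
    rintro (_ | _) (_ | _) h
    exacts [(h rfl).elim, h1, h0, (h rfl).elim]
  have hc : TopCat.Presheaf.IsCompatible 𝒜.1 O sf := by
    intro i j
    by_cases hij : i = j
    · subst hij
      rfl
    -- The overlap is empty, so the empty family covers it and any two sections over it agree.
    · refine TopCat.Sheaf.eq_of_locally_eq' 𝒜 (fun e : Empty => e.elim) _ (fun e => e.elim) ?_ _ _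
        (fun e => e.elim)
      rw [hO i j hij]
      exact bot_le
  obtain ⟨s, hs, -⟩ := TopCat.Sheaf.existsUnique_gluing 𝒜 O sf hc
  have hle : ∀ b, O b ≤ iSup O := le_iSup O
  have hKL' : K ∪ L ⊆ (iSup O : Opens X) := by
    rintro x (hx | hx)
    · exact hle false (hKV hx)
    · exact hle true (hLW hx)
  obtain ⟨e, he⟩ := h𝒜.surjective_res_closed (hK.union hL)
    (show K ∪ L ⊆ closure ((⊤ : Opens X) : Set X) from fun x _ => mem_closure_top x) (Sec.ofOpen 𝒜 (iSup O) hKL' s)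
  have hg : ∀ b x (hx : x ∈ K ∪ L) (hb : x ∈ O b), germ x e =
      Sec.ofOpen 𝒜 (O b) (Set.singleton_subset_iff.2 hb) (sf b) := by
    intro b x hx hb
    have h1 : germ x e = Sec.res 𝒜 (Set.singleton_subset_iff.2 hx) (Sec.ofOpen 𝒜 (iSup O) hKL' s) := by
      rw [← he, Sec.res_res]
      rfl
    rw [h1, Sec.res_ofOpen, ← Sec.ofOpen_res 𝒜 (Set.singleton_subset_iff.2 hb) (hle b)]
    congr 1
    exact hs b
  refine ⟨e, fun x hx => ?_, fun x hx => ?_⟩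
  · exact (hg false x (Or.inl hx) (hKV hx)).trans (Sec.ofOpen_zero 𝒜 _ _)
  · exact (hg true x (Or.inr hx) (hLW hx)).trans (Sec.ofOpen_one 𝒜 _ _)

end SoftSections

/-! ### Local units in the kernels of restriction, and partitions of unity. -/

/-- A ring homomorphism whose kernel has local left units. -/
def HasLocalUnits {R S : Type u} [Ring R] [Ring S] (f : R →+* S) : Prop :=
  ∀ s : Finset R, (∀ a ∈ s, f a = 0) → ∃ e, f e = 0 ∧ ∀ a ∈ s, e * a = a

section SoftSections

variable {X : TopCat.{u}} {𝒜 : TopCat.Sheaf RingCat.{u} X}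

/-- The common zero set Z of the germs of the given sections is open and contains the closure of V.
A Urysohn function e that is 0 on this closure and 1 outside Z is the required unit: at each point
either e is 1 or all the given sections are 0. -/
theorem IsSoft.hasLocalUnits_top (h𝒜 : IsSoft 𝒜) [NormalSpace X] (V : Opens X) :
    HasLocalUnits (res 𝒜 (le_top : V ≤ ⊤)) := by
  intro s hs
  let Z : Set X := ⋂ a ∈ s, {x | germ x a = 0}
  have hZ : IsOpen Z := isOpen_biInter_finset fun a _ => isOpen_germ_eq_zero a
  have hVZ : closure (V : Set X) ⊆ Z := fun x hx => Set.mem_iInter₂.2 fun a ha =>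
    (res_eq_zero_iff_germ a).1 (hs a ha) x hx
  obtain ⟨e, he0, he1⟩ := h𝒜.exists_urysohn isClosed_closure hZ.isClosed_compl
    (Set.disjoint_compl_right_iff_subset.2 hVZ)
  refine ⟨e, (res_eq_zero_iff_germ e).2 he0, fun a ha => eq_of_germ_eq fun x => ?_⟩
  rw [map_mul]
  by_cases hx : x ∈ Z
  · have h0 : germ x a = 0 := Set.mem_iInter₂.1 hx a ha
    rw [h0, mul_zero]
  · rw [he1 x hx, one_mul]

/-- Lifts to global sections of the given elements still vanish over V, so the unit found on X can
be restricted to W. -/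
theorem IsSoft.hasLocalUnits (h𝒜 : IsSoft 𝒜) [NormalSpace X] {V W : Opens X} (h : V ≤ W) :
    HasLocalUnits (res 𝒜 h) := by
  classical
  intro s hs
  have hsurj := h𝒜.surjective_res (le_top : W ≤ ⊤)
  obtain ⟨e, he0, he1⟩ := h𝒜.hasLocalUnits_top V (s.image (Function.surjInv hsurj)) (by
    intro a ha
    obtain ⟨b, hb, rfl⟩ := Finset.mem_image.1 ha
    rw [← Sec.res_res 𝒜 (closure_mono h) (closure_mono le_top)]
    change res 𝒜 h (res 𝒜 le_top _) = 0
    rw [Function.surjInv_eq hsurj, hs b hb])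
  refine ⟨res 𝒜 le_top e, by rwa [Sec.res_res], fun a ha => ?_⟩
  have := congrArg (res 𝒜 (le_top : W ≤ ⊤)) (he1 _ (Finset.mem_image_of_mem _ ha))
  rwa [map_mul, Function.surjInv_eq hsurj] at this

/-- A partition of unity subordinate to a finite open cover. -/
theorem IsSoft.exists_partition (h𝒜 : IsSoft 𝒜) [NormalSpace X] {ι : Type u} [Fintype ι] (U : ι → Opens X)
    (hU : ⨆ i, U i = ⊤) :
    ∃ ρ : ι → GlobalRing 𝒜, ∑ i, ρ i = 1 ∧ ∀ i x, x ∉ U i → germ x (ρ i) = 0 := by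
  classical
  obtain ⟨L, hL, hLc, hLU⟩ := exists_iUnion_eq_closed_subset (u := fun i => (U i : Set X))
    (fun i => (U i).2) (fun _ => Set.toFinite _) (by
      rw [← Opens.coe_iSup, hU]
      rfl)
  have he : ∀ i, ∃ e : GlobalRing 𝒜, (∀ x ∈ (U i : Set X)ᶜ, germ x e = 0) ∧
      ∀ x ∈ L i, germ x e = 1 := fun i =>
    h𝒜.exists_urysohn (U i).2.isClosed_compl (hLc i)
      (Set.disjoint_compl_left_iff_subset.2 (hLU i))
  choose e he0 he1 using he
  -- The new function is `(1 - ∑ ρ j) * e k`, which makes the remainder `1 - ∑ ρ j` the product of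
  -- the factors `1 - e k`. The factor of k vanishes along `L k`, and the sets `L k` cover X.
  have key : ∀ s : Finset ι, ∃ ρ : ι → GlobalRing 𝒜, (∀ i x, x ∉ U i → germ x (ρ i) = 0) ∧
      ∀ i ∈ s, ∀ x ∈ L i, germ x (1 - ∑ j ∈ s, ρ j) = 0 := by
    intro s
    induction s using Finset.induction_on with
    | empty => exact ⟨0, fun i x _ => map_zero _, by simp⟩
    | insert k s hk ih =>
      obtain ⟨ρ, h1, h2⟩ := ih
      refine ⟨Function.update ρ k ((1 - ∑ j ∈ s, ρ j) * e k), fun i x hx => ?_, ?_⟩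
      · by_cases hik : i = k
        · subst hik
          rw [Function.update_self, map_mul, he0 i x hx, mul_zero]
        · rw [Function.update_of_ne hik, h1 i x hx]
      · have hsum : 1 - ∑ j ∈ insert k s, Function.update ρ k ((1 - ∑ j ∈ s, ρ j) * e k) j =
            (1 - ∑ j ∈ s, ρ j) * (1 - e k) := by
          have h3 : ∑ j ∈ s, Function.update ρ k ((1 - ∑ j ∈ s, ρ j) * e k) j = ∑ j ∈ s, ρ j :=
            Finset.sum_congr rfl fun j hj =>
              Function.update_of_ne (ne_of_mem_of_not_mem hj hk) _ _
          rw [Finset.sum_insert hk, Function.update_self, h3]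
          noncomm_ring
        intro i hi x hx
        rw [hsum, map_mul]
        rcases Finset.mem_insert.1 hi with rfl | hi
        · rw [map_sub, map_one, map_sub, he1 _ x hx, map_one, sub_self, mul_zero]
        · rw [h2 i hi x hx, zero_mul]
  obtain ⟨ρ, h1, h2⟩ := key Finset.univ
  refine ⟨ρ, (sub_eq_zero.1 (eq_of_germ_eq fun x => ?_)).symm, h1⟩
  obtain ⟨i, hi⟩ := Set.mem_iUnion.1 (hL.ge (Set.mem_univ x))
  rw [h2 i (Finset.mem_univ i) x hi, map_zero]

end SoftSections

/-! ### Ideals with local units and descent of modules -/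

section LocalUnits

variable {R : Type u} [Ring R]

/-- A two-sided ideal such that every finite subset has a common left unit in the ideal. -/
structure IsLocallyUnital (I : Ideal R) : Prop where
  mul_mem_right : ∀ a ∈ I, ∀ r : R, a * r ∈ I
  exists_unit : ∀ s : Finset R, (∀ a ∈ s, a ∈ I) → ∃ e ∈ I, ∀ a ∈ s, e * a = a

/-- If e in I and g in J are left units for the same finite set, so is `g * e`, which lies in both
ideals because they are two-sided. -/
theorem IsLocallyUnital.inf {I J : Ideal R} (hI : IsLocallyUnital I) (hJ : IsLocallyUnital J) :
    IsLocallyUnital (I ⊓ J) where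
  mul_mem_right a ha r := ⟨hI.mul_mem_right a ha.1 r, hJ.mul_mem_right a ha.2 r⟩
  exists_unit s hs := by
    obtain ⟨e, he, h1⟩ := hI.exists_unit s fun a ha => (hs a ha).1
    obtain ⟨g, hg, h2⟩ := hJ.exists_unit s fun a ha => (hs a ha).2
    exact ⟨g * e, ⟨I.mul_mem_left g he, hJ.mul_mem_right g hg e⟩, fun a ha => by
      rw [mul_assoc, h1 a ha, h2 a ha]⟩

theorem IsLocallyUnital.top : IsLocallyUnital (⊤ : Ideal R) where
  mul_mem_right _ _ _ := trivial
  exists_unit _ _ := ⟨1, trivial, fun a _ => one_mul a⟩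

theorem IsLocallyUnital.finset_inf {ι : Type*} {I : ι → Ideal R} (s : Finset ι)
    (h : ∀ i ∈ s, IsLocallyUnital (I i)) : IsLocallyUnital (s.inf I) := by
  classical
  induction s using Finset.induction_on with
  | empty => exact IsLocallyUnital.top
  | insert k s hk ih =>
    rw [Finset.inf_insert]
    exact (h k (Finset.mem_insert_self k s)).inf
      (ih fun i hi => h i (Finset.mem_insert_of_mem hi))

variable {M N P : Type u} [AddCommGroup M] [Module R M] [AddCommGroup N] [Module R N]
  [AddCommGroup P] [Module R P] {I J : Ideal R}

/-- The submodule `I M`. -/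
def IsLocallyUnital.sub (hI : IsLocallyUnital I) (M : Type u) [AddCommGroup M] [Module R M] :
    Submodule R M where
  -- Local units allow this description in place of finite sums of products: a common unit for e and
  -- e' fixes the sum of two such elements.
  carrier := {m | ∃ e ∈ I, e • m = m}
  zero_mem' := ⟨0, I.zero_mem, smul_zero 0⟩
  add_mem' := by
    classical
    rintro m m' ⟨e, he, h⟩ ⟨e', he', h'⟩
    obtain ⟨g, hg, h2⟩ := hI.exists_unit {e, e'} (by simp [he, he'])
    refine ⟨g, hg, ?_⟩
    rw [smul_add, ← h, ← h', smul_smul, smul_smul, h2 e (by simp), h2 e' (by simp)]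
  smul_mem' := by
    rintro r m ⟨e, he, h⟩
    obtain ⟨g, hg, h2⟩ := hI.exists_unit {r * e} (by simpa using I.mul_mem_left r he)
    refine ⟨g, hg, ?_⟩
    rw [← h, smul_smul r e m, smul_smul, h2 (r * e) (by simp)]

theorem IsLocallyUnital.smul_mem_sub (hI : IsLocallyUnital I) {a : R} (ha : a ∈ I) (m : M) :
    a • m ∈ hI.sub M := by
  obtain ⟨g, hg, h⟩ := hI.exists_unit {a} (by simpa using ha)
  exact ⟨g, hg, by rw [smul_smul, h a (by simp)]⟩

theorem IsLocallyUnital.map_mem_sub (hI : IsLocallyUnital I) (f : M →ₗ[R] N) {m : M}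
    (hm : m ∈ hI.sub M) : f m ∈ hI.sub N := by
  obtain ⟨e, he, h⟩ := hm
  exact ⟨e, he, by rw [← map_smul, h]⟩

theorem IsLocallyUnital.exists_of_mem_sub (hI : IsLocallyUnital I) {f : M →ₗ[R] N}
    (hf : Function.Surjective f) {n : N} (hn : n ∈ hI.sub N) : ∃ m ∈ hI.sub M, f m = n := by
  obtain ⟨e, he, h⟩ := hn
  obtain ⟨m, rfl⟩ := hf n
  exact ⟨e • m, hI.smul_mem_sub he m, by rw [map_smul, h]⟩

/-- This is the identity IM ∩ JM = (I ∩ J)M, which makes M / (I ∩ J)M the fibre product of M / IM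
and M / JM over M / (IM + JM). -/
theorem IsLocallyUnital.sub_inf (hI : IsLocallyUnital I) (hJ : IsLocallyUnital J) {m : M}
    (h1 : m ∈ hI.sub M) (h2 : m ∈ hJ.sub M) : m ∈ (hI.inf hJ).sub M := by
  obtain ⟨e, he, h⟩ := h1
  obtain ⟨g, hg, h'⟩ := h2
  exact ⟨g * e, ⟨I.mul_mem_left g he, hJ.mul_mem_right g hg e⟩, by rw [mul_smul, h, h']⟩

/-- `P / I P` is projective over `R / I`, expressed by lifting along surjections between modules
that are annihilated by `I`. -/
def IsProjectiveMod (I : Ideal R) (P : Type u) [AddCommGroup P] [Module R P] : Prop :=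
  ∀ (M N : Type u) [AddCommGroup M] [Module R M] [AddCommGroup N] [Module R N]
    (f : M →ₗ[R] N) (g : P →ₗ[R] N), Function.Surjective f → (∀ a ∈ I, ∀ m : M, a • m = 0) →
    ∃ h : P →ₗ[R] M, f ∘ₗ h = g

/-- Patching of projectivity over two closed sets. -/
theorem IsProjectiveMod.inf (hI : IsLocallyUnital I) (hJ : IsLocallyUnital J)
    (h1 : IsProjectiveMod I P) (h2 : IsProjectiveMod J P) : IsProjectiveMod (I ⊓ J) P := by
  intro M N _ _ _ _ f g hf hM
  -- Since I ∩ J kills M, the submodules IM and JM meet in zero and M embeds into M / IM × M / JM;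
  -- the same holds for the quotient N of M.
  have hM0 : ∀ m : M, m ∈ hI.sub M → m ∈ hJ.sub M → m = 0 := fun m h h' => by
    obtain ⟨e, he, hem⟩ := hI.sub_inf hJ h h'
    rw [← hem, hM e he]
  have hN0 : ∀ n : N, n ∈ hI.sub N → n ∈ hJ.sub N → n = 0 := fun n h h' => by
    obtain ⟨e, he, hen⟩ := hI.sub_inf hJ h h'
    obtain ⟨m, rfl⟩ := hf n
    rw [← hen, ← map_smul, hM e he, map_zero]
  have kill : ∀ {K : Ideal R} (hK : IsLocallyUnital K), ∀ a ∈ K, ∀ x : M ⧸ hK.sub M,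
      a • x = 0 := by
    intro K hK a ha x
    obtain ⟨m, rfl⟩ := Submodule.mkQ_surjective _ x
    rw [← map_smul]
    exact (Submodule.Quotient.mk_eq_zero _).2 (hK.smul_mem_sub ha m)
  -- Projectivity modulo K lifts g only as a map to N / KN, so the lift is correct up to an error in
  -- KN.
  have lifts : ∀ {K : Ideal R} (hK : IsLocallyUnital K), IsProjectiveMod K P →
      ∃ h : P →ₗ[R] M ⧸ hK.sub M, ∀ p m, h p = (hK.sub M).mkQ m → f m - g p ∈ hK.sub N := by
    intro K hK hP
    obtain ⟨h, hh⟩ := hP _ _ ((hK.sub M).mapQ (hK.sub N) f fun m hm => hK.map_mem_sub f hm)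
      ((hK.sub N).mkQ ∘ₗ g) (by
        intro y
        obtain ⟨n, rfl⟩ := Submodule.mkQ_surjective _ y
        obtain ⟨m, rfl⟩ := hf n
        exact ⟨(hK.sub M).mkQ m, rfl⟩) (kill hK)
    refine ⟨h, fun p m hm => ?_⟩
    have := LinearMap.congr_fun hh p
    rw [LinearMap.comp_apply, hm] at this
    exact (Submodule.Quotient.eq _).1 this
  obtain ⟨u, hu⟩ := lifts hI h1
  obtain ⟨v, hv⟩ := lifts hJ h2
  -- the difference of the two lifts lies in the image of `ker f`
  let S : Submodule R M := hI.sub M ⊔ hJ.sub M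
  let u' : P →ₗ[R] M ⧸ S := (hI.sub M).mapQ S LinearMap.id le_sup_left ∘ₗ u
  let v' : P →ₗ[R] M ⧸ S := (hJ.sub M).mapQ S LinearMap.id le_sup_right ∘ₗ v
  let L : Submodule R M := LinearMap.ker f
  let D : Submodule R (M ⧸ S) := L.map S.mkQ
  have hD : ∀ p, (u' - v') p ∈ D := by
    intro p
    obtain ⟨m, hm⟩ := Submodule.mkQ_surjective _ (u p)
    obtain ⟨m', hm'⟩ := Submodule.mkQ_surjective _ (v p)
    obtain ⟨x, hx, hx'⟩ := hI.exists_of_mem_sub hf (hu p m hm.symm)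
    obtain ⟨y, hy, hy'⟩ := hJ.exists_of_mem_sub hf (hv p m' hm'.symm)
    refine ⟨(m - x) - (m' - y), ?_, ?_⟩
    · change f _ = 0
      rw [map_sub, map_sub, map_sub, hx', hy']
      abel
    · have e1 : (u' - v') p = S.mkQ m - S.mkQ m' := by
        change (hI.sub M).mapQ S LinearMap.id le_sup_left (u p) -
          (hJ.sub M).mapQ S LinearMap.id le_sup_right (v p) = _
        rw [← hm, ← hm']
        rfl
      rw [e1, ← map_sub, ← sub_eq_zero, ← map_sub]
      refine (Submodule.Quotient.mk_eq_zero _).2 ?_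
      have e2 : m - x - (m' - y) - (m - m') = -x + y := by abel
      rw [e2]
      exact S.add_mem (S.neg_mem (Submodule.mem_sup_left hx)) (Submodule.mem_sup_right hy)
  -- Projectivity modulo I is used a second time, to lift the discrepancy `u' - v'` to a map w into
  -- the image of ker f in M / IM. Then `u - w` and v agree in M / S, and the correction by w is
  -- invisible to f.
  let LI : Submodule R (M ⧸ hI.sub M) := L.map (hI.sub M).mkQ
  obtain ⟨w, hw⟩ := h1 LI D
    (((hI.sub M).mapQ S LinearMap.id le_sup_left ∘ₗ LI.subtype).codRestrict D (by
      rintro ⟨_, l, hl, rfl⟩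
      exact ⟨l, hl, rfl⟩))
    ((u' - v').codRestrict D hD) (by
      rintro ⟨_, l, hl, rfl⟩
      exact ⟨⟨_, l, hl, rfl⟩, rfl⟩) (by
      intro a ha x
      exact Subtype.ext (kill hI a ha x.1))
  have hw' : ∀ p, ∃ l : M, f l = 0 ∧ (w p : M ⧸ hI.sub M) = (hI.sub M).mkQ l ∧
      S.mkQ l = u' p - v' p := by
    intro p
    obtain ⟨l, hl, hl'⟩ := (w p).2
    refine ⟨l, hl, hl'.symm, ?_⟩
    have := congrArg Subtype.val (LinearMap.congr_fun hw p)
    rw [← LinearMap.sub_apply]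
    refine Eq.trans ?_ this
    change _ = (hI.sub M).mapQ S LinearMap.id le_sup_left (w p).1
    rw [← hl']
    rfl
  -- Elements of M / IM and M / JM with the same image in M / (IM + JM) come from a single element
  -- of M.
  have glue : ∀ p, ∃ m : M, (hI.sub M).mkQ m = u p - (w p).1 ∧ (hJ.sub M).mkQ m = v p := by
    intro p
    obtain ⟨m, hm⟩ := Submodule.mkQ_surjective _ (u p)
    obtain ⟨m', hm'⟩ := Submodule.mkQ_surjective _ (v p)
    obtain ⟨l, hl, hl', hl''⟩ := hw' p
    have e1 : S.mkQ l = S.mkQ m - S.mkQ m' := by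
      rw [hl'']
      change (hI.sub M).mapQ S LinearMap.id le_sup_left (u p) -
        (hJ.sub M).mapQ S LinearMap.id le_sup_right (v p) = _
      rw [← hm, ← hm']
      rfl
    have e2 : m - l - m' ∈ S := by
      rw [← (Submodule.Quotient.mk_eq_zero S)]
      change S.mkQ (m - l - m') = 0
      rw [map_sub, map_sub, e1]
      abel
    obtain ⟨x, hx, y, hy, hxy⟩ := Submodule.mem_sup.1 e2
    refine ⟨m - l - x, ?_, ?_⟩
    · have hx' : (hI.sub M).mkQ x = 0 := (Submodule.Quotient.mk_eq_zero _).2 hx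
      rw [map_sub, map_sub, hm, hl', hx', sub_zero]
    · have e3 : m - l - x = m' + y := by
        rw [sub_eq_iff_eq_add, add_assoc, add_comm y x, hxy]
        abel
      have hy' : (hJ.sub M).mkQ y = 0 := (Submodule.Quotient.mk_eq_zero _).2 hy
      rw [e3, map_add, hm', hy', add_zero]
  choose h hh1 hh2 using glue
  have uniq : ∀ m m' : M, (hI.sub M).mkQ m = (hI.sub M).mkQ m' →
      (hJ.sub M).mkQ m = (hJ.sub M).mkQ m' → m = m' := fun m m' e e' =>
    sub_eq_zero.1 (hM0 _ ((Submodule.Quotient.eq _).1 e) ((Submodule.Quotient.eq _).1 e'))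
  refine ⟨⟨⟨h, fun p q => uniq _ _ ?_ ?_⟩, fun r p => uniq _ _ ?_ ?_⟩, ?_⟩
  · rw [map_add, hh1, hh1, hh1, map_add, map_add, Submodule.coe_add]
    abel
  · rw [map_add, hh2, hh2, hh2, map_add]
  · change _ = (hI.sub M).mkQ (r • h p)
    rw [map_smul, hh1, hh1, map_smul, map_smul, Submodule.coe_smul, smul_sub]
  · change _ = (hJ.sub M).mkQ (r • h p)
    rw [map_smul, hh2, hh2, map_smul]
  -- The error f (h p) - g p lies in IN, because h p + l represents u p with f l = 0, and in JN by
  -- the choice of v; these meet in zero.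
  · ext p
    obtain ⟨l, hl, hl', -⟩ := hw' p
    refine sub_eq_zero.1 (hN0 _ ?_ ?_)
    · have := hu p (h p + l) (by rw [map_add, hh1, ← hl', sub_add_cancel])
      rwa [map_add, hl, add_zero] at this
    · exact hv p (h p) (hh2 p).symm

theorem IsProjectiveMod.finset_inf {ι : Type*} {I : ι → Ideal R} (s : Finset ι)
    (h : ∀ i ∈ s, IsLocallyUnital (I i)) (hP : ∀ i ∈ s, IsProjectiveMod (I i) P) :
    IsProjectiveMod (s.inf I) P := by
  classical
  induction s using Finset.induction_on with
  | empty =>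
    intro M N _ _ _ _ f g hf hM
    -- The infimum of the empty family is the unit ideal, and a module that it annihilates is zero.
    have hz : ∀ m : M, m = 0 := fun m => by rw [← one_smul R m]; exact hM 1 trivial m
    refine ⟨0, LinearMap.ext fun p => ?_⟩
    obtain ⟨m, hm⟩ := hf (g p)
    rw [← hm, hz m, map_zero, LinearMap.comp_apply, LinearMap.zero_apply, map_zero]
  | insert k s hk ih =>
    have h' : ∀ i ∈ s, i ∈ insert k s := fun i => Finset.mem_insert_of_mem
    rw [Finset.inf_insert]
    exact IsProjectiveMod.inf (h k (Finset.mem_insert_self k s))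
      (IsLocallyUnital.finset_inf s fun i hi => h i (h' i hi))
      (hP k (Finset.mem_insert_self k s))
      (ih (fun i hi => h i (h' i hi)) fun i hi => hP i (h' i hi))

theorem IsProjectiveMod.projective (h : IsProjectiveMod (⊥ : Ideal R) P) :
    Module.Projective R P := by
  refine Module.Projective.of_lifting_property'' fun f hf => ?_
  exact h _ _ f LinearMap.id hf (by
    rintro a rfl m
    exact zero_smul R m)

end LocalUnits

/-! ### Restriction of modules along a surjection with local units -/

section Restriction

variable {R S T : Type u} [Ring R] [Ring S] [Ring T]

/-- A semilinear map `u : M → N` along `f : R → S` that exhibits `N` as `M / ker f • M`. -/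
structure IsRestriction (f : R →+* S) {M N : Type u} [AddCommGroup M] [Module R M]
    [AddCommGroup N] [Module S N] (u : M →+ N) : Prop where
  map_smul : ∀ r m, u (r • m) = f r • u m
  surjective : Function.Surjective u
  exists_unit : ∀ m, u m = 0 → ∃ e, f e = 0 ∧ e • m = m

theorem HasLocalUnits.isLocallyUnital {f : R →+* S} (hf : HasLocalUnits f) :
    IsLocallyUnital (RingHom.ker f) where
  mul_mem_right a ha r := by
    rw [RingHom.mem_ker] at ha ⊢
    rw [map_mul, ha, zero_mul]
  exists_unit s hs := hf s hs

variable {f : R →+* S} {M N : Type u} [AddCommGroup M] [Module R M] [AddCommGroup N] [Module S N]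

/-- The only substantial point is the kernel. With I the kernel of f, the quotient M / IM is a
module over S because f is surjective, so the universal property gives a map from S ⊗ M to it that
sends 1 ⊗ m to the class of m. If 1 ⊗ m = 0 then m lies in IM. -/
theorem BaseChange.isRestriction (hf : Function.Surjective f) (hu : HasLocalUnits f) :
    IsRestriction f (BaseChange.unit f : M →+ BaseChange f M) where
  map_smul := BaseChange.unit_smul f
  surjective x := by
    induction x using BaseChange.induction with
    | h0 => exact ⟨0, map_zero _⟩
    | ht s m =>
      obtain ⟨r, rfl⟩ := hf s
      exact ⟨r • m, by rw [BaseChange.unit_smul, BaseChange.unit_apply, BaseChange.smul_tmul,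
        mul_one]⟩
    | ha x y hx hy =>
      obtain ⟨m, rfl⟩ := hx
      obtain ⟨m', rfl⟩ := hy
      exact ⟨m + m', map_add _ _ _⟩
  exists_unit m hm := by
    have hI := hu.isLocallyUnital
    let Q := M ⧸ hI.sub M
    let : SMul S Q := ⟨fun s x => Function.surjInv hf s • x⟩
    have hsmul : ∀ (r : R) (x : Q), f r • x = r • x := by
      intro r x
      change Function.surjInv hf (f r) • x = r • x
      rw [← sub_eq_zero, ← sub_smul]
      obtain ⟨m, rfl⟩ := Submodule.mkQ_surjective _ x
      rw [← map_smul]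
      refine (Submodule.Quotient.mk_eq_zero _).2 (hI.smul_mem_sub ?_ m)
      rw [RingHom.mem_ker, map_sub, Function.surjInv_eq hf, sub_self]
    let : Module S Q := Function.Surjective.moduleLeft f hf hsmul
    have := congrArg (BaseChange.lift f (RingHom.id S) (hI.sub M).mkQ.toAddMonoidHom
      (fun r m => by
        change (hI.sub M).mkQ (r • m) = f r • (hI.sub M).mkQ m
        rw [hsmul, _root_.map_smul])) hm
    rw [map_zero, BaseChange.unit_apply, BaseChange.lift_tmul, map_one, one_smul] at this
    exact (Submodule.Quotient.mk_eq_zero (hI.sub M)).1 this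

theorem IsRestriction.comp {g : S →+* T} {P : Type u} [AddCommGroup P] [Module T P]
    {u : M →+ N} {v : N →+ P} (hu : IsRestriction f u) (hv : IsRestriction g v)
    (hf : Function.Surjective f) :
    IsRestriction (g.comp f) (v.comp u) where
  map_smul r m := by
    rw [AddMonoidHom.comp_apply, hu.map_smul, hv.map_smul]
    rfl
  surjective := hv.surjective.comp hu.surjective
  exists_unit m hm := by
    obtain ⟨e', he', h1⟩ := hv.exists_unit _ hm
    obtain ⟨e, rfl⟩ := hf e'
    obtain ⟨e₂, he₂, h2⟩ := hu.exists_unit (m - e • m) (by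
      rw [map_sub, hu.map_smul, h1, sub_self])
    -- This is 1 - (1 - e₂)(1 - e): the factor 1 - e moves m into the kernel of u, and 1 - e₂ kills
    -- the result.
    refine ⟨e₂ * (1 - e) + e, ?_, ?_⟩
    · rw [map_add, map_mul, RingHom.comp_apply, RingHom.comp_apply g f e, he₂, he', map_zero,
        zero_mul, zero_add]
    · rw [add_smul, mul_smul, sub_smul, one_smul, h2, sub_add_cancel]

/-- Modules that restrict to zero on a finite family of closed sets that cover. -/
theorem eq_zero_of_restriction {ι : Type*} [Fintype ι] {S : ι → Type u} [∀ i, Ring (S i)]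
    (f : ∀ i, R →+* S i) (h0 : ∀ r, (∀ i, f i r = 0) → r = 0) (m : M)
    (hm : ∀ i, ∃ e, f i e = 0 ∧ e • m = m) : m = 0 := by
  classical
  have key : ∀ s : Finset ι, ∃ e : R, (∀ i ∈ s, f i e = 0) ∧ e • m = m := by
    intro s
    induction s using Finset.induction_on with
    | empty => exact ⟨1, by simp, one_smul R m⟩
    | insert k s hk ih =>
      obtain ⟨e, he, h⟩ := ih
      obtain ⟨g, hg, h'⟩ := hm k
      refine ⟨g * e, fun i hi => ?_, by rw [mul_smul, h, h']⟩
      rcases Finset.mem_insert.1 hi with rfl | hi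
      · rw [map_mul, hg, zero_mul]
      · rw [map_mul, he i hi, mul_zero]
  obtain ⟨e, he, h⟩ := key Finset.univ
  rw [← h, h0 e fun i => he i (Finset.mem_univ i), zero_smul]

/-- Lifts of finite generating sets of all the N i span a submodule of M whose quotient restricts to
zero for every i, hence vanishes. -/
theorem finite_of_restriction {ι : Type*} [Fintype ι] {S : ι → Type u} [∀ i, Ring (S i)]
    (f : ∀ i, R →+* S i) (hf : ∀ i, Function.Surjective (f i))
    (h0 : ∀ r, (∀ i, f i r = 0) → r = 0)
    (N : ι → Type u) [∀ i, AddCommGroup (N i)] [∀ i, Module (S i) (N i)] (u : ∀ i, M →+ N i)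
    (hu : ∀ i, IsRestriction (f i) (u i)) (hN : ∀ i, Module.Finite (S i) (N i)) :
    Module.Finite R M := by
  classical
  choose s hs using fun i => (hN i).1
  let t : ∀ i, Finset M := fun i => (s i).image (Function.surjInv (hu i).surjective)
  refine ⟨Finset.univ.biUnion t, ?_⟩
  rw [Submodule.eq_top_iff']
  intro m
  rw [← Submodule.Quotient.mk_eq_zero]
  refine eq_zero_of_restriction f h0 _ fun i => ?_
  have h1 : ∀ n ∈ Submodule.span (S i) (s i : Set (N i)),
      ∃ m ∈ Submodule.span R ((Finset.univ.biUnion t : Finset M) : Set M), u i m = n := by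
    intro n hn
    induction hn using Submodule.span_induction with
    | mem n hn =>
      refine ⟨_, Submodule.subset_span ?_, Function.surjInv_eq (hu i).surjective n⟩
      exact Finset.mem_coe.2 (Finset.mem_biUnion.2 ⟨i, Finset.mem_univ i,
        Finset.mem_image_of_mem _ hn⟩)
    | zero => exact ⟨0, Submodule.zero_mem _, map_zero _⟩
    | add x y _ _ hx hy =>
      obtain ⟨a, ha, rfl⟩ := hx
      obtain ⟨b, hb, rfl⟩ := hy
      exact ⟨a + b, Submodule.add_mem _ ha hb, map_add _ _ _⟩
    | smul c x _ hx =>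
      obtain ⟨a, ha, rfl⟩ := hx
      obtain ⟨r, rfl⟩ := hf i c
      exact ⟨r • a, Submodule.smul_mem _ r ha, (hu i).map_smul r a⟩
  obtain ⟨m', hm', h2⟩ := h1 (u i m) (by rw [hs i]; trivial)
  obtain ⟨e, he, h3⟩ := (hu i).exists_unit (m - m') (by rw [map_sub, h2, sub_self])
  refine ⟨e, he, ?_⟩
  have h4 : (Submodule.Quotient.mk m : M ⧸ Submodule.span R
      ((Finset.univ.biUnion t : Finset M) : Set M)) = Submodule.Quotient.mk (m - m') := by
    rw [Submodule.Quotient.mk_sub, (Submodule.Quotient.mk_eq_zero _).2 hm', sub_zero]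
  rw [h4, ← Submodule.Quotient.mk_smul, h3]

/-- A module annihilated by ker f is a module over S, and a map from M to such a module factors
through N. The lifting problem thus becomes one over S for the projective module N. -/
theorem IsRestriction.isProjectiveMod {u : M →+ N} (hu : IsRestriction f u)
    (hf : Function.Surjective f) (hN : Module.Projective S N) :
    IsProjectiveMod (RingHom.ker f) M := by
  intro A B _ _ _ _ p g hp hA
  have kA : ∀ r r' : R, f r = f r' → ∀ a : A, r • a = r' • a := fun r r' h a => by
    rw [← sub_eq_zero, ← sub_smul]
    exact hA _ (by rw [RingHom.mem_ker, map_sub, h, sub_self]) a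
  have kB : ∀ r r' : R, f r = f r' → ∀ b : B, r • b = r' • b := fun r r' h b => by
    obtain ⟨a, rfl⟩ := hp b
    rw [← _root_.map_smul, ← _root_.map_smul, kA r r' h]
  let : SMul S A := ⟨fun s x => Function.surjInv hf s • x⟩
  let : SMul S B := ⟨fun s x => Function.surjInv hf s • x⟩
  have sA : ∀ (r : R) (x : A), f r • x = r • x := fun r x => kA _ _ (Function.surjInv_eq hf _) x
  have sB : ∀ (r : R) (x : B), f r • x = r • x := fun r x => kB _ _ (Function.surjInv_eq hf _) x
  let : Module S A := Function.Surjective.moduleLeft f hf sA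
  let : Module S B := Function.Surjective.moduleLeft f hf sB
  let p' : A →ₗ[S] B := ⟨⟨p, map_add p⟩, fun s a => by
    obtain ⟨r, rfl⟩ := hf s
    change p (f r • a) = f r • p a
    rw [sA, sB, _root_.map_smul]⟩
  have hg : ∀ m m', u m = u m' → g m = g m' := fun m m' h => by
    obtain ⟨e, he, h'⟩ := hu.exists_unit (m - m') (by rw [map_sub, h, sub_self])
    rw [← sub_eq_zero, ← map_sub, ← h', _root_.map_smul, kB e 0 (by rw [he, map_zero]), zero_smul]
  have hinv := Function.surjInv_eq hu.surjective
  let g' : N →ₗ[S] B := ⟨⟨fun n => g (Function.surjInv hu.surjective n), fun n n' => by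
      rw [← map_add]
      exact hg _ _ (by rw [map_add, hinv, hinv, hinv])⟩, fun s n => by
      obtain ⟨r, rfl⟩ := hf s
      change g _ = f r • g _
      rw [sB, ← _root_.map_smul]
      exact hg _ _ (by rw [hinv, hu.map_smul, hinv])⟩
  obtain ⟨h, hh⟩ := Module.projective_lifting_property p' g' hp
  refine ⟨⟨⟨fun m => h (u m), fun m m' => by rw [map_add, map_add]⟩, fun r m => ?_⟩, ?_⟩
  · change h (u (r • m)) = r • h (u m)
    rw [hu.map_smul, _root_.map_smul, sA]
  · ext m
    refine (LinearMap.congr_fun hh (u m)).trans (hg _ _ (hinv _))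

/-- The kernels of the f i intersect in zero, so the patching of projectivity over all of them is
projectivity over R. -/
theorem projective_of_restriction {ι : Type*} [Fintype ι] {S : ι → Type u} [∀ i, Ring (S i)]
    (f : ∀ i, R →+* S i) (hf : ∀ i, Function.Surjective (f i))
    (hL : ∀ i, HasLocalUnits (f i)) (h0 : ∀ r, (∀ i, f i r = 0) → r = 0)
    (N : ι → Type u) [∀ i, AddCommGroup (N i)] [∀ i, Module (S i) (N i)] (u : ∀ i, M →+ N i)
    (hu : ∀ i, IsRestriction (f i) (u i)) (hN : ∀ i, Module.Projective (S i) (N i)) :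
    Module.Projective R M := by
  refine IsProjectiveMod.projective ?_
  have := IsProjectiveMod.finset_inf (P := M) (I := fun i => RingHom.ker (f i)) Finset.univ
    (fun i _ => (hL i).isLocallyUnital) fun i _ => (hu i).isProjectiveMod (hf i) (hN i)
  convert this
  refine (le_bot_iff.1 fun r hr => ?_).symm
  rw [Submodule.mem_finsetInf] at hr
  exact h0 r fun i => hr i (Finset.mem_univ i)

end Restriction

/-! ### Exactness of the extension of scalars -/

section Exact

variable {R S : Type u} [Ring R] [Ring S] {f : R →+* S}

/-- Exactness survives because cycles can be corrected. If g n restricts to zero, it is fixed by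
some e in the kernel of f; then n - e n is a cycle with the same restriction as n. -/
theorem baseChange_preservesHomology (hf : Function.Surjective f) (hu : HasLocalUnits f) :
    (baseChange f).PreservesHomology := by
  refine ((Functor.exact_tfae (baseChange f)).out 1 2).1 fun C hC => ?_
  rw [ShortComplex.moduleCat_exact_iff] at hC ⊢
  intro y hy
  obtain ⟨n, rfl⟩ := (BaseChange.isRestriction (M := C.X₂) hf hu).surjective y
  have h1 : BaseChange.unit f (C.g n) = 0 := by
    refine Eq.trans ?_ hy
    exact (BaseChange.map_tmul f C.g.hom 1 n).symm
  obtain ⟨e, he, h2⟩ := (BaseChange.isRestriction (M := C.X₃) hf hu).exists_unit _ h1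
  obtain ⟨m, hm⟩ := hC (n - e • n) (by rw [map_sub, map_smul, h2, sub_self])
  refine ⟨BaseChange.unit f m, ?_⟩
  refine (BaseChange.map_tmul f C.f.hom 1 m).trans ?_
  change BaseChange.unit f (C.f m) = _
  rw [hm, map_sub, BaseChange.unit_smul, he, zero_smul, sub_zero]

theorem BaseChange.finite {M : Type u} [AddCommGroup M] [Module R M]
    (hM : Module.Finite R M) : Module.Finite S (BaseChange f M) := by
  classical
  obtain ⟨s, hs⟩ := hM.1
  refine ⟨s.image (BaseChange.unit f), ?_⟩
  rw [Submodule.eq_top_iff']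
  intro x
  induction x using BaseChange.induction with
  | h0 => exact Submodule.zero_mem _
  | ha x y hx hy => exact Submodule.add_mem _ hx hy
  | ht c m =>
    rw [BaseChange.tmul_eq_smul]
    refine Submodule.smul_mem _ c ?_
    have hm : m ∈ Submodule.span R (s : Set M) := by rw [hs]; trivial
    change BaseChange.unit f m ∈ _
    induction hm using Submodule.span_induction with
    | mem m hm => exact Submodule.subset_span (Finset.mem_coe.2 (Finset.mem_image_of_mem _ hm))
    | zero => rw [map_zero]; exact Submodule.zero_mem _
    | add x y _ _ hx hy => rw [map_add]; exact Submodule.add_mem _ hx hy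
    | smul r x _ hx => rw [BaseChange.unit_smul]; exact Submodule.smul_mem _ _ hx

/-- Extension of scalars is left adjoint to restriction of scalars along f, and the latter keeps
surjections. So the splitting over S is adjoint to a lift over R. -/
theorem BaseChange.projective {M : Type u} [AddCommGroup M] [Module R M]
    (hM : Module.Projective R M) : Module.Projective S (BaseChange f M) := by
  refine Module.Projective.of_lifting_property'' fun p hp => ?_
  let : Module R (BaseChange f M →₀ S) := Module.compHom _ f
  let : Module R (BaseChange f M) := Module.compHom _ f
  let p' : (BaseChange f M →₀ S) →ₗ[R] BaseChange f M :=
    ⟨⟨p, map_add p⟩, fun r a => map_smul p (f r) a⟩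
  let g' : M →ₗ[R] BaseChange f M := ⟨⟨BaseChange.unit f, map_add _⟩, BaseChange.unit_smul f⟩
  obtain ⟨h, hh⟩ := Module.projective_lifting_property p' g' hp
  have hk : ∀ (r : R) (m : M), h.toAddMonoidHom (r • m) =
      RingHom.id S (f r) • h.toAddMonoidHom m := fun r m => map_smul h r m
  refine ⟨BaseChange.lift f (RingHom.id S) h.toAddMonoidHom hk, ?_⟩
  apply BaseChange.hom_ext
  intro m
  rw [LinearMap.comp_apply, BaseChange.lift_tmul, map_one, one_smul]
  exact LinearMap.congr_fun hh m

end Exact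

/-! ### Mapping cones in derived categories -/

section Cones

open Pretriangulated CochainComplex

variable {𝒞 : Type*} [Category* 𝒞] [Abelian 𝒞] {K L L' : CochainComplex 𝒞 ℤ}

attribute [local instance] HasDerivedCategory.standard

/-- In the long exact sequence H^n(K) → H^n(L) → H^n(cone) → H^{n+1}(K) the outer arrow is onto and
the last term is zero. -/
theorem isZero_homology_mappingCone (φ : K ⟶ L) (n : ℤ)
    (h1 : Epi (HomologicalComplex.homologyMap φ n)) (h2 : Limits.IsZero (K.homology (n + 1))) :
    Limits.IsZero ((mappingCone φ).homology n) := by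
  have hT := DerivedCategory.mappingCone_triangle_distinguished φ
  have e2 := homologyMap_exact₂_of_distTriang _ hT n
  have e3 := homologyMap_exact₃_of_distTriang _ hT n (n + 1) rfl
  have z : HomologicalComplex.homologyMap (mappingCone.triangle φ).mor₂ n = 0 := by
    have : Epi (HomologicalComplex.homologyMap (mappingCone.triangle φ).mor₁ n) := h1
    rw [← cancel_epi (HomologicalComplex.homologyMap (mappingCone.triangle φ).mor₁ n),
      homologyMap_comp_eq_zero_of_distTriang _ hT n, Limits.comp_zero]
  exact e3.isZero_X₂ z (h2.eq_of_tgt _ _)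

/-- In the derived category this is a morphism of distinguished triangles with two invertible
components. -/
theorem quasiIso_mappingCone_map (φ : K ⟶ L) (b : L ⟶ L') [QuasiIso b] :
    QuasiIso (mappingCone.map φ (φ ≫ b) (𝟙 K) b (by rw [Category.id_comp])) := by
  rw [← DerivedCategory.isIso_Q_map_iff_quasiIso]
  let f := DerivedCategory.Q.mapTriangle.map (mappingCone.triangleMap φ (φ ≫ b) (𝟙 K) b
    (by rw [Category.id_comp]))
  have h1 : IsIso f.hom₁ := inferInstanceAs (IsIso (DerivedCategory.Q.map (𝟙 K)))
  have h2 : IsIso f.hom₂ := inferInstanceAs (IsIso (DerivedCategory.Q.map b))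
  exact isIso₃_of_isIso₁₂ f (DerivedCategory.mappingCone_triangle_distinguished φ)
    (DerivedCategory.mappingCone_triangle_distinguished (φ ≫ b)) h1 h2

/-- Maps out of a K-projective complex in the derived category are homotopy classes of maps of
complexes, so the isomorphism has an honest representative. -/
theorem exists_quasiIso_of_iso [K.IsKProjective]
    (e : DerivedCategory.Q.obj K ≅ DerivedCategory.Q.obj L) : ∃ φ : K ⟶ L, QuasiIso φ := by
  obtain ⟨g, hg⟩ := (IsKProjective.Qh_map_bijective K
    ((HomotopyCategory.quotient _ _).obj L)).surjective
    ((DerivedCategory.quotientCompQhIso 𝒞).hom.app K ≫ e.hom ≫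
      (DerivedCategory.quotientCompQhIso 𝒞).inv.app L)
  obtain ⟨φ, rfl⟩ := (HomotopyCategory.quotient _ _).map_surjective g
  refine ⟨φ, (DerivedCategory.isIso_Q_map_iff_quasiIso _ φ).1 ?_⟩
  have h := DerivedCategory.quotientCompQhIso_hom_naturality φ
  rw [hg] at h
  simp only [Category.assoc, Iso.inv_hom_id_app, Category.comp_id] at h
  have h' : DerivedCategory.Q.map φ = e.hom := by
    rw [← cancel_epi ((DerivedCategory.quotientCompQhIso 𝒞).hom.app K)]
    exact h.symm
  rw [h']
  infer_instance

/-- Two rotations of the triangle K → L → cone g → K[1] exhibit L[1] as the cone of cone g → K[1].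
Replacing cone g by the resolution E gives the cone of w : E → K[1], from which L is recovered by a
shift. -/
theorem exists_shift_mappingCone_iso {E : CochainComplex 𝒞 ℤ} [E.IsKProjective] (g : K ⟶ L)
    (φ : E ⟶ mappingCone g) [QuasiIso φ] :
    ∃ w : E ⟶ K⟦(1 : ℤ)⟧,
      Nonempty (DerivedCategory.Q.obj ((mappingCone w)⟦(-1 : ℤ)⟧) ≅ DerivedCategory.Q.obj L) := by
  let ω : mappingCone g ⟶ K⟦(1 : ℤ)⟧ := (mappingCone.triangle g).mor₃
  let w := φ ≫ ω
  refine ⟨w, ?_⟩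
  have h1 := DerivedCategory.mappingCone_triangle_distinguished w
  have h2 := rot_of_distTriang _ (rot_of_distTriang _
    (DerivedCategory.mappingCone_triangle_distinguished g))
  have hφ : IsIso (DerivedCategory.Q.map φ) := inferInstance
  obtain ⟨e, -, -⟩ := exists_iso_of_arrow_iso _ _ h1 h2
    (Arrow.isoMk (@asIso _ _ _ _ (DerivedCategory.Q.map φ) hφ)
      ((DerivedCategory.Q.commShiftIso (1 : ℤ)).app K) (by
        change DerivedCategory.Q.map φ ≫ DerivedCategory.Q.map ω ≫
          (DerivedCategory.Q.commShiftIso (1 : ℤ)).hom.app K =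
          DerivedCategory.Q.map (φ ≫ ω) ≫ (DerivedCategory.Q.commShiftIso (1 : ℤ)).hom.app K
        rw [Functor.map_comp, Category.assoc]))
  exact ⟨(DerivedCategory.Q.commShiftIso (-1 : ℤ)).app (mappingCone w) ≪≫
    (CategoryTheory.shiftFunctor _ (-1 : ℤ)).mapIso (Triangle.π₃.mapIso e) ≪≫
    (shiftEquiv (DerivedCategory 𝒞) (1 : ℤ)).unitIso.symm.app (DerivedCategory.Q.obj L)⟩

end Cones

/-! ### Bounded complexes of finitely generated projective modules. -/

section Perfect

open CochainComplex

variable {R : Type u} [Ring R]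

/-- Complexes of finitely generated projective modules in degrees from `a` to `b`. -/
structure IsPerfectIn (E : CochainComplex (ModuleCat.{u} R) ℤ) (a b : ℤ) : Prop where
  isZero : ∀ n, n < a ∨ b < n → Limits.IsZero (E.X n)
  finite : ∀ n, Module.Finite R (E.X n)
  projective : ∀ n, Module.Projective R (E.X n)

theorem finite_of_iso {M N : ModuleCat.{u} R} (e : M ≅ N) (h : Module.Finite R M) :
    Module.Finite R N := Module.Finite.equiv e.toLinearEquiv

theorem projective_of_iso {M N : ModuleCat.{u} R} (e : M ≅ N) (h : Module.Projective R M) :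
    Module.Projective R N := Module.Projective.of_equiv e.toLinearEquiv

variable {E K L : CochainComplex (ModuleCat.{u} R) ℤ} {a b : ℤ}

theorem IsPerfectIn.isKProjective (h : IsPerfectIn E a b) : E.IsKProjective := by
  have : E.IsStrictlyLE b := (isStrictlyLE_iff _ _).2 fun i hi => h.isZero i (Or.inr hi)
  have : ∀ n, Projective (E.X n) := fun n =>
    (IsProjective.iff_projective (E.X n)).1 (h.projective n)
  exact isKProjective_of_projective E b

/-- The source lives one degree higher because the cone in degree n is K^{n+1} ⊕ L^n. -/
theorem IsPerfectIn.mappingCone {φ : K ⟶ L} (hK : IsPerfectIn K (a + 1) (b + 1))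
    (hL : IsPerfectIn L a b) : IsPerfectIn (mappingCone φ) a b := by
  have e : ∀ n, (CochainComplex.mappingCone φ).X n ≅ ModuleCat.of R (K.X (n + 1) × L.X n) :=
    fun n => HomologicalComplex.homotopyCofiber.XIsoBiprod φ n (n + 1) rfl ≪≫
      ModuleCat.biprodIsoProd _ _
  refine ⟨fun n hn => ?_, fun n => ?_, fun n => ?_⟩
  · exact (mappingCone.isZero_X_iff φ n).2 ⟨hK.isZero _ (by omega), hL.isZero _ hn⟩
  · have := hK.finite (n + 1)
    have := hL.finite n
    exact finite_of_iso (e n).symm (inferInstanceAs (Module.Finite R (K.X (n + 1) × L.X n)))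
  · have := hK.projective (n + 1)
    have := hL.projective n
    exact projective_of_iso (e n).symm
      (inferInstanceAs (Module.Projective R (K.X (n + 1) × L.X n)))

theorem IsPerfectIn.mono (h : IsPerfectIn E a b) {a' b' : ℤ} (ha : a' ≤ a) (hb : b ≤ b') :
    IsPerfectIn E a' b' :=
  ⟨fun n hn => h.isZero n (by omega), h.finite, h.projective⟩

theorem IsPerfectIn.shift (h : IsPerfectIn E a b) (n : ℤ) :
    IsPerfectIn (E⟦n⟧) (a - n) (b - n) :=
  ⟨fun k hk => h.isZero (k + n) (by omega), fun k => h.finite (k + n),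
    fun k => h.projective (k + n)⟩

theorem isPerfectIn_single (M : ModuleCat.{u} R) (hf : Module.Finite R M)
    (hp : Module.Projective R M) (n : ℤ) :
    IsPerfectIn ((HomologicalComplex.single _ (ComplexShape.up ℤ) n).obj M) n n := by
  have hz : ∀ k, k ≠ n → Limits.IsZero
      (((HomologicalComplex.single _ (ComplexShape.up ℤ) n).obj M).X k) := fun k hk =>
    HomologicalComplex.isZero_single_obj_X _ _ _ _ hk
  refine ⟨fun k hk => hz k (by omega), fun k => ?_, fun k => ?_⟩
  · by_cases hk : k = n
    · subst hk
      exact finite_of_iso (HomologicalComplex.singleObjXSelf (ComplexShape.up ℤ) k M).symm hf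
    · have := ModuleCat.subsingleton_of_isZero (hz k hk)
      infer_instance
  · by_cases hk : k = n
    · subst hk
      exact projective_of_iso (HomologicalComplex.singleObjXSelf (ComplexShape.up ℤ) k M).symm hp
    · have := ModuleCat.subsingleton_of_isZero (hz k hk)
      infer_instance

theorem finite_projective_ker {M N : Type u} [AddCommGroup M] [Module R M] [AddCommGroup N]
    [Module R N] (f : M →ₗ[R] N) (h : Module.Projective R (LinearMap.range f))
    (hf : Module.Finite R M) (hp : Module.Projective R M) :
    Module.Finite R (LinearMap.ker f) ∧ Module.Projective R (LinearMap.ker f) := by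
  obtain ⟨s, hs⟩ := Module.projective_lifting_property f.rangeRestrict LinearMap.id
    f.surjective_rangeRestrict
  have hs' : ∀ x, f (s x) = x := fun x => congrArg Subtype.val (LinearMap.congr_fun hs x)
  let r : M →ₗ[R] LinearMap.ker f := (LinearMap.id - s ∘ₗ f.rangeRestrict).codRestrict _ (by
    intro m
    rw [LinearMap.mem_ker, LinearMap.sub_apply, map_sub, LinearMap.comp_apply, hs',
      LinearMap.id_apply]
    exact sub_self _)
  have hr : r ∘ₗ (LinearMap.ker f).subtype = LinearMap.id := by
    ext ⟨m, hm⟩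
    have h0 : f.rangeRestrict m = 0 := Subtype.ext hm
    change m - s (f.rangeRestrict m) = m
    rw [h0, map_zero, sub_zero]
  exact ⟨Module.Finite.of_surjective r fun x => ⟨x.1, LinearMap.congr_fun hr x⟩,
    Module.Projective.of_split _ _ hr⟩

/-- Above degree c the image of each differential is the next kernel. Descending from the top
degree, each such kernel is projective, so the preceding differential splits onto its image and its
kernel is a direct summand. -/
theorem IsPerfectIn.ker (hE : IsPerfectIn E a b) {c : ℤ} (hc : ∀ n, c < n → E.ExactAt n) :
    Module.Finite R (LinearMap.ker (E.d c (c + 1)).hom) ∧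
      Module.Projective R (LinearMap.ker (E.d c (c + 1)).hom) := by
  -- The induction variable k bounds the distance of n from the top degree b; for k = 0 the degree n
  -- lies above b and the kernel is zero.
  have key : ∀ (k : ℕ) (n : ℤ), c ≤ n → b - n < k →
      Module.Finite R (LinearMap.ker (E.d n (n + 1)).hom) ∧
      Module.Projective R (LinearMap.ker (E.d n (n + 1)).hom) := by
    intro k
    induction k with
    | zero =>
      intro n hn hk
      have := ModuleCat.subsingleton_of_isZero (hE.isZero n (Or.inr (by simp at hk; omega)))
      exact ⟨inferInstance, inferInstance⟩
    | succ k ih =>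
      intro n hn hk
      refine finite_projective_ker _ ?_ (hE.finite n) (hE.projective n)
      have h1 := (ih (n + 1) (by omega) (by push_cast at hk; omega)).2
      have h2 : LinearMap.range (E.d n (n + 1)).hom =
          LinearMap.ker (E.d (n + 1) (n + 1 + 1)).hom := by
        have := hc (n + 1) (by omega)
        rw [HomologicalComplex.exactAt_iff' _ n (n + 1) (n + 1 + 1) (by simp) (by simp),
          ShortComplex.moduleCat_exact_iff_range_eq_ker] at this
        exact this
      rw [h2]
      exact h1
  exact key (b - c + 1).toNat c le_rfl (by omega)

/-- The linear equivalence between the kernel of the differential and the cycles. -/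
def kerEquivCycles (E : CochainComplex (ModuleCat.{u} R) ℤ) (n : ℤ) :
    LinearMap.ker (E.d n (n + 1)).hom ≃ₗ[R] E.cycles n :=
  LinearEquiv.ofBijective
    (E.liftCycles (ModuleCat.ofHom (LinearMap.ker (E.d n (n + 1)).hom).subtype) (n + 1)
      (by simp) (by ext x; exact x.2)).hom (by
    have hi := fun x => congrArg (fun f => f.hom x) (E.liftCycles_i
      (ModuleCat.ofHom (LinearMap.ker (E.d n (n + 1)).hom).subtype) (n + 1)
      (by simp) (by ext x; exact x.2))
    have hinj : Function.Injective (E.iCycles n) := (ModuleCat.mono_iff_injective _).1 inferInstance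
    constructor
    · intro x y hxy
      refine Subtype.ext ?_
      exact (hi x).symm.trans ((congrArg (E.iCycles n) hxy).trans (hi y))
    · intro z
      have hz : E.d n (n + 1) (E.iCycles n z) = 0 :=
        congrArg (fun f => f.hom z) (E.iCycles_d n (n + 1))
      exact ⟨⟨E.iCycles n z, hz⟩, hinj (hi ⟨E.iCycles n z, hz⟩)⟩)

theorem IsPerfectIn.finite_homology (hE : IsPerfectIn E a b) {c : ℤ}
    (hc : ∀ n, c < n → E.ExactAt n) : Module.Finite R (E.homology c) := by
  have := (hE.ker hc).1
  have h1 : Module.Finite R (E.cycles c) := Module.Finite.equiv (kerEquivCycles E c)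
  exact Module.Finite.of_surjective (E.homologyπ c).hom
    ((ModuleCat.epi_iff_surjective _).1 inferInstance)

/-- No differential enters the lowest degree a, so the homology there is the kernel of the outgoing
differential. -/
theorem IsPerfectIn.projective_homology (hE : IsPerfectIn E a b)
    (hc : ∀ n, a < n → E.ExactAt n) : Module.Projective R (E.homology a) := by
  have := (hE.ker hc).2
  have h1 : Module.Projective R (E.cycles a) := Module.Projective.of_equiv (kerEquivCycles E a)
  have h2 : IsIso (E.homologyπ a) := E.isIso_homologyπ (a - 1) a (by simp)
    ((hE.isZero (a - 1) (Or.inl (by omega))).eq_of_src _ _)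
  exact projective_of_iso (asIso (E.homologyπ a)) h1

end Perfect

/-! ### Descent of perfect complexes -/

section PerfectDescent

open CochainComplex

variable {R : Type u} [Ring R] {ι : Type u} {S : ι → Type u} [∀ i, Ring (S i)]

/-- A family of functors that preserves and jointly reflects zero objects, finite generation and
projectivity. -/
structure IsDescentFamily (G : ∀ i, ModuleCat.{u} R ⥤ ModuleCat.{u} (S i)) : Prop where
  isZero : ∀ M : ModuleCat.{u} R, (∀ i, Limits.IsZero ((G i).obj M)) → Limits.IsZero M
  finite : ∀ M : ModuleCat.{u} R, (∀ i, Module.Finite (S i) ((G i).obj M)) → Module.Finite R M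
  projective : ∀ M : ModuleCat.{u} R, (∀ i, Module.Projective (S i) ((G i).obj M)) → Module.Projective R M
  map_finite : ∀ i (M : ModuleCat.{u} R), Module.Finite R M → Module.Finite (S i) ((G i).obj M)
  map_projective : ∀ i (M : ModuleCat.{u} R), Module.Projective R M → Module.Projective (S i) ((G i).obj M)

variable {G : ∀ i, ModuleCat.{u} R ⥤ ModuleCat.{u} (S i)} [∀ i, (G i).Additive]
  [∀ i, (G i).PreservesHomology]

/-- An exact functor commutes with homology, compared along a quasi-isomorphism. -/
def homologyIsoOfQuasiIso {i : ι} {C : CochainComplex (ModuleCat.{u} R) ℤ}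
    {Q : CochainComplex (ModuleCat.{u} (S i)) ℤ}
    (q : ((G i).mapHomologicalComplex (ComplexShape.up ℤ)).obj C ⟶ Q) [QuasiIso q] (n : ℤ) :
    (G i).obj (C.homology n) ≅ Q.homology n :=
  ((C.sc n).mapHomologyIso (G i)).symm ≪≫ isoOfQuasiIsoAt q n

theorem IsDescentFamily.map_isPerfectIn (hG : IsDescentFamily G) (i : ι)
    {E : CochainComplex (ModuleCat.{u} R) ℤ} {a b : ℤ} (hE : IsPerfectIn E a b) :
    IsPerfectIn (((G i).mapHomologicalComplex (ComplexShape.up ℤ)).obj E) a b :=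
  ⟨fun n hn => (G i).map_isZero (hE.isZero n hn), fun n => hG.map_finite i _ (hE.finite n),
    fun n => hG.map_projective i _ (hE.projective n)⟩

/-- A morphism from a complex in a single degree that induces a given map in homology. -/
theorem exists_single_hom {C : CochainComplex (ModuleCat.{u} R) ℤ} {P : ModuleCat.{u} R}
    (hP : Module.Projective R P) (n : ℤ) (π : P ⟶ C.homology n) :
    ∃ g : (HomologicalComplex.single _ (ComplexShape.up ℤ) n).obj P ⟶ C,
      (HomologicalComplex.singleObjHomologySelfIso (ComplexShape.up ℤ) n P).inv ≫
        HomologicalComplex.homologyMap g n = π := by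
  have : Projective P := (IsProjective.iff_projective P).1 hP
  let l : P ⟶ C.cycles n := Projective.factorThru π (C.homologyπ n)
  have hl : l ≫ C.homologyπ n = π := Projective.factorThru_comp π (C.homologyπ n)
  let g := HomologicalComplex.mkHomFromSingle (c := ComplexShape.up ℤ) (l ≫ C.iCycles n)
    (fun k _ => by rw [Category.assoc, C.iCycles_d, Limits.comp_zero])
  refine ⟨g, ?_⟩
  rw [← hl, ← HomologicalComplex.singleObjCyclesSelfIso_inv_homologyπ, Category.assoc,
    HomologicalComplex.homologyπ_naturality, ← Category.assoc]
  congr 1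
  rw [← cancel_mono (C.iCycles n), Category.assoc, HomologicalComplex.cyclesMap_i,
    HomologicalComplex.singleObjCyclesSelfIso_inv_iCycles_assoc,
    HomologicalComplex.mkHomFromSingle_f, Iso.inv_hom_id_assoc]

/-- Induction on the length d of the range of degrees from a to a + d that contains the cohomology.
The bounds a and N of the local models are kept fixed throughout; only the cohomological range
shrinks when a top class is killed. -/
theorem exists_perfect_of_local_aux (hG : IsDescentFamily G) (d : ℕ) :
    ∀ (a N : ℤ) (C : CochainComplex (ModuleCat.{u} R) ℤ)
      (Q : ∀ i, CochainComplex (ModuleCat.{u} (S i)) ℤ)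
      (q : ∀ i, ((G i).mapHomologicalComplex (ComplexShape.up ℤ)).obj C ⟶ Q i),
      (∀ i, QuasiIso (q i)) → a + d ≤ N → (∀ i, IsPerfectIn (Q i) a N) →
      (∀ i n, a + d < n → (Q i).ExactAt n) →
      ∃ (E : CochainComplex (ModuleCat.{u} R) ℤ) (φ : E ⟶ C), IsPerfectIn E a N ∧ QuasiIso φ := by
  induction d with
  | zero =>
    intro a N C Q q hq hN hQ hex
    rw [Nat.cast_zero, add_zero] at hex hN
    -- Only one cohomology module is left. It is the lowest homology of each local model, hence
    -- locally finitely generated projective, and by descent globally so; placed in degree a it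
    -- resolves C.
    let H := C.homology a
    have hHf : Module.Finite R H := hG.finite _ fun i =>
      finite_of_iso (homologyIsoOfQuasiIso (q i) a).symm ((hQ i).finite_homology (hex i))
    have hHp : Module.Projective R H := hG.projective _ fun i =>
      projective_of_iso (homologyIsoOfQuasiIso (q i) a).symm ((hQ i).projective_homology (hex i))
    obtain ⟨g, hg⟩ := exists_single_hom hHp a (𝟙 H)
    refine ⟨_, g, (isPerfectIn_single H hHf hHp a).mono le_rfl hN, ⟨fun n => ?_⟩⟩
    rw [quasiIsoAt_iff_isIso_homologyMap]
    by_cases hn : n = a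
    · subst hn
      have : HomologicalComplex.homologyMap g n =
          (HomologicalComplex.singleObjHomologySelfIso (ComplexShape.up ℤ) n H).hom := by
        rw [← Iso.inv_comp_eq_id, hg]
      rw [this]
      infer_instance
    · have h1 := HomologicalComplex.isZero_single_obj_homology (ComplexShape.up ℤ) a H n hn
      have h2 : Limits.IsZero (C.homology n) := hG.isZero _ fun i => by
        refine Limits.IsZero.of_iso ?_ (homologyIsoOfQuasiIso (q i) n)
        rw [← HomologicalComplex.exactAt_iff_isZero_homology]
        rcases lt_or_gt_of_ne hn with h | h
        · exact ShortComplex.exact_of_isZero_X₂ _ ((hQ i).isZero n (Or.inl h))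
        · exact hex i n h
      exact ⟨⟨0, h1.eq_of_src _ _, h2.eq_of_src _ _⟩⟩
  | succ d ih =>
    intro a N C Q q hq hN hQ hex
    let b : ℤ := a + (d + 1 : ℕ)
    have hHf : Module.Finite R (C.homology b) := hG.finite _ fun i =>
      finite_of_iso (homologyIsoOfQuasiIso (q i) b).symm ((hQ i).finite_homology (hex i))
    -- The top cohomology need only be finitely generated: a finite free module maps onto it, and
    -- the cone of the resulting map to C has no cohomology above a + d.
    obtain ⟨r, p, hp⟩ := Module.Finite.exists_fin' R (C.homology b)
    let P : ModuleCat.{u} R := ModuleCat.of R (Fin r → R)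
    have hPf : Module.Finite R P := inferInstanceAs (Module.Finite R (Fin r → R))
    have hPp : Module.Projective R P := inferInstanceAs (Module.Projective R (Fin r → R))
    let K := (HomologicalComplex.single (ModuleCat.{u} R) (ComplexShape.up ℤ) b).obj P
    let π : P ⟶ C.homology b := ModuleCat.ofHom p
    obtain ⟨g, hg⟩ := exists_single_hom hPp b π
    have hK : IsPerfectIn K b b := isPerfectIn_single P hPf hPp b
    -- The degree b satisfies a + 1 ≤ b ≤ N, so the cones of the local models stay in degrees from a
    -- to N.
    have hK' : IsPerfectIn K (a + 1) (N + 1) := hK.mono (by omega) (by omega)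
    let q' := fun i => (mappingCone.mapHomologicalComplexIso g (G i)).hom ≫
      mappingCone.map (((G i).mapHomologicalComplex (ComplexShape.up ℤ)).map g)
        (((G i).mapHomologicalComplex (ComplexShape.up ℤ)).map g ≫ q i) (𝟙 _) (q i)
        (by rw [Category.id_comp])
    have hq' : ∀ i, QuasiIso (q' i) := fun i => by
      have := quasiIso_mappingCone_map (((G i).mapHomologicalComplex (ComplexShape.up ℤ)).map g)
        (q i)
      infer_instance
    have hz : ∀ n, a + d < n → Limits.IsZero ((mappingCone g).homology n) := by
      intro n hn
      refine isZero_homology_mappingCone g n ?_ ?_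
      · by_cases hnb : n = b
        · subst hnb
          have hp' : Epi π := (ModuleCat.epi_iff_surjective _).2 hp
          rw [← hg] at hp'
          exact @epi_of_epi _ _ _ _ _ _ _ hp'
        · have h2 : Limits.IsZero (C.homology n) := hG.isZero _ fun i => by
            refine Limits.IsZero.of_iso ?_ (homologyIsoOfQuasiIso (q i) n)
            rw [← HomologicalComplex.exactAt_iff_isZero_homology]
            exact hex i n (by omega)
          exact ⟨fun _ _ _ => h2.eq_of_src _ _⟩
      · exact HomologicalComplex.isZero_single_obj_homology (ComplexShape.up ℤ) b P (n + 1)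
          (by omega)
    obtain ⟨E', φ', hE', hφ'⟩ := ih a N (mappingCone g) _ q' hq' (by omega)
      (fun i => (hG.map_isPerfectIn i hK').mappingCone (hQ i)) (fun i n hn => by
        rw [HomologicalComplex.exactAt_iff_isZero_homology]
        exact ((G i).map_isZero (hz n hn)).of_iso (homologyIsoOfQuasiIso (q' i) n).symm)
    have := hE'.isKProjective
    -- C is recovered from the resolution E' of the cone as the shifted cone of E' → K[1]; the cone
    -- lies in degrees from a - 1 to N - 1, and the shift by -1 restores the range from a to N.
    obtain ⟨w, ⟨e⟩⟩ := exists_shift_mappingCone_iso g φ'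
    have hK1 : IsPerfectIn (K⟦(1 : ℤ)⟧) (a - 1) (N - 1) :=
      (hK.shift 1).mono (by omega) (by omega)
    have hE : IsPerfectIn ((mappingCone w)⟦(-1 : ℤ)⟧) a N := by
      have h1 : IsPerfectIn (mappingCone w) (a - 1) (N - 1) :=
        IsPerfectIn.mappingCone (by simpa using hE') hK1
      have h2 := h1.shift (-1)
      simpa using h2
    have := hE.isKProjective
    obtain ⟨φ, hφ⟩ := exists_quasiIso_of_iso e
    exact ⟨_, φ, hE, hφ⟩

/-- A complex that is locally quasi-isomorphic to a bounded complex of finitely generated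
projective modules is so globally. -/
theorem exists_perfect_of_local (hG : IsDescentFamily G) (C : CochainComplex (ModuleCat.{u} R) ℤ)
    (Q : ∀ i, CochainComplex (ModuleCat.{u} (S i)) ℤ)
    (q : ∀ i, ((G i).mapHomologicalComplex (ComplexShape.up ℤ)).obj C ⟶ Q i)
    (hq : ∀ i, QuasiIso (q i)) (N : ℕ) (hQ : ∀ i, IsPerfectIn (Q i) (-N) N) :
    ∃ (E : CochainComplex (ModuleCat.{u} R) ℤ) (φ : E ⟶ C),
      IsPerfectIn E (-N) N ∧ QuasiIso φ := by
  -- The degrees from -N to N form an interval of length 2 N, beyond which every local model is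
  -- zero.
  refine exists_perfect_of_local_aux hG (2 * N) (-N) N C Q q hq (by push_cast; omega) hQ
    fun i n hn => ?_
  exact ShortComplex.exact_of_isZero_X₂ _ ((hQ i).isZero n (Or.inr (by push_cast at hn; omega)))

end PerfectDescent

/-! ### The descent family of a finite cover -/

section CoverDescent

variable {X : TopCat.{u}} (𝒜 : TopCat.Sheaf RingCat.{u} X)

/-- Restriction of `𝒜(X)`-modules to `V`, formed through `W`. -/
abbrev restr₂ {V W : Opens X} (hW : V ≤ W) :
    ModuleCat.{u} (ringOn 𝒜 (⊤ : Opens X)) ⥤ ModuleCat.{u} (ringOn 𝒜 V) :=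
  baseChange (res 𝒜 (le_top : W ≤ ⊤)) ⋙ baseChange (res 𝒜 hW)

variable {𝒜}

theorem eq_zero_of_res_eq_zero {ι : Type*} (V : ι → Opens X) (hV : ⨆ i, V i = ⊤)
    (r : ringOn 𝒜 (⊤ : Opens X)) (hr : ∀ i, res 𝒜 (le_top : V i ≤ ⊤) r = 0) : r = 0 := by
  refine eq_of_germ_eq fun x => ?_
  have hx : x ∈ ⨆ i, V i := by rw [hV]; trivial
  obtain ⟨i, hi⟩ := Opens.mem_iSup.1 hx
  rw [map_zero]
  exact (res_eq_zero_iff_germ r).1 (hr i) x (subset_closure hi)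

variable [T2Space X] [ParacompactSpace X]

theorem IsSoft.isRestriction_unit (h𝒜 : IsSoft 𝒜) {V W : Opens X} (hW : V ≤ W) {M : Type u}
    [AddCommGroup M] [Module (ringOn 𝒜 W) M] :
    IsRestriction (res 𝒜 hW) (BaseChange.unit (res 𝒜 hW) : M →+ Restr 𝒜 hW M) :=
  BaseChange.isRestriction (h𝒜.surjective_res hW) (h𝒜.hasLocalUnits hW)

theorem IsSoft.isRestriction_unit₂ (h𝒜 : IsSoft 𝒜) {V W : Opens X} (hW : V ≤ W) {M : Type u}
    [AddCommGroup M] [Module (ringOn 𝒜 (⊤ : Opens X)) M] :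
    IsRestriction (res 𝒜 (le_top : V ≤ ⊤))
      (unit₂ 𝒜 hW : M →+ Restr 𝒜 hW (Restr 𝒜 (le_top : W ≤ ⊤) M)) := by
  have h : (res 𝒜 hW).comp (res 𝒜 (le_top : W ≤ ⊤)) = res 𝒜 (le_top : V ≤ ⊤) :=
    RingHom.ext fun x => Sec.res_res 𝒜 (closure_mono hW) _ x
  rw [← h]
  exact (h𝒜.isRestriction_unit le_top).comp (h𝒜.isRestriction_unit hW)
    (h𝒜.surjective_res le_top)

/-- Preservation of homology is rewritten as preservation of finite limits and colimits, which
passes to composites. -/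
theorem IsSoft.restr₂_preservesHomology (h𝒜 : IsSoft 𝒜) {V W : Opens X} (hW : V ≤ W) :
    (restr₂ 𝒜 hW).PreservesHomology := by
  have e : ∀ {R S : Type u} [Ring R] [Ring S] (G : ModuleCat.{u} R ⥤ ModuleCat.{u} S) [G.Additive],
      G.PreservesHomology ↔
        Limits.PreservesFiniteLimits G ∧ Limits.PreservesFiniteColimits G :=
    fun G => (Functor.exact_tfae G).out 2 3
  obtain ⟨h1, h2⟩ := (e _).1
    (baseChange_preservesHomology (h𝒜.surjective_res hW) (h𝒜.hasLocalUnits hW))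
  obtain ⟨h3, h4⟩ := (e _).1 (baseChange_preservesHomology
    (h𝒜.surjective_res (le_top : W ≤ ⊤)) (h𝒜.hasLocalUnits le_top))
  exact (e _).2 ⟨Limits.comp_preservesFiniteLimits _ _, Limits.comp_preservesFiniteColimits _ _⟩

/-- The two-step restriction through `W i` is the one that occurs in T(E), where E is restricted to
U_i and then to the intersection attached to the tuple (i). -/
theorem IsSoft.isDescentFamily (h𝒜 : IsSoft 𝒜) {ι : Type u} [Finite ι] (V W : ι → Opens X)
    (hVW : ∀ i, V i ≤ W i) (hV : ⨆ i, V i = ⊤) :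
    IsDescentFamily fun i => restr₂ 𝒜 (hVW i) := by
  cases nonempty_fintype ι
  refine ⟨fun M hM => ?_, fun M hM => ?_, fun M hM => ?_, fun i M hM => ?_, fun i M hM => ?_⟩
  · rw [ModuleCat.isZero_iff_subsingleton]
    refine subsingleton_of_forall_eq 0 fun m => ?_
    refine eq_zero_of_restriction (fun i => res 𝒜 (le_top : V i ≤ ⊤))
      (eq_zero_of_res_eq_zero V hV) m fun i => ?_
    refine (h𝒜.isRestriction_unit₂ (hVW i)).exists_unit m ?_
    have := ModuleCat.subsingleton_of_isZero (hM i)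
    exact this.elim _ _
  · exact finite_of_restriction _ (fun i => h𝒜.surjective_res le_top)
      (eq_zero_of_res_eq_zero V hV) _ _ (fun i => h𝒜.isRestriction_unit₂ (hVW i)) hM
  · exact projective_of_restriction _ (fun i => h𝒜.surjective_res le_top)
      (fun i => h𝒜.hasLocalUnits le_top)
      (eq_zero_of_res_eq_zero V hV) _ _ (fun i => h𝒜.isRestriction_unit₂ (hVW i)) hM
  · exact BaseChange.finite (BaseChange.finite hM)
  · exact BaseChange.projective (BaseChange.projective hM)

end CoverDescent

/-! ### Extension by zero with the help of a bump function -/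

section Extend

variable {R S : Type u} [Ring R] [Ring S] {f : R →+* S} {M N : Type u} [AddCommGroup M]
  [Module R M] [AddCommGroup N] [Module S N] {u : M →+ N}

/-- The difference m - m' is fixed by some e in the kernel of f, and ρ annihilates e. This is what
makes extension by zero well defined. -/
theorem IsRestriction.smul_eq_smul (hu : IsRestriction f u) {ρ : R}
    (hρ : ∀ e, f e = 0 → ρ * e = 0) {m m' : M} (h : u m = u m') : ρ • m = ρ • m' := by
  obtain ⟨e, he, h1⟩ := hu.exists_unit (m - m') (by rw [map_sub, h, sub_self])
  rw [← sub_eq_zero, ← smul_sub, ← h1, smul_smul, hρ e he, zero_smul]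

/-- The map `N → M` that multiplication by `ρ` on `M` induces if `ρ` annihilates the kernel of
`M → N`. -/
def IsRestriction.extend (hu : IsRestriction f u) (ρ : R) (hρ : ∀ e, f e = 0 → ρ * e = 0) :
    N →+ M :=
  AddMonoidHom.mk' (fun n => ρ • Function.surjInv hu.surjective n) fun n n' => by
    rw [← smul_add]
    refine hu.smul_eq_smul hρ ?_
    simp only [map_add, Function.surjInv_eq]

theorem IsRestriction.extend_apply (hu : IsRestriction f u) (ρ : R)
    (hρ : ∀ e, f e = 0 → ρ * e = 0) (m : M) : hu.extend ρ hρ (u m) = ρ • m :=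
  hu.smul_eq_smul hρ (Function.surjInv_eq hu.surjective _)

variable {X : TopCat.{u}} {𝒜 : TopCat.Sheaf RingCat.{u} X}

/-- The germs of the section `ρ` vanish outside of `O`. -/
def SupportedIn (ρ : GlobalRing 𝒜) (O : Opens X) : Prop := ∀ x, x ∉ O → germ x ρ = 0

/-- A point of the closure of V that lies in the open set O is in the closure of V ∩ O, where e has
zero germ; outside O the germ of ρ is zero. -/
theorem SupportedIn.res_mul_eq_zero {ρ : GlobalRing 𝒜} {O : Opens X} (hρ : SupportedIn ρ O)
    {V V' : Opens X} (hO : V ⊓ O ≤ V') {e : GlobalRing 𝒜}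
    (he : res 𝒜 (le_top : V' ≤ ⊤) e = 0) : res 𝒜 (le_top : V ≤ ⊤) (ρ * e) = 0 := by
  rw [res_eq_zero_iff_germ] at he ⊢
  intro x hx
  rw [map_mul]
  by_cases hxO : x ∈ O
  · rw [he x, mul_zero]
    have h1 : x ∈ closure ((V : Set X) ∩ O) := O.2.closure_inter ⟨hx, hxO⟩
    exact closure_mono hO h1
  · rw [hρ x hxO, zero_mul]

variable [T2Space X] [ParacompactSpace X] {V V' V'' W Y : Opens X} {P Q : Type u} [AddCommGroup P]
  [Module (ringOn 𝒜 W) P] [AddCommGroup Q] [Module (ringOn 𝒜 Y) Q]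

theorem IsSoft.isRestriction_shrink (h𝒜 : IsSoft 𝒜) (h : V' ≤ V) (hV : V ≤ W) (hV' : V' ≤ W) :
    IsRestriction (res 𝒜 h) (shrink 𝒜 h hV hV' : Restr 𝒜 hV P →ₛₗ[_] _).toAddMonoidHom where
  map_smul r m := map_smulₛₗ (shrink 𝒜 h hV hV') r m
  surjective y := by
    obtain ⟨m, rfl⟩ := (h𝒜.isRestriction_unit hV').surjective y
    refine ⟨BaseChange.unit _ m, ?_⟩
    change shrink 𝒜 h hV hV' (BaseChange.tmul _ 1 m) = _
    rw [shrink_tmul, map_one]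
    rfl
  exists_unit x hx := by
    obtain ⟨m, rfl⟩ := (h𝒜.isRestriction_unit hV).surjective x
    have h1 : BaseChange.unit (res 𝒜 hV') m = 0 := by
      rw [← hx]
      change _ = shrink 𝒜 h hV hV' (BaseChange.tmul _ 1 m)
      rw [shrink_tmul, map_one]
      rfl
    obtain ⟨e, he, h2⟩ := (h𝒜.isRestriction_unit hV').exists_unit m h1
    refine ⟨res 𝒜 hV e, by rw [Sec.res_res, he], ?_⟩
    rw [← BaseChange.unit_smul, h2]

theorem IsSoft.shrink_surjective (h𝒜 : IsSoft 𝒜) (h : V' ≤ V) (hV : V ≤ W) (hV' : V' ≤ W) :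
    Function.Surjective (shrink 𝒜 h hV hV' : Restr 𝒜 hV P →ₛₗ[_] Restr 𝒜 hV' P) :=
  (h𝒜.isRestriction_shrink h hV hV').surjective

theorem SupportedIn.mul_eq_zero {ρ : GlobalRing 𝒜} {O : Opens X} (hρ : SupportedIn ρ O)
    (h𝒜 : IsSoft 𝒜) (h : V' ≤ V) (hO : V ⊓ O ≤ V') (e : ringOn 𝒜 V) (he : res 𝒜 h e = 0) :
    res 𝒜 (le_top : V ≤ ⊤) ρ * e = 0 := by
  obtain ⟨e, rfl⟩ := h𝒜.surjective_res (le_top : V ≤ ⊤) e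
  rw [← map_mul]
  refine hρ.res_mul_eq_zero hO ?_
  rwa [Sec.res_res] at he

/-- Multiplication by `ρ` followed by extension by zero from `V ∩ O` to `V`. -/
def extend (h𝒜 : IsSoft 𝒜) {ρ : GlobalRing 𝒜} {O : Opens X} (hρ : SupportedIn ρ O)
    (hO : V ⊓ O ≤ V') (h : V' ≤ V) (hV : V ≤ W) (hV' : V' ≤ W) :
    Restr 𝒜 hV' P →+ Restr 𝒜 hV P :=
  (h𝒜.isRestriction_shrink h hV hV').extend (res 𝒜 (le_top : V ≤ ⊤) ρ)
    (hρ.mul_eq_zero h𝒜 h hO)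

variable (h𝒜 : IsSoft 𝒜) {ρ : GlobalRing 𝒜} {O : Opens X} (hρ : SupportedIn ρ O)

theorem extend_shrink (hO : V ⊓ O ≤ V') (h : V' ≤ V) (hV : V ≤ W) (hV' : V' ≤ W)
    (x : Restr 𝒜 hV P) :
    extend h𝒜 hρ hO h hV hV' (shrink 𝒜 h hV hV' x) = res 𝒜 (le_top : V ≤ ⊤) ρ • x :=
  (h𝒜.isRestriction_shrink h hV hV').extend_apply _ _ x

theorem map_extend (hO : V ⊓ O ≤ V') (h : V' ≤ V) (hV : V ≤ W) (hV' : V' ≤ W) (hY : V ≤ Y)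
    (hY' : V' ≤ Y) (k : Restr 𝒜 hV P →ₗ[ringOn 𝒜 V] Restr 𝒜 hY Q) (y : Restr 𝒜 hV' P) :
    k (extend h𝒜 hρ hO h hV hV' y) =
      extend h𝒜 hρ hO h hY hY' (shrinkHom 𝒜 h hV hV' hY hY' k y) := by
  obtain ⟨x, rfl⟩ := h𝒜.shrink_surjective h hV hV' y
  rw [extend_shrink, shrinkHom_shrink, extend_shrink, map_smul]

theorem shrink_extend {Z Z' : Opens X} (hO : V ⊓ O ≤ V') (h : V' ≤ V) (hV : V ≤ W) (hV' : V' ≤ W)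
    (hO' : Z ⊓ O ≤ Z') (g : Z' ≤ Z) (hZ : Z ≤ W) (hZ' : Z' ≤ W) (k : Z ≤ V) (k' : Z' ≤ V')
    (y : Restr 𝒜 hV' P) :
    shrink 𝒜 k hV hZ (extend h𝒜 hρ hO h hV hV' y) =
      extend h𝒜 hρ hO' g hZ hZ' (shrink 𝒜 k' hV' hZ' y) := by
  obtain ⟨x, rfl⟩ := h𝒜.shrink_surjective h hV hV' y
  rw [extend_shrink, map_smulₛₗ, Sec.res_res, shrink_shrink 𝒜 h k' (k'.trans h),
    ← shrink_shrink 𝒜 k g (k'.trans h) hV hZ hZ', extend_shrink]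

/-- A factor e on V' is moved inside the extension as ρ e on V. It serves to show that extensions
vanish over sets where ρ e does. -/
theorem extend_smul (hO : V ⊓ O ≤ V') (h : V' ≤ V) (hV : V ≤ W) (hV' : V' ≤ W)
    (e : GlobalRing 𝒜) (y : Restr 𝒜 hV' P) :
    ∃ x : Restr 𝒜 hV P, extend h𝒜 hρ hO h hV hV' (res 𝒜 (le_top : V' ≤ ⊤) e • y) =
      res 𝒜 (le_top : V ≤ ⊤) (ρ * e) • x := by
  obtain ⟨x, rfl⟩ := h𝒜.shrink_surjective h hV hV' y
  refine ⟨x, ?_⟩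
  have h1 : res 𝒜 (le_top : V' ≤ ⊤) e • shrink 𝒜 h hV hV' x =
      shrink 𝒜 h hV hV' (res 𝒜 (le_top : V ≤ ⊤) e • x) := by
    rw [map_smulₛₗ, Sec.res_res]
  rw [h1, extend_shrink, map_mul, mul_smul]

end Extend

/-! ### Tuples with an entry added at the end -/

section Snoc

variable {ι : Type u} {i j : ι} {p : ℕ}

/-- The tuple `(i)`. -/
def Chain.point (i : ι) : Chain i i 0 := ⟨fun _ => i, rfl, fun _ _ => rfl⟩

theorem Chain.eq_point (σ : Chain i i 0) : σ = Chain.point i :=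
  Chain.ext (funext fun x => σ.last x (Nat.zero_le x))

/-- The tuple `(i₀, …, i_p, l)`. -/
def Chain.snoc (σ : Chain i j p) (l : ι) : Chain i l (p + 1) where
  vertex x := if x ≤ p then σ.vertex x else l
  first := by rw [if_pos (Nat.zero_le p), σ.first]
  last x hx := if_neg (by omega)

theorem Chain.snoc_of_le (σ : Chain i j p) (l : ι) {x : ℕ} (hx : x ≤ p) :
    (σ.snoc l).vertex x = σ.vertex x := if_pos hx

theorem Chain.snoc_last (σ : Chain i j p) (l : ι) {x : ℕ} (hx : p < x) :
    (σ.snoc l).vertex x = l := if_neg (by omega)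

variable {X : TopCat.{u}} (U : ι → Opens X)

theorem Chain.le_inter (σ : Chain i j p) {V : Opens X} (h : ∀ x ≤ p, V ≤ U (σ.vertex x)) :
    V ≤ σ.inter U :=
  Finset.le_inf fun x hx => h x (by have := Finset.mem_range.1 hx; omega)

theorem Chain.inter_point (i : ι) : (Chain.point i).inter U = U i :=
  le_antisymm (Chain.inter_le_first U _) (Chain.le_inter U _ fun _ _ => le_rfl)

theorem Chain.inter_snoc_le (σ : Chain i j p) (l : ι) : (σ.snoc l).inter U ≤ σ.inter U :=
  σ.le_inter U fun x hx => ((σ.snoc l).inter_le U x).trans_eq (by rw [σ.snoc_of_le l hx])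

theorem Chain.inter_inf_le_snoc (σ : Chain i j p) (l : ι) :
    σ.inter U ⊓ U l ≤ (σ.snoc l).inter U := by
  refine (σ.snoc l).le_inter U fun x _ => ?_
  by_cases hx : x ≤ p
  · rw [σ.snoc_of_le l hx]
    exact inf_le_left.trans (σ.inter_le U x)
  · rw [σ.snoc_last l (by omega)]
    exact inf_le_right

theorem Chain.inter_snoc_le_snoc {k : ι} {r : ℕ} (σ : Chain i j p) {v w : ι} (τ : Chain v w r)
    (h : σ.inter U ≤ τ.inter U) : (σ.snoc k).inter U ≤ (τ.snoc k).inter U :=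
  (le_inf ((σ.inter_snoc_le U k).trans h) ((σ.snoc k).inter_le_last U)).trans
    (τ.inter_inf_le_snoc U k)

end Snoc

/-! ### The contracting homotopy of the Čech complex -/

namespace TwistedComplex

section Htpy

variable {X : TopCat.{u}} [T2Space X] [ParacompactSpace X] {𝒜 : TopCat.Sheaf RingCat.{u} X}
  (h𝒜 : IsSoft 𝒜) {ι : Type u} {U : ι → Opens X} {F : TwistedComplex 𝒜 U} {l : ι}
  {ρ : GlobalRing 𝒜} (hρ : SupportedIn ρ (U l))

/-- The homotopy `(h c)_{i₀…i_p} = (-1)^{p+1} ρ c_{i₀…i_p l}`. -/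
def sHtpy {n n' : ℤ} (hn : n + 1 = n') (c : F.SMod n') : F.SMod n := fun x =>
  (-1 : ℤ) ^ (x.p + 1) • extend h𝒜 hρ (x.σ.inter_inf_le_snoc U l) (x.σ.inter_snoc_le U l)
    (x.σ.inter_le_first U) ((x.σ.snoc l).inter_le_first U)
    (c.comp (x.σ.snoc l) x.q (by have := x.h; push_cast; omega))

/-- The map `(S y)_{i₀…i_p} = (-1)^p ρ a_{i₀…i_p l} y`. -/
def sSec {n : ℤ} {V : Opens X} (hV : V ≤ U l) (hlV : U l ≤ V)
    (y : Restr 𝒜 hV ((F.obj l).X n)) : F.SMod n := fun x =>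
  (-1 : ℤ) ^ x.p • extend h𝒜 hρ (x.σ.inter_inf_le_snoc U l) (x.σ.inter_snoc_le U l)
    (x.σ.inter_le_first U) ((x.σ.snoc l).inter_le_first U)
    (F.a (x.p + 1) x.i l (x.σ.snoc l) n x.q (by have := x.h; push_cast; omega)
      (shrink 𝒜 (((x.σ.snoc l).inter_le_last U).trans hlV) hV ((x.σ.snoc l).inter_le_last U) y))

theorem sHtpy_comp {n n' : ℤ} (hn : n + 1 = n') (c : F.SMod n') {p : ℕ} {i j : ι}
    (σ : Chain i j p) (q : ℤ) (h : q + p = n) :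
    (sHtpy h𝒜 hρ hn c).comp σ q h =
      (-1 : ℤ) ^ (p + 1) • extend h𝒜 hρ (σ.inter_inf_le_snoc U l) (σ.inter_snoc_le U l)
        (σ.inter_le_first U) ((σ.snoc l).inter_le_first U)
        (c.comp (σ.snoc l) q (by push_cast; omega)) := rfl

theorem sSec_comp {n : ℤ} {V : Opens X} (hV : V ≤ U l) (hlV : U l ≤ V)
    (y : Restr 𝒜 hV ((F.obj l).X n)) {p : ℕ} {i j : ι} (σ : Chain i j p) (q : ℤ) (h : q + p = n) :
    (sSec h𝒜 hρ hV hlV y).comp σ q h =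
      (-1 : ℤ) ^ p • extend h𝒜 hρ (σ.inter_inf_le_snoc U l) (σ.inter_snoc_le U l)
        (σ.inter_le_first U) ((σ.snoc l).inter_le_first U)
        (F.a (p + 1) i l (σ.snoc l) n q (by push_cast; omega)
          (shrink 𝒜 (((σ.snoc l).inter_le_last U).trans hlV) hV ((σ.snoc l).inter_le_last U)
            y)) := rfl

variable {i j : ι} {p : ℕ} (σ : Chain i j p)

theorem aAt_extend (f : ℕ → ℕ) (t : ℕ) (hf : ∀ x ≤ t, f x ≤ p) {v w : ι} (hV : σ.inter U ≤ U v)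
    (hW : σ.inter U ≤ U w) (hV' : (σ.snoc l).inter U ≤ U v) (hW' : (σ.snoc l).inter U ≤ U w)
    (m q : ℤ) (y : Restr 𝒜 hW' ((F.obj w).X m)) :
    aAt σ f t hV hW m q (extend h𝒜 hρ (σ.inter_inf_le_snoc U l) (σ.inter_snoc_le U l) hW hW' y) =
      extend h𝒜 hρ (σ.inter_inf_le_snoc U l) (σ.inter_snoc_le U l) hV hV'
        (aAt (σ.snoc l) f t hV' hW' m q y) := by
  rw [map_extend h𝒜 hρ _ _ hW hW' hV hV']
  congr 2
  by_cases h : σ.vertex (f 0) = v ∧ σ.vertex (f t) = w ∧ m + 1 = q + t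
  · rw [aAt, dif_pos h, shrinkHom_shrinkHom 𝒜 _ _ ((σ.inter_snoc_le U l).trans
      (σ.inter_le_sub U f t h.1 h.2.1))]
    refine aAt_eq f hV' hW' h.2.2 _ _ fun x hx => ?_
    simp only [Chain.sub, min_eq_left hx, σ.snoc_of_le l (hf x hx)]
  · rw [aAt, aAt, dif_neg h, dif_neg]
    · exact (shrinkHomAdd 𝒜 (σ.inter_snoc_le U l) hW hW' hV hV').map_zero
    · rwa [σ.snoc_of_le l (hf 0 (Nat.zero_le _)), σ.snoc_of_le l (hf t le_rfl)]

/-- The map g agrees with f on the first r + 1 places and sends the next one to p + 1, the place of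
the appended index l. -/
theorem cAt_sHtpy {n n' : ℤ} (hn : n + 1 = n') (c : F.SMod n') (f g : ℕ → ℕ) (r : ℕ)
    (hf : ∀ x ≤ r, f x ≤ p) (hfg : ∀ x ≤ r, g x = f x) (hg : g (r + 1) = p + 1) {v : ι}
    (hV : σ.inter U ≤ U v) (hV' : (σ.snoc l).inter U ≤ U v) (q : ℤ) :
    cAt σ (sHtpy h𝒜 hρ hn c) f r hV q =
      (-1 : ℤ) ^ (r + 1) • extend h𝒜 hρ (σ.inter_inf_le_snoc U l) (σ.inter_snoc_le U l) hV hV'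
        (cAt (σ.snoc l) c g (r + 1) hV' q) := by
  have h0 : (σ.snoc l).vertex (g 0) = σ.vertex (f 0) := by
    rw [hfg 0 (Nat.zero_le _), σ.snoc_of_le l (hf 0 (Nat.zero_le _))]
  by_cases h : σ.vertex (f 0) = v ∧ q + r = n
  · rw [cAt, dif_pos h, sHtpy_comp, map_zsmul]
    congr 1
    rw [shrink_extend h𝒜 hρ _ _ _ _ (σ.inter_inf_le_snoc U l) (σ.inter_snoc_le U l) hV hV' _
      (σ.inter_snoc_le_snoc U _ (σ.inter_le_sub U f r h.1 rfl))]
    congr 1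
    refine cAt_eq c g hV' (h0.trans h.1) _ _ _ fun x hx => ?_
    rcases Nat.lt_or_ge r x with hx' | hx'
    · obtain rfl : x = r + 1 := by omega
      rw [hg, Chain.snoc_last _ _ (Nat.lt_succ_self r), Chain.snoc_last _ _ (Nat.lt_succ_self p)]
    · rw [Chain.snoc_of_le _ _ hx', hfg x hx', Chain.snoc_of_le _ _ (hf x hx')]
      simp only [Chain.sub, min_eq_left hx']
  · rw [cAt, cAt, dif_neg h, dif_neg, map_zero, smul_zero]
    rw [h0]
    rintro ⟨h1, h2⟩
    exact h ⟨h1, by push_cast at h2; omega⟩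

/-- The Čech differential of S(F) also omits the last index, so appending l contracts it. All terms
of d h cancel against terms of h d in which l is kept and the operation takes place before it. Two
terms of h d remain: omission of l, which returns ρ c, and the full coefficient a_{i₀…i_p l} applied
to c_l, which returns the map S. Only the component c_l enters, given as y on a set that equals U_l.
-/
theorem sDiff_sHtpy_add {n n' n'' : ℤ} (hn : n + 1 = n') (hn' : n' + 1 = n'') (c : F.SMod n')
    {V : Opens X} (hV : V ≤ U l) (hlV : U l ≤ V) (y : Restr 𝒜 hV ((F.obj l).X n'))
    (hy : ∀ h, shrink 𝒜 h _ hV (c.comp (Chain.point l) n' (by simp)) = y) :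
    F.sDiff hn (sHtpy h𝒜 hρ hn c) + sHtpy h𝒜 hρ hn' (F.sDiff hn' c) =
      (ρ : ringOn 𝒜 (⊤ : Opens X)) • c - sSec h𝒜 hρ hV hlV y := by
  refine SMod.ext fun p i j σ q hq => ?_
  have hV1 := σ.inter_le_first U
  have hV1' := (σ.snoc l).inter_le_first U
  have h0 := cAt_eq (σ := σ) (F.sDiff hn (sHtpy h𝒜 hρ hn c)) (fun x => x) hV1 σ.first hq σ le_rfl
    (fun _ _ => rfl)
  rw [shrink_self, cAt_sDiff hn _ _ _ hV1 q σ.first hq] at h0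
  have h1 := cAt_eq (σ := σ.snoc l) (F.sDiff hn' c) (fun x => x) hV1' (σ.snoc l).first
    (show q + (p + 1 : ℕ) = n'' by push_cast; omega) (σ.snoc l) le_rfl (fun _ _ => rfl)
  rw [shrink_self, cAt_sDiff hn' _ _ _ hV1' q (σ.snoc l).first (by push_cast; omega)] at h1
  let ext : Restr 𝒜 hV1' ((F.obj i).X q) →+ Restr 𝒜 hV1 ((F.obj i).X q) :=
    extend h𝒜 hρ (σ.inter_inf_le_snoc U l) (σ.inter_snoc_le U l) hV1 hV1'
  -- Omitting one of i₁, …, i_p commutes with appending l. A face has one entry fewer, so the sign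
  -- of the homotopy on it is the opposite one and the two contributions cancel.
  have hA : ∀ s ∈ Finset.range p, (-1 : ℤ) ^ (s + 1) •
      cAt σ (sHtpy h𝒜 hρ hn c) (fun x => skip (s + 1) x) (p - 1) hV1 q =
      - ((-1 : ℤ) ^ (p + 1) • (-1 : ℤ) ^ (s + 1) •
        ext (cAt (σ.snoc l) c (fun x => skip (s + 1) x) (p + 1 - 1) hV1' q)) := by
    intro s hs
    have hs := Finset.mem_range.1 hs
    obtain ⟨r, rfl⟩ : ∃ r, p = r + 1 := ⟨p - 1, by omega⟩
    rw [cAt_sHtpy h𝒜 hρ σ hn c _ (fun x => skip (s + 1) x) (r + 1 - 1) _ (fun _ _ => rfl) _ hV1 hV1']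
    · rw [smul_smul, smul_smul, ← neg_smul]
      simp only [Nat.add_sub_cancel]
      congr 1
      ring
    · intro x hx; unfold skip; split_ifs <;> omega
    · unfold skip; split_ifs <;> omega
  -- The coefficients a_{i₀…i_t} are linear and so commute with the extension by zero; the longer
  -- back tuple changes the sign of the product, which gives the cancellation.
  have hB : ∀ t ∈ Finset.range (p + 1), ((1 - (t : ℤ)) * ((p - t : ℕ) : ℤ)).negOnePow •
        aAt σ (fun x => x) t hV1 (σ.inter_le U t) (q + t - 1) q
          (cAt σ (sHtpy h𝒜 hρ hn c) (fun x => t + x) (p - t) (σ.inter_le U t) (q + t - 1)) =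
      - ((-1 : ℤ) ^ (p + 1) • ((1 - (t : ℤ)) * ((p + 1 - t : ℕ) : ℤ)).negOnePow •
        ext (aAt (σ.snoc l) (fun x => x) t hV1' ((σ.snoc l).inter_le U t) (q + t - 1) q
          (cAt (σ.snoc l) c (fun x => t + x) (p + 1 - t) ((σ.snoc l).inter_le U t)
            (q + t - 1)))) := by
    intro t ht
    have ht := Finset.mem_range.1 ht
    obtain ⟨r, rfl⟩ : ∃ r, p = t + r := ⟨p - t, by omega⟩
    have hvt : (σ.snoc l).vertex t = σ.vertex t := σ.snoc_of_le l (by omega)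
    have hW : (σ.snoc l).inter U ≤ U (σ.vertex t) := by
      rw [← hvt]; exact (σ.snoc l).inter_le U t
    rw [cAt_sHtpy h𝒜 hρ σ hn c _ (fun x => t + x) (t + r - t) _ (fun _ _ => rfl) _ _ hW]
    · rw [map_zsmul, aAt_extend h𝒜 hρ σ (fun x => x) t (fun x hx => by omega) hV1 _ hV1' hW,
        aAt_cAt_congr c hV1' hW ((σ.snoc l).inter_le U t) hvt.symm rfl
        (show t + r - t + 1 = t + r + 1 - t by omega) (fun _ _ => rfl) (fun _ _ => rfl)]
      rw [negOnePow_natCast_smul, negOnePow_natCast_smul, smul_smul, smul_smul, ← Units.neg_smul,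
        ← Int.negOnePow_add, ← Int.negOnePow_add, ← Int.negOnePow_succ]
      congr 1
      rw [Int.negOnePow_eq_iff, show t + r - t = r by omega, show t + r + 1 - t = r + 1 by omega]
      push_cast
      exact ⟨-1, by ring⟩
    · intro x hx; omega
    · omega
  -- The face that omits the appended index l returns the original tuple.
  have hC : cAt (σ.snoc l) c (fun x => skip (p + 1) x) (p + 1 - 1) hV1' q =
      shrink 𝒜 (σ.inter_snoc_le U l) hV1 hV1' (c.comp σ q hq) := by
    refine (cAt_eq c _ hV1' ?_ hq σ _ fun x hx => ?_).symm
    · rw [skip_zero, (σ.snoc l).first]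
    · rw [skip, if_pos (by omega), σ.snoc_of_le l hx]
  -- For t = p + 1 the back tuple is (l) alone, and this is the term in which only c_l = y is seen.
  have hD : aAt (σ.snoc l) (fun x => x) (p + 1) hV1' ((σ.snoc l).inter_le U (p + 1))
        (q + (p + 1 : ℕ) - 1) q
        (cAt (σ.snoc l) c (fun x => p + 1 + x) (p + 1 - (p + 1)) ((σ.snoc l).inter_le U (p + 1))
          (q + (p + 1 : ℕ) - 1)) =
      F.a (p + 1) i l (σ.snoc l) n' q (by push_cast; omega)
          (shrink 𝒜 (((σ.snoc l).inter_le_last U).trans hlV) hV ((σ.snoc l).inter_le_last U)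
            y) := by
    have hl := (σ.snoc l).inter_le_last U
    have hlp : U l ≤ (Chain.point l).inter U := (Chain.inter_point U l).ge
    have e1 := aAt_eq (F := F) (σ := σ.snoc l) (fun x => x) hV1' hl
      (show n' + 1 = q + (p + 1 : ℕ) by push_cast; omega) (σ.snoc l) le_rfl fun _ _ => rfl
    have e2 := cAt_eq (σ := σ.snoc l) c (fun x => p + 1 + x) hl
      ((σ.snoc l).last _ (Nat.le_add_right _ _)) (show n' + (0 : ℕ) = n' by simp)
      (Chain.point l) (hl.trans hlp) fun x hx => ((σ.snoc l).last _ (Nat.le_add_right _ _)).symm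
    rw [aAt_cAt_congr c hV1' _ hl ((σ.snoc l).last _ le_rfl)
      (show q + (p + 1 : ℕ) - 1 = n' by push_cast; omega) (Nat.sub_self _) (fun _ _ => rfl)
      (fun _ _ => rfl), ← e1, ← e2, ← hy (hV.trans hlp),
      shrink_shrink 𝒜 _ _ (hl.trans hlp)]
    refine congrArg (fun g : _ →ₗ[_] _ => g _) ?_
    exact shrinkHom_ext 𝒜 le_rfl hl hl hV1' fun x => by rw [shrinkHom_shrink, shrink_self, shrink_self]
  rw [Finset.sum_congr rfl hA, Finset.sum_congr rfl hB] at h0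
  rw [Finset.sum_range_succ _ p, Finset.sum_range_succ _ (p + 1), hC, hD] at h1
  have hR : ((ρ : ringOn 𝒜 (⊤ : Opens X)) • c - sSec h𝒜 hρ hV hlV y).comp σ q hq =
      ((ρ : ringOn 𝒜 (⊤ : Opens X)) • c).comp σ q hq - (sSec h𝒜 hρ hV hlV y).comp σ q hq := rfl
  rw [SMod.comp_add, sHtpy_comp, h0, h1, hR, SMod.comp_smul, sSec_comp,
    ← extend_shrink h𝒜 hρ (σ.inter_inf_le_snoc U l) (σ.inter_snoc_le U l) hV1 hV1']
  change _ + (-1 : ℤ) ^ (p + 1) • ext _ = ext _ - (-1 : ℤ) ^ p • ext _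
  simp only [map_add, map_sum, map_zsmul, smul_add, Finset.smul_sum, Finset.sum_neg_distrib,
    Units.smul_def]
  have hs : (-1 : ℤ) ^ (p + 1) * (-1 : ℤ) ^ (p + 1) = 1 := by
    rw [← mul_pow]; simp
  rw [Nat.sub_self, Nat.cast_zero, mul_zero, Int.negOnePow_zero, Units.val_one, one_smul,
    smul_smul ((-1 : ℤ) ^ (p + 1)) ((-1 : ℤ) ^ (p + 1)), hs, one_smul, pow_succ (-1 : ℤ) p,
    mul_neg_one, neg_smul]
  abel

end Htpy

end TwistedComplex

/-! ### Restriction to smaller sets of maps that are already defined over W. -/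

section ShrinkMap

variable {X : TopCat.{u}} (𝒜 : TopCat.Sheaf RingCat.{u} X) {V V' W : Opens X}
  {M N : Type u} [AddCommGroup M] [Module (ringOn 𝒜 W) M] [AddCommGroup N] [Module (ringOn 𝒜 W) N]

theorem shrink_map (h : V' ≤ V) (hV : V ≤ W) (hV' : V' ≤ W) (k : M →ₗ[ringOn 𝒜 W] N)
    (x : Restr 𝒜 hV M) :
    shrink 𝒜 h hV hV' (BaseChange.map (res 𝒜 hV) k x) =
      BaseChange.map (res 𝒜 hV') k (shrink 𝒜 h hV hV' x) := by
  induction x using BaseChange.induction with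
  | h0 => simp only [map_zero]
  | ht s m => simp only [shrink_tmul, BaseChange.map_tmul]
  | ha x y hx hy => simp only [map_add, hx, hy]

theorem shrinkHom_map (h : V' ≤ V) (hV : V ≤ W) (hV' : V' ≤ W) (k : M →ₗ[ringOn 𝒜 W] N) :
    shrinkHom 𝒜 h hV hV' hV hV' (BaseChange.map (res 𝒜 hV) k) = BaseChange.map (res 𝒜 hV') k :=
  shrinkHom_ext 𝒜 h hV hV' hV' fun x => by rw [shrinkHom_shrink, shrink_map]

theorem shrinkHom_self (h : V ≤ V) (hV : V ≤ W) {Y : Opens X} (hY : V ≤ Y) {P : Type u}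
    [AddCommGroup P] [Module (ringOn 𝒜 Y) P] (k : Restr 𝒜 hV M →ₗ[ringOn 𝒜 V] Restr 𝒜 hY P) :
    shrinkHom 𝒜 h hV hV hY hY k = k :=
  shrinkHom_ext 𝒜 h hV hV hY fun x => by rw [shrinkHom_shrink, shrink_self, shrink_self]

end ShrinkMap

namespace TwistedComplex

/-! ### The Maurer-Cartan equation and the differential of S(F) in low Čech degree. -/

section LowDegree

variable {X : TopCat.{u}} {𝒜 : TopCat.Sheaf RingCat.{u} X} {ι : Type u} {U : ι → Opens X}
  {F : TwistedComplex 𝒜 U}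

variable (F) in
/-- The differential of `F_i`, restricted to `V`. -/
abbrev dOn {V : Opens X} {i : ι} (hV : V ≤ U i) (m n : ℤ) :
    Restr 𝒜 hV ((F.obj i).X m) →ₗ[ringOn 𝒜 V] Restr 𝒜 hV ((F.obj i).X n) :=
  BaseChange.map (res 𝒜 hV) ((F.obj i).d m n).hom

variable {i j : ι} {K : ℕ} {σ : Chain i j K}

theorem aAt_zero (f : ℕ → ℕ) {v : ι} (hV : σ.inter U ≤ U v) {m q : ℤ}
    (hmq : m + 1 = q) (hv : σ.vertex (f 0) = v) :
    aAt (F := F) σ f 0 hV hV m q = dOn F hV m q := by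
  rw [← aAt_eq (F := F) f hV hV (show m + 1 = q + (0 : ℕ) by simpa using hmq) (Chain.point v)
    (hV.trans (Chain.inter_point U v).ge) (fun x hx => by
      obtain rfl : x = 0 := by omega
      exact hv.symm), F.a_zero, shrinkHom_map]

theorem aAt_comp_congr {f f' g g' : ℕ → ℕ} {p r r' : ℕ} {v w w' z : ι}
    (hV : σ.inter U ≤ U v) (hW : σ.inter U ≤ U w) (hW' : σ.inter U ≤ U w')
    (hZ : σ.inter U ≤ U z) {m n n' q : ℤ}
    (hw : w = w') (hn : n = n') (hr : r = r')
    (H : ∀ x ≤ p, σ.vertex (f x) = σ.vertex (f' x))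
    (H' : ∀ x ≤ r, σ.vertex (g x) = σ.vertex (g' x)) :
    aAt (F := F) σ f p hV hW n q ∘ₗ aAt σ g r hW hZ m n =
      aAt σ f' p hV hW' n' q ∘ₗ aAt σ g' r' hW' hZ m n' := by
  subst hw hn hr
  rw [aAt_congr hV hW H, aAt_congr hW hZ H']

/-- The components of Čech degree one of `a` commute with the differentials. -/
theorem aAt_one_dOn {w : ι} (hV : σ.inter U ≤ U i) (hW : σ.inter U ≤ U w)
    (hw : σ.vertex 1 = w) (m q : ℤ) (hmq : m + 1 = q) (x : Restr 𝒜 hW ((F.obj w).X m)) :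
    aAt (F := F) σ (fun x => x) 1 hV hW q q (dOn F hW m q x) =
      dOn F hV m q (aAt σ (fun x => x) 1 hV hW m m x) := by
  have key := mc_at (F := F) (σ := σ) 1 hV hW hw m q (by push_cast; omega)
  rw [Nat.sub_self, Finset.range_zero, Finset.sum_empty, zero_add, Finset.sum_range_succ,
    Finset.sum_range_one,
    aAt_comp_congr (p := 0) (f' := fun x => x) (g' := fun x => x) (r' := 1) (n' := m) hV _ hV hW
      σ.first (by push_cast; omega) (by omega) (fun _ _ => rfl) (fun x _ => by rw [zero_add]),
    aAt_comp_congr (p := 1) (f' := fun x => x) (g' := fun x => 1 + x) (r' := 0) (n' := q) hV _ hW hW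
      hw (by push_cast; omega) (by omega) (fun _ _ => rfl) (fun x _ => rfl),
    aAt_zero _ hV hmq σ.first, aAt_zero _ hW hmq hw] at key
  have key' := congrArg (fun g => g x) key
  simp only [Nat.cast_zero, Nat.cast_one, sub_zero, Nat.sub_zero, Nat.sub_self, mul_one, mul_zero,
    Int.negOnePow_one, Int.negOnePow_zero, one_smul, Units.neg_smul, LinearMap.add_apply,
    LinearMap.neg_apply, LinearMap.comp_apply, LinearMap.zero_apply] at key'
  rw [neg_add_eq_zero] at key'
  exact key'.symm

/-- The composition of two components of Čech degree one of `a` is homotopic to a component of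
Čech degree one. -/
theorem aAt_one_aAt_one {v w : ι} (hV : σ.inter U ≤ U i) (hY : σ.inter U ≤ U v)
    (hW : σ.inter U ≤ U w) (hv : σ.vertex 1 = v)
    (hw : σ.vertex 2 = w) (m m' m'' : ℤ) (hm : m' + 1 = m) (hm' : m + 1 = m'')
    (x : Restr 𝒜 hW ((F.obj w).X m)) :
    aAt (F := F) σ (fun x => x) 1 hV hY m m (aAt σ (fun x => 1 + x) 1 hY hW m m x) =
      aAt σ (fun x => skip 1 x) 1 hV hW m m x
        - dOn F hV m' m (aAt σ (fun x => x) 2 hV hW m m' x)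
        - aAt σ (fun x => x) 2 hV hW m'' m (dOn F hW m m'' x) := by
  have key := mc_at (F := F) (σ := σ) 2 hV hW hw m m (by push_cast; omega)
  rw [show 2 - 1 = 1 from rfl, Finset.sum_range_one, Finset.sum_range_succ, Finset.sum_range_succ,
    Finset.sum_range_one,
    aAt_comp_congr (p := 0) (f' := fun x => x) (g' := fun x => x) (r' := 2) (n' := m') hV _ hV hW
      σ.first (by push_cast; omega) (by omega) (fun _ _ => rfl) (fun x _ => by rw [zero_add]),
    aAt_comp_congr (p := 1) (f' := fun x => x) (g' := fun x => 1 + x) (r' := 1) (n' := m) hV _ hY hW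
      hv (by push_cast; omega) (by omega) (fun _ _ => rfl) (fun x _ => rfl),
    aAt_comp_congr (p := 2) (f' := fun x => x) (g' := fun x => 2 + x) (r' := 0) (n' := m'') hV _ hW
      hW hw (by push_cast; omega) (by omega) (fun _ _ => rfl) (fun x _ => rfl),
    aAt_zero _ hV hm σ.first, aAt_zero _ hW hm' hw] at key
  have key' := congrArg (fun g => g x) key
  have e2 : (2 : ℤ).negOnePow = 1 := rfl
  simp only [zero_add, pow_one, Nat.cast_zero, Nat.cast_one, Nat.cast_ofNat, sub_zero, Nat.sub_zero,
    sub_self, Nat.sub_self, one_mul, zero_mul, mul_zero, e2, neg_smul,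
    Int.negOnePow_zero, one_smul, LinearMap.add_apply,
    LinearMap.neg_apply, LinearMap.comp_apply, LinearMap.zero_apply] at key'
  rw [neg_add_eq_zero] at key'
  rw [key']
  abel

variable (F) in
theorem comp_point_sDiff {n n' : ℤ} (hn : n + 1 = n') (c : F.SMod n) (l : ι) :
    (F.sDiff hn c).comp (Chain.point l) n' (by simp) =
      dOn F (Chain.inter_le_first U _) n n' (c.comp (Chain.point l) n (by simp)) := by
  have hV := (Chain.point l).inter_le_first U
  have h0 := cAt_eq (σ := Chain.point l) (F.sDiff hn c) (fun x => x) hV rfl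
    (show n' + (0 : ℕ) = n' by simp) (Chain.point l) le_rfl (fun _ _ => rfl)
  have h1 := cAt_eq (σ := Chain.point l) c (fun x => x) hV rfl
    (show n + (0 : ℕ) = n by simp) (Chain.point l) le_rfl (fun _ _ => rfl)
  rw [shrink_self] at h0 h1
  rw [h0, h1, cAt_sDiff hn _ _ _ hV n' rfl (by simp), Finset.range_zero, Finset.sum_empty,
    zero_add, Finset.sum_range_one, aAt_cAt_congr (p := 0) c hV _ hV (m' := n) (f' := fun x => x)
      (g := fun x => 0 + x) (g' := fun x => x) (r' := 0) (Chain.point l).first (by push_cast; omega)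
      (by omega) (fun _ _ => rfl) (fun x _ => congrArg _ (zero_add x)), aAt_zero _ hV hn rfl]
  simp

variable (F) in
-- Its use: if c is closed over U_k, then on U_l ∩ U_k the component c_l equals a_{lk} c_k up to the
-- boundary of c_{lk}.
theorem comp_pair_sDiff {n n' m : ℤ} (hn : n + 1 = n') (hm : m + 1 = n) (c : F.SMod n) (l k : ι) :
    (F.sDiff hn c).comp ((Chain.point l).snoc k) n (by push_cast; omega) =
      aAt ((Chain.point l).snoc k) (fun x => x) 1 (Chain.inter_le_first U _)
        (Chain.inter_le_last U _) n n
        (cAt ((Chain.point l).snoc k) c (fun x => 1 + x) 0 (Chain.inter_le_last U _) n) -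
      dOn F (Chain.inter_le_first U _) m n
        (c.comp ((Chain.point l).snoc k) m (by push_cast; omega)) -
      shrink 𝒜 (Chain.inter_snoc_le U _ k) _ _ (c.comp (Chain.point l) n (by simp)) := by
  have hV := ((Chain.point l).snoc k).inter_le_first U
  have hW := ((Chain.point l).snoc k).inter_le_last U
  have h0 := cAt_eq (σ := (Chain.point l).snoc k) (F.sDiff hn c) (fun x => x) hV
    ((Chain.point l).snoc k).first
    (show n + (1 : ℕ) = n' by push_cast; omega) ((Chain.point l).snoc k) le_rfl (fun _ _ => rfl)
  have h1 := cAt_eq (σ := (Chain.point l).snoc k) c (fun x => x) hV ((Chain.point l).snoc k).first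
    (show m + (1 : ℕ) = n by push_cast; omega) ((Chain.point l).snoc k) le_rfl (fun _ _ => rfl)
  have h2 := cAt_eq (σ := (Chain.point l).snoc k) c (fun x => skip 1 x) hV
    ((Chain.point l).snoc k).first
    (show n + (0 : ℕ) = n by simp) (Chain.point l) (Chain.inter_snoc_le U _ k)
    (fun x hx => by
      obtain rfl : x = 0 := by omega
      exact ((Chain.point l).snoc k).first.symm)
  rw [shrink_self] at h0 h1
  rw [h0, h1, h2, cAt_sDiff hn _ _ _ hV n ((Chain.point l).snoc k).first (by push_cast; omega),
    Finset.sum_range_one,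
    Finset.sum_range_succ, Finset.sum_range_one, aAt_cAt_congr (p := 0) c hV _ hV (m' := m)
      (f' := fun x => x)
      (g' := fun x => x) (r' := 1) ((Chain.point l).snoc k).first (by push_cast; omega)
      (by omega) (fun _ _ => rfl) (fun x _ => congrArg _ (zero_add x)),
    aAt_cAt_congr (p := 1) c hV _ hW (m' := n)
      (f' := fun x => x)
      (g' := fun x => 1 + x) (r' := 0) (((Chain.point l).snoc k).last 1 le_rfl)
      (by push_cast; omega)
      (by omega) (fun _ _ => rfl) (fun x _ => rfl),
    aAt_zero _ hV hm ((Chain.point l).snoc k).first]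
  simp only [zero_add, pow_one, Nat.cast_zero, Nat.cast_one, sub_zero, Nat.sub_zero,
    sub_self, Nat.sub_self, one_mul, zero_mul, neg_smul, Units.neg_smul, Int.negOnePow_one,
    Int.negOnePow_zero, one_smul]
  abel

end LowDegree

end TwistedComplex

namespace TwistedComplex

/-! ### The local structure of the Čech complex -/

section Local

variable {X : TopCat.{u}} {𝒜 : TopCat.Sheaf RingCat.{u} X}
  {ι : Type u} {U : ι → Opens X} {F : TwistedComplex 𝒜 U}

/-- The module of sections of `F_l` over `U_l`. -/
abbrev Pt (F : TwistedComplex 𝒜 U) (l : ι) (n : ℤ) : Type u :=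
  Restr 𝒜 ((Chain.point l).inter_le_first U) ((F.obj l).X n)

variable (F) in
/-- The differential of the sections of `F_l` over `U_l`. -/
abbrev dPt (l : ι) (m n : ℤ) :
    F.Pt l m →ₗ[ringOn 𝒜 ((Chain.point l).inter U)] F.Pt l n :=
  dOn F ((Chain.point l).inter_le_first U) m n

/-- The component of `c` at `(l)`. -/
def SMod.pt {n : ℤ} (c : F.SMod n) (l : ι) : F.Pt l n := c.comp (Chain.point l) n (by simp)

theorem pt_sDiff {n n' : ℤ} (hn : n + 1 = n') (c : F.SMod n) (l : ι) :
    (F.sDiff hn c).pt l = F.dPt l n n' (c.pt l) := comp_point_sDiff F hn c l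

/-- The family whose only nonzero component is `y` at `x`. -/
def sSingle {n : ℤ} (x : SIdx ι n) (y : Restr 𝒜 (x.σ.inter_le_first U) ((F.obj x.i).X x.q)) :
    F.SMod n := fun x' =>
  open Classical in
  if hx : x = x' then Eq.rec (motive := fun (x : SIdx ι n) _ =>
    Restr 𝒜 (x.σ.inter_le_first U) ((F.obj x.i).X x.q)) y hx else 0

theorem sSingle_self {n : ℤ} (x : SIdx ι n)
    (y : Restr 𝒜 (x.σ.inter_le_first U) ((F.obj x.i).X x.q)) : sSingle x y x = y := by
  rw [sSingle, dif_pos rfl]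

theorem exists_pt_eq {n : ℤ} (l : ι) (y : F.Pt l n) : ∃ c : F.SMod n, c.pt l = y :=
  ⟨sSingle ⟨Chain.point l, n, by simp⟩ y, sSingle_self (F := F) ⟨Chain.point l, n, by simp⟩ y⟩

variable [T2Space X] [ParacompactSpace X] (h𝒜 : IsSoft 𝒜) {l : ι}
  {ρ : GlobalRing 𝒜} (hρ : SupportedIn ρ (U l))

/-- The map `(S y)_{i₀…i_p} = (-1)^p ρ a_{i₀…i_p l} y` as an additive map. -/
def sSecHom (n : ℤ) : F.Pt l n →+ F.SMod n :=
  AddMonoidHom.mk' (sSec h𝒜 hρ ((Chain.point l).inter_le_first U) (Chain.inter_point U l).ge)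
    fun y y' => SMod.ext fun p i j σ q h => by
      rw [SMod.comp_add, sSec_comp, sSec_comp, sSec_comp, map_add, map_add, map_add, smul_add]

/-- The homotopy `(h c)_{i₀…i_p} = (-1)^{p+1} ρ c_{i₀…i_p l}` as an additive map. -/
def sHtpyHom {n n' : ℤ} (hn : n + 1 = n') : F.SMod n' →+ F.SMod n :=
  AddMonoidHom.mk' (sHtpy h𝒜 hρ hn)
    fun c c' => SMod.ext fun p i j σ q h => by
      rw [SMod.comp_add, sHtpy_comp, sHtpy_comp, sHtpy_comp, SMod.comp_add, map_add, smul_add]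

theorem smul_eq_sHtpy {n n' n'' : ℤ} (hn : n + 1 = n') (hn' : n' + 1 = n'') (c : F.SMod n') :
    (ρ : ringOn 𝒜 (⊤ : Opens X)) • c = F.sDiff hn (sHtpyHom h𝒜 hρ hn c) +
      sHtpyHom h𝒜 hρ hn' (F.sDiff hn' c) + sSecHom h𝒜 hρ n' (c.pt l) := by
  rw [← sub_eq_iff_eq_add]
  exact (sDiff_sHtpy_add h𝒜 hρ hn hn' c _ (Chain.inter_point U l).ge _ fun h => shrink_self 𝒜 _ _ _).symm

/-- This is formal. Applying the differential to the homotopy formula for c and comparing with the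
formula for dc leaves d S(c_l) = S(d c_l), and every y occurs as some c_l. No computation with the
coefficients a is needed. -/
theorem sDiff_sSec {n n' : ℤ} (hn : n + 1 = n') (y : F.Pt l n) :
    F.sDiff hn (sSecHom h𝒜 hρ n y) = sSecHom h𝒜 hρ n' (F.dPt l n n' y) := by
  obtain ⟨c, rfl⟩ := exists_pt_eq l y
  have h1 := congrArg (F.sDiff hn) (smul_eq_sHtpy h𝒜 hρ (sub_add_cancel n 1) hn c)
  have h2 := smul_eq_sHtpy h𝒜 hρ hn rfl (F.sDiff hn c)
  rw [map_add, map_add, sDiff_sDiff, zero_add, map_smul] at h1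
  rw [sDiff_sDiff, map_zero, add_zero, h1, pt_sDiff] at h2
  exact add_left_cancel h2

variable (F) in
/-- The restriction of `S^n(F)` to `U_k`. -/
abbrev toPt (k : ι) (n : ℤ) : F.SMod n →+
    Restr 𝒜 ((Chain.point k).inter_le_last U) (Restr 𝒜 (le_top : U k ≤ ⊤) (F.SMod n)) :=
  unit₂ 𝒜 ((Chain.point k).inter_le_last U)

/-- Such a c is a multiple of the global section ρ e, and ρ e vanishes over U_k: e vanishes on U_l ∩
U_k and ρ is supported in U_l. -/
theorem toPt_eq_zero {k : ι} {n : ℤ} {e : GlobalRing 𝒜}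
    (he : res 𝒜 (le_top : ((Chain.point l).snoc k).inter U ≤ ⊤) e = 0) {c : F.SMod n}
    (hρ : SupportedIn ρ (U l))
    (h : ∀ (p : ℕ) (i j : ι) (σ : Chain i j p) (q : ℤ) (h : q + p = n),
      ∃ x, c.comp σ q h = res 𝒜 (le_top : σ.inter U ≤ ⊤) (ρ * e) • x) : F.toPt k n c = 0 := by
  choose x hx using h
  let c' : F.SMod n := fun y => x y.p y.i y.j y.σ y.q y.h
  have h1 : c = ((ρ * e : GlobalRing 𝒜) : ringOn 𝒜 (⊤ : Opens X)) • c' := SMod.ext hx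
  have h2 : (Chain.point k).inter U ⊓ U l ≤ ((Chain.point l).snoc k).inter U := by
    refine (le_inf ?_ ?_).trans ((Chain.point l).inter_inf_le_snoc U k)
    · rw [Chain.inter_point U l]
      exact inf_le_right
    · exact inf_le_left.trans (Chain.inter_le_first U _)
  rw [h1, unit₂_smul, hρ.res_mul_eq_zero h2 he, zero_smul]

/-- Over U_k the family S(z) depends only on the restriction of z to U_l ∩ U_k, because of the
factor ρ. -/
theorem toPt_sSec {k : ι} {n : ℤ} (z : F.Pt l n)
    (hz : shrink 𝒜 ((Chain.point l).inter_snoc_le U k) _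
      (((Chain.point l).snoc k).inter_le_first U) z = 0) :
    F.toPt k n (sSecHom h𝒜 hρ n z) = 0 := by
  obtain ⟨e, he, hez⟩ := (h𝒜.isRestriction_shrink _ _ _).exists_unit z hz
  obtain ⟨e, rfl⟩ := h𝒜.surjective_res (le_top : (Chain.point l).inter U ≤ ⊤) e
  rw [Sec.res_res] at he
  refine toPt_eq_zero he hρ fun p i j σ q h => ?_
  rw [← hez]
  change ∃ x, (sSec h𝒜 hρ _ (Chain.inter_point U l).ge _).comp σ q h = _
  rw [sSec_comp, map_smulₛₗ, Sec.res_res, map_smul]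
  obtain ⟨x, hx⟩ := extend_smul h𝒜 hρ (σ.inter_inf_le_snoc U l) (σ.inter_snoc_le U l)
        (σ.inter_le_first U) ((σ.snoc l).inter_le_first U) e
        (F.a (p + 1) i l (σ.snoc l) n q (by push_cast; omega)
          (shrink 𝒜 (((σ.snoc l).inter_le_last U).trans (Chain.inter_point U l).ge) _
            ((σ.snoc l).inter_le_last U) z))
  exact ⟨(-1 : ℤ) ^ p • x, (congrArg _ hx).trans (smul_comm _ _ _)⟩

/-- The homotopy is not linear over the cochain restriction by definition, but it maps families that
vanish over U_k to such families, since the killing factor e passes through the extension. -/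
theorem toPt_sHtpy {k : ι} {n n' : ℤ} (hn : n + 1 = n') (c : F.SMod n')
    (hc : F.toPt k n' c = 0) : F.toPt k n (sHtpyHom h𝒜 hρ hn c) = 0 := by
  obtain ⟨e, he, hez⟩ := (h𝒜.isRestriction_unit₂ _).exists_unit c hc
  have he' : res 𝒜 (le_top : ((Chain.point l).snoc k).inter U ≤ ⊤) e = 0 := by
    have h1 : ((Chain.point l).snoc k).inter U ≤ (Chain.point k).inter U := by
      rw [Chain.inter_point]
      exact Chain.inter_le_last U _
    rw [← Sec.res_res 𝒜 (closure_mono h1) (closure_mono le_top), he, map_zero]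
  refine toPt_eq_zero he' hρ fun p i j σ q h => ?_
  rw [← hez]
  change ∃ x, (sHtpy h𝒜 hρ hn _).comp σ q h = _
  rw [sHtpy_comp, SMod.comp_smul]
  obtain ⟨x, hx⟩ := extend_smul h𝒜 hρ (σ.inter_inf_le_snoc U l) (σ.inter_snoc_le U l)
        (σ.inter_le_first U) ((σ.snoc l).inter_le_first U) e
        (c.comp (σ.snoc l) q (by push_cast; omega))
  exact ⟨(-1 : ℤ) ^ (p + 1) • x, (congrArg _ hx).trans (smul_comm _ _ _)⟩

/-! ### Injectivity of evaluation on cohomology. -/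

section Partition

variable [Fintype ι] {ρ : ι → GlobalRing 𝒜}

/-- In the homotopy formula for ρ_l c the term with dc vanishes over U_k and one term is a boundary,
so S_l(c_l) must be shown to be a boundary over U_k. On U_l ∩ U_k the component c_l is d(a_{lk} x -
c_{lk}), and S_l commutes with differentials. The sum over l gives c itself. -/
theorem toPt_injective (h𝒜 : IsSoft 𝒜) (hρ : ∀ l, SupportedIn (ρ l) (U l)) (hρ1 : ∑ l, ρ l = 1) {k : ι} {m n n' : ℤ} (hm : m + 1 = n) (hn : n + 1 = n') (c : F.SMod n)
    (hc : F.toPt k n' (F.sDiff hn c) = 0) (x : F.Pt k m) (hx : F.dPt k m n x = c.pt k) :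
    ∃ c', F.toPt k n c = F.toPt k n (F.sDiff hm c') := by
  have hw : ∀ l, ∃ w : F.Pt l m, F.toPt k n (sSecHom h𝒜 (hρ l) n (c.pt l)) =
      F.toPt k n (F.sDiff hm (sSecHom h𝒜 (hρ l) m w)) := by
    intro l
    let τ := (Chain.point l).snoc k
    have hτ : τ.inter U ≤ (Chain.point l).inter U := (Chain.point l).inter_snoc_le U k
    have hτ' : τ.inter U ≤ (Chain.point k).inter U :=
      (Chain.inter_le_last U _).trans (Chain.inter_point U k).ge
    -- The primitive a_{lk} x - c_{lk} lives only on U_l ∩ U_k; softness lifts it to U_l.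
    obtain ⟨w, hw⟩ := h𝒜.shrink_surjective hτ (Chain.inter_le_first U _) (τ.inter_le_first U)
      (aAt (F := F) τ (fun x => x) 1 (τ.inter_le_first U) (τ.inter_le_last U) m m
        (shrink 𝒜 hτ' _ _ x) - c.comp τ m (by push_cast; omega))
    refine ⟨w, ?_⟩
    rw [sDiff_sSec, ← sub_eq_zero, ← map_sub, ← map_sub]
    refine toPt_sSec h𝒜 (hρ l) _ ?_
    -- Vanishing of dc over U_k forces its component at (l, k) to vanish, since U_l ∩ U_k lies in
    -- U_k.
    have h0 : (F.sDiff hn c).comp τ n (by push_cast; omega) = 0 := by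
      obtain ⟨e, he, hez⟩ := (h𝒜.isRestriction_unit₂ _).exists_unit _ hc
      rw [← hez, SMod.comp_smul, ← Sec.res_res 𝒜 (closure_mono hτ') (closure_mono le_top), he,
        map_zero, zero_smul]
    have h1 := comp_pair_sDiff F hn hm c l k
    rw [h0] at h1
    have h2 := cAt_eq (σ := τ) c (fun x => 1 + x) (τ.inter_le_last U)
      (τ.last _ (Nat.le_add_right _ _)) (show n + (0 : ℕ) = n by simp) (Chain.point k) hτ'
      fun x _ => (τ.last _ (Nat.le_add_right _ _)).symm
    rw [← h2] at h1
    change _ = _ - _ - shrink 𝒜 _ _ _ (c.pt l) at h1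
    rw [map_sub, shrink_map, hw, map_sub, ← aAt_one_dOn _ _ (τ.last 1 le_rfl) m n hm]
    change 0 = aAt τ _ 1 _ _ n n (shrink 𝒜 hτ' _ _ (c.pt k)) - _ - _ at h1
    rw [← hx, shrink_map, eq_comm, sub_eq_zero, eq_comm] at h1
    rw [h1, sub_self]
  choose w hw using hw
  refine ⟨∑ l, (sHtpyHom h𝒜 (hρ l) hm c + sSecHom h𝒜 (hρ l) m (w l)), ?_⟩
  have h1 : c = ∑ l, (ρ l : ringOn 𝒜 (⊤ : Opens X)) • c := by
    rw [← Finset.sum_smul]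
    exact ((congrArg (fun r : ringOn 𝒜 (⊤ : Opens X) => r • c) hρ1).trans (one_smul _ c)).symm
  have h2 : ∀ l, F.toPt k n ((ρ l : ringOn 𝒜 (⊤ : Opens X)) • c) =
      F.toPt k n (F.sDiff hm (sHtpyHom h𝒜 (hρ l) hm c + sSecHom h𝒜 (hρ l) m (w l))) := by
    intro l
    rw [smul_eq_sHtpy h𝒜 (hρ l) hm hn c, map_add, map_add, toPt_sHtpy h𝒜 (hρ l) hn _ hc, add_zero,
      hw l, map_add, map_add]
  rw [map_sum, map_sum, ← Finset.sum_congr rfl fun l _ => h2 l, ← map_sum]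
  exact congrArg _ h1

end Partition

end Local

end TwistedComplex

/-! ### Homotopies and quasi-isomorphisms in terms of elements. -/

section Elements

variable {R : Type u} [Ring R] {A B : CochainComplex (ModuleCat.{u} R) ℤ}

theorem homotopy_apply {f g : A ⟶ B} (H : Homotopy f g) {m n n' : ℤ} (hm : m + 1 = n)
    (hn : n + 1 = n') (x : A.X n) :
    (f.f n).hom x = (H.hom n' n).hom ((A.d n n').hom x) + (B.d m n).hom ((H.hom n m).hom x) +
      (g.f n).hom x := by
  have h := congrArg (fun k => k.hom x) (H.comm n)
  rw [dNext_eq H.hom (show (ComplexShape.up ℤ).Rel n n' from hn),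
    prevD_eq H.hom (show (ComplexShape.up ℤ).Rel m n from hm)] at h
  exact h

/-- A criterion for quasi-isomorphisms in terms of elements. -/
theorem quasiIso_of_elements (q : A ⟶ B)
    (hinj : ∀ (m n n' : ℤ), m + 1 = n → n + 1 = n' → ∀ (a : A.X n) (b : B.X m),
      (A.d n n').hom a = 0 → (B.d m n).hom b = (q.f n).hom a → ∃ a', (A.d m n).hom a' = a)
    (hsurj : ∀ (m n n' : ℤ), m + 1 = n → n + 1 = n' → ∀ b : B.X n, (B.d n n').hom b = 0 →
      ∃ (a : A.X n) (b' : B.X m), (A.d n n').hom a = 0 ∧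
        (q.f n).hom a = b + (B.d m n).hom b') : QuasiIso q := by
  refine ⟨fun n => ?_⟩
  rw [quasiIsoAt_iff_isIso_homologyMap, ConcreteCategory.isIso_iff_bijective]
  have hπ : ∀ (C : CochainComplex (ModuleCat.{u} R) ℤ) (z : C.cycles n),
      (C.homologyπ n).hom z = 0 → ∃ y, (C.d (n - 1) n).hom y = (C.iCycles n).hom z := by
    intro C z hz
    have hex := ShortComplex.exact_of_g_is_cokernel
      (ShortComplex.mk _ _ (C.toCycles_comp_homologyπ (n - 1) n))
      (C.homologyIsCokernel (n - 1) n (by simp))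
    rw [ShortComplex.moduleCat_exact_iff] at hex
    obtain ⟨y, hy⟩ := hex z hz
    refine ⟨y, ?_⟩
    rw [← C.toCycles_i (n - 1) n]
    exact congrArg (C.iCycles n).hom hy
  have hc : ∀ (C : CochainComplex (ModuleCat.{u} R) ℤ) (x : C.X n),
      (C.d n (n + 1)).hom x = 0 → ∃ z, (C.iCycles n).hom z = x := by
    intro C x hx
    have hex := ShortComplex.exact_of_f_is_kernel
      (ShortComplex.mk _ _ (C.iCycles_d n (n + 1)))
      (C.cyclesIsKernel n (n + 1) (by simp))
    rw [ShortComplex.moduleCat_exact_iff] at hex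
    exact hex x hx
  have hc' : ∀ (C : CochainComplex (ModuleCat.{u} R) ℤ) (z : C.cycles n),
      (C.d n (n + 1)).hom ((C.iCycles n).hom z) = 0 := fun C z =>
    congrArg (fun g => g.hom z) (C.iCycles_d n (n + 1))
  have hinjC : ∀ C : CochainComplex (ModuleCat.{u} R) ℤ,
      Function.Injective (C.iCycles n).hom := fun C =>
    (ModuleCat.mono_iff_injective _).1 inferInstance
  have hsurjC : ∀ C : CochainComplex (ModuleCat.{u} R) ℤ,
      Function.Surjective (C.homologyπ n).hom := fun C =>
    (ModuleCat.epi_iff_surjective _).1 inferInstance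
  have hb : ∀ (C : CochainComplex (ModuleCat.{u} R) ℤ) (z : C.cycles n) (y : C.X (n - 1)),
      (C.d (n - 1) n).hom y = (C.iCycles n).hom z → (C.homologyπ n).hom z = 0 := by
    intro C z y hy
    have h1 : (C.toCycles (n - 1) n).hom y = z := by
      refine hinjC C ?_
      rw [← hy, ← C.toCycles_i (n - 1) n]
      rfl
    rw [← h1]
    exact congrArg (fun g => g.hom y) (C.toCycles_comp_homologyπ (n - 1) n)
  have hnat : ∀ z, (HomologicalComplex.homologyMap q n).hom ((A.homologyπ n).hom z) =
      (B.homologyπ n).hom ((HomologicalComplex.cyclesMap q n).hom z) := fun z =>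
    congrArg (fun g => g.hom z) (HomologicalComplex.homologyπ_naturality q n)
  have hcyc : ∀ z, (B.iCycles n).hom ((HomologicalComplex.cyclesMap q n).hom z) =
      (q.f n).hom ((A.iCycles n).hom z) := fun z =>
    congrArg (fun g => g.hom z) (HomologicalComplex.cyclesMap_i q n)
  constructor
  · refine (injective_iff_map_eq_zero (HomologicalComplex.homologyMap q n).hom).2 fun h hh => ?_
    obtain ⟨z, rfl⟩ := hsurjC A h
    rw [hnat] at hh
    obtain ⟨b, hb'⟩ := hπ B _ hh
    rw [hcyc] at hb'
    obtain ⟨a', ha'⟩ := hinj (n - 1) n (n + 1) (by omega) rfl _ b (hc' A z) hb'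
    exact hb A z a' ha'
  · intro h
    obtain ⟨z, rfl⟩ := hsurjC B h
    obtain ⟨a, b', ha, hab⟩ := hsurj (n - 1) n (n + 1) (by omega) rfl _ (hc' B z)
    obtain ⟨za, rfl⟩ := hc A a ha
    refine ⟨(A.homologyπ n).hom za, ?_⟩
    refine (hnat za).trans ?_
    rw [← sub_eq_zero, ← map_sub]
    refine hb B _ b' ?_
    rw [map_sub, hcyc, hab, add_sub_cancel_left]

end Elements

/-! ### Surjectivity of evaluation on cohomology. -/

namespace TwistedComplex

variable {X : TopCat.{u}} {𝒜 : TopCat.Sheaf RingCat.{u} X}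
  {ι : Type u} {U : ι → Opens X} {F : TwistedComplex 𝒜 U}

/-- The homotopy inverse of a component `a_{kk}`, in terms of linear maps. -/
theorem exists_inverse_a_one {k : ι} (τ : Chain k k 1) :
    ∃ (g : ∀ n, Restr 𝒜 (τ.inter_le_first U) ((F.obj k).X n) →ₗ[ringOn 𝒜 (τ.inter U)]
        Restr 𝒜 (τ.inter_le_first U) ((F.obj k).X n))
      (H : ∀ n m, Restr 𝒜 (τ.inter_le_first U) ((F.obj k).X n) →ₗ[ringOn 𝒜 (τ.inter U)]
        Restr 𝒜 (τ.inter_le_first U) ((F.obj k).X m)),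
      (∀ n n' x, dOn F (τ.inter_le_first U) n n' (g n x) =
        g n' (dOn F (τ.inter_le_first U) n n' x)) ∧
      ∀ m n n', m + 1 = n → n + 1 = n' → ∀ x, F.a 1 k k τ n n rfl (g n x) =
        H n' n (dOn F (τ.inter_le_first U) n n' x) +
          dOn F (τ.inter_le_first U) m n (H n m x) + x := by
  obtain ⟨g, hg⟩ := F.a_one k τ
  refine ⟨fun n => (g.inv.f n).hom, fun n m => (g.homotopyInvHomId.hom n m).hom,
    fun n n' x => congrArg (fun f => f.hom x) (g.inv.comm n n'), fun m n n' hm hn x => ?_⟩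
  rw [← hg n]
  exact homotopy_apply g.homotopyInvHomId hm hn x

/-- With g a homotopy inverse of a_{kk} and H the homotopy, x₀ = g x and w = H x: the remaining term
of the homotopy is H d x = 0. The intersections of the tuples (k) and (k, k) are equal but written
differently, whence the restrictions in both directions. -/
theorem exists_preimage_a_one {k : ι} {m n n' : ℤ} (hm : m + 1 = n) (hn : n + 1 = n')
    (x : F.Pt k n) (hx : F.dPt k n n' x = 0) :
    ∃ (x₀ : F.Pt k n) (w : F.Pt k m), F.dPt k n n' x₀ = 0 ∧
      F.a 1 k k ((Chain.point k).snoc k) n n rfl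
        (shrink 𝒜 ((Chain.point k).inter_snoc_le U k) _ _ x₀) =
      shrink 𝒜 ((Chain.point k).inter_snoc_le U k) _ _ (x + F.dPt k m n w) := by
  let τ : Chain k k 1 := (Chain.point k).snoc k
  have h1 : τ.inter U ≤ (Chain.point k).inter U := (Chain.point k).inter_snoc_le U k
  have h2 : (Chain.point k).inter U ≤ τ.inter U :=
    (le_inf le_rfl (Chain.inter_le_first U _)).trans (Chain.inter_inf_le_snoc U _ k)
  obtain ⟨g, H, hg, hH⟩ := exists_inverse_a_one (F := F) τ
  let x₁ : Restr 𝒜 (τ.inter_le_first U) ((F.obj k).X n) := shrink 𝒜 h1 _ _ x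
  have hx₁ : dOn F (τ.inter_le_first U) n n' x₁ = 0 := by
    rw [← shrink_map, hx, map_zero]
  refine ⟨shrink 𝒜 h2 _ _ (g n x₁), shrink 𝒜 h2 _ _ (H n m x₁), ?_, ?_⟩
  · rw [← shrink_map, hg, hx₁, map_zero, map_zero]
  · have e1 : shrink 𝒜 h1 ((Chain.point k).inter_le_first U) (τ.inter_le_first U)
        (shrink 𝒜 h2 _ _ (g n x₁)) = g n x₁ := by
      rw [shrink_shrink 𝒜 h2 h1 le_rfl, shrink_self]
    have e2 : shrink 𝒜 h1 ((Chain.point k).inter_le_first U) (τ.inter_le_first U)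
        (x + F.dPt k m n (shrink 𝒜 h2 _ _ (H n m x₁))) =
        x₁ + dOn F (τ.inter_le_first U) m n (H n m x₁) := by
      rw [map_add, shrink_map, shrink_shrink 𝒜 h2 h1 le_rfl, shrink_self]
    refine (congrArg (F.a 1 k k τ n n rfl) e1).trans (Eq.trans ?_ e2.symm)
    rw [hH m n n' hm hn, hx₁, map_zero, zero_add, add_comm]

variable [T2Space X] [ParacompactSpace X] [Fintype ι] {ρ : ι → GlobalRing 𝒜}

/-- The class is c = ∑ S_l(y_l), where y_l extends a_{lk} x₀ from U_l ∩ U_k to U_l. It is closed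
over U_k because d y_l = a_{lk} d x₀ = 0 on U_l ∩ U_k. Its component at k is ∑ ρ_l a_{kl} a_{lk} x₀,
and the Maurer-Cartan equation replaces a_{kl} a_{lk} x₀ by a_{kk} x₀ up to a boundary. -/
theorem toPt_surjective (h𝒜 : IsSoft 𝒜) (hρ : ∀ l, SupportedIn (ρ l) (U l)) (hρ1 : ∑ l, ρ l = 1)
    {k : ι} {m n n' : ℤ} (hm : m + 1 = n) (hn : n + 1 = n') (x : F.Pt k n)
    (hx : F.dPt k n n' x = 0) :
    ∃ (c : F.SMod n) (w : F.Pt k m), F.toPt k n' (F.sDiff hn c) = 0 ∧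
      c.pt k = x + F.dPt k m n w := by
  obtain ⟨x₀, w, hx₀, hw⟩ := exists_preimage_a_one hm hn x hx
  have hpt : ∀ l, U l ≤ (Chain.point l).inter U := fun l => (Chain.inter_point U l).ge
  have hy : ∀ l, ∃ y : F.Pt l n, shrink 𝒜 ((Chain.point l).inter_snoc_le U k) _
      (Chain.inter_le_first U _) y =
      F.a 1 l k ((Chain.point l).snoc k) n n rfl
        (shrink 𝒜 ((Chain.inter_le_last U _).trans (hpt k)) _ _ x₀) :=
    fun l => h𝒜.shrink_surjective _ _ _ _
  choose y hy using hy
  have hd : ∀ l, F.toPt k n' (F.sDiff hn (sSecHom h𝒜 (hρ l) n (y l))) = 0 := by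
    intro l
    rw [sDiff_sSec]
    refine toPt_sSec h𝒜 (hρ l) _ ?_
    let τ := (Chain.point l).snoc k
    have e1 := aAt_eq (F := F) (σ := τ) (fun x => x) (τ.inter_le_first U) (τ.inter_le_last U)
      (show n + 1 = n + (1 : ℕ) by simp) τ le_rfl fun _ _ => rfl
    rw [shrinkHom_self] at e1
    have e2 := aAt_one_dOn (F := F) (τ.inter_le_first U) (τ.inter_le_last U) (τ.last 1 le_rfl) n n' hn
      (shrink 𝒜 ((Chain.inter_le_last U _).trans (hpt k)) _ _ x₀)
    rw [← shrink_map, hx₀, map_zero, map_zero] at e2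
    rw [shrink_map, hy, e2]
    exact congrArg _ (congrArg (fun g : _ →ₗ[_] _ => g _) e1)
  have hv : ∀ l, ∃ v : F.Pt k m, (sSecHom h𝒜 (hρ l) n (y l)).pt k =
      res 𝒜 (le_top : (Chain.point k).inter U ≤ ⊤) (ρ l) • (x + F.dPt k m n w) -
        F.dPt k m n v := by
    intro l
    let σ := (Chain.point k).snoc l
    let τ := σ.snoc k
    let τ' := (Chain.point l).snoc k
    let κ := (Chain.point k).snoc k
    have hV := τ.inter_le_first U
    have hW := τ.inter_le_last U
    have hY : τ.inter U ≤ U l := (τ.inter_le U 1).trans_eq (by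
      rw [σ.snoc_of_le k le_rfl, σ.last 1 le_rfl])
    have hτσ : τ.inter U ≤ σ.inter U := σ.inter_snoc_le U k
    have hτk : τ.inter U ≤ (Chain.point k).inter U := hW.trans (hpt k)
    have hτl : τ.inter U ≤ (Chain.point l).inter U := hY.trans (hpt l)
    have hττ' : τ.inter U ≤ τ'.inter U :=
      (le_inf hτl hW).trans ((Chain.point l).inter_inf_le_snoc U k)
    have hτκ : τ.inter U ≤ κ.inter U :=
      (le_inf hτk hW).trans ((Chain.point k).inter_inf_le_snoc U k)
    have hO : (Chain.point k).inter U ⊓ U l ≤ τ.inter U :=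
      (le_inf ((Chain.point k).inter_inf_le_snoc U l)
        (inf_le_left.trans (Chain.inter_le_first U _))).trans (σ.inter_inf_le_snoc U k)
    have hv0 : τ.vertex 0 = k := τ.first
    have hv1 : τ.vertex 1 = l := by rw [σ.snoc_of_le k le_rfl, σ.last 1 le_rfl]
    have hv2 : τ.vertex 2 = k := τ.last 2 le_rfl
    let x' := shrink 𝒜 hτk (Chain.inter_le_first U _) hW x₀
    have ey : shrink 𝒜 hτl (Chain.inter_le_first U _) hY (y l) =
        aAt τ (fun x => 1 + x) 1 hY hW n n x' := by
      rw [← shrink_shrink 𝒜 ((Chain.point l).inter_snoc_le U k) hττ' hτl _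
        (τ'.inter_le_first U), hy l, ← shrinkHom_shrink 𝒜 hττ' _ hW,
        shrink_shrink 𝒜 _ hττ' hτk, aAt_eq (F := F) (σ := τ) (fun x => 1 + x) hY hW]
      intro x hx
      rcases (by omega : x = 0 ∨ x = 1) with rfl | rfl
      · exact τ'.first.trans hv1.symm
      · exact (τ'.last 1 le_rfl).trans hv2.symm
    have ek : aAt τ (fun x => skip 1 x) 1 hV hW n n x' =
        shrink 𝒜 hτk _ hV (x + F.dPt k m n w) := by
      rw [← shrink_shrink 𝒜 ((Chain.point k).inter_snoc_le U k) hτκ hτk _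
        (κ.inter_le_first U), ← hw, ← shrinkHom_shrink 𝒜 hτκ _ hW,
        shrink_shrink 𝒜 _ hτκ hτk, aAt_eq (F := F) (σ := τ) (fun x => skip 1 x) hV hW]
      intro x hx
      rcases (by omega : x = 0 ∨ x = 1) with rfl | rfl
      · exact κ.first.trans hv0.symm
      · exact (κ.last 1 le_rfl).trans hv2.symm
    have hx' : dOn F hW n n' x' = 0 := by rw [← shrink_map, hx₀, map_zero]
    -- The primitive v is ρ_l a_{klk} x₀, extended by zero from U_l ∩ U_k to U_k; the term a_{klk} d
    -- x₀ drops out because x₀ is closed.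
    refine ⟨extend h𝒜 (hρ l) hO hτk (Chain.inter_le_first U _) hV
      (aAt τ (fun x => x) 2 hV hW n m x'), ?_⟩
    have e1 : (sSecHom h𝒜 (hρ l) n (y l)).pt k =
        extend h𝒜 (hρ l) ((Chain.point k).inter_inf_le_snoc U l)
          ((Chain.point k).inter_snoc_le U l) (Chain.inter_le_first U _) (σ.inter_le_first U)
          (F.a 1 k l σ n n rfl (shrink 𝒜 ((σ.inter_le_last U).trans (hpt l)) _
            (σ.inter_le_last U) (y l))) := by
      refine (sSec_comp h𝒜 (hρ l) _ (hpt l) (y l) (Chain.point k) n (by simp)).trans ?_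
      rw [pow_zero, one_smul]
    have e2 := shrink_extend h𝒜 (hρ l) ((Chain.point k).inter_inf_le_snoc U l)
          ((Chain.point k).inter_snoc_le U l) (Chain.inter_le_first U _) (σ.inter_le_first U)
          hO hτk (Chain.inter_le_first U _) hV le_rfl hτσ
          (F.a 1 k l σ n n rfl (shrink 𝒜 ((σ.inter_le_last U).trans (hpt l)) _
            (σ.inter_le_last U) (y l)))
    rw [shrink_self] at e2
    rw [e1, e2, ← shrinkHom_shrink 𝒜 hτσ _ hY, shrink_shrink 𝒜 _ hτσ hτl, ey,
      aAt_eq (F := F) (σ := τ) (fun x => x) hV hY (show n + 1 = n + (1 : ℕ) by simp) σ hτσ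
        (fun x hx => (σ.snoc_of_le k hx).symm),
      aAt_one_aAt_one hV hY hW hv1 hv2 n m n' hm hn, hx', map_zero, sub_zero, ek, map_sub,
      extend_shrink, map_extend h𝒜 (hρ l) hO hτk _ hV _ hV, shrinkHom_map]
  choose v hv using hv
  refine ⟨∑ l, sSecHom h𝒜 (hρ l) n (y l), w - ∑ l, v l, ?_, ?_⟩
  · rw [map_sum, map_sum]
    exact Finset.sum_eq_zero fun l _ => hd l
  · have h1 : (∑ l, sSecHom h𝒜 (hρ l) n (y l)).pt k =
        ∑ l, (sSecHom h𝒜 (hρ l) n (y l)).pt k :=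
      map_sum (AddMonoidHom.mk' (fun c : F.SMod n => c.pt k) fun _ _ => rfl) _ _
    have h2 : ∑ l, res 𝒜 (le_top : (Chain.point k).inter U ≤ ⊤) (ρ l) = 1 := by
      rw [← map_sum]
      exact (congrArg (res 𝒜 (le_top : (Chain.point k).inter U ≤ ⊤)) hρ1).trans (map_one _)
    -- The corrected cocycle x + dw does not depend on l, so the partition of unity sums its
    -- multiples to x + dw.
    rw [h1, Finset.sum_congr rfl fun l _ => hv l, Finset.sum_sub_distrib, ← Finset.sum_smul, h2,
      one_smul, map_sub, map_sum]
    abel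

end TwistedComplex

namespace TwistedComplex

/-! ### Local comparison and existence of the perfect complex -/

section Comparison

variable {X : TopCat.{u}} {𝒜 : TopCat.Sheaf RingCat.{u} X}
  {ι : Type u} {U : ι → Opens X} (F : TwistedComplex 𝒜 U)

theorem sheafify_d {n n' : ℤ} (hn : n + 1 = n') : (F.sheafify.d n n').hom = F.sDiff hn := by
  change (if h : n + 1 = n' then ModuleCat.ofHom (F.sDiff h) else 0 :
    ModuleCat.of (ringOn 𝒜 (⊤ : Opens X)) (F.SMod n) ⟶ ModuleCat.of _ (F.SMod n')).hom = _
  rw [dif_pos hn]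
  rfl

variable {F}

theorem map_map_unit₂ {V W : Opens X} (hW : V ≤ W) {M N : Type u} [AddCommGroup M]
    [Module (ringOn 𝒜 (⊤ : Opens X)) M] [AddCommGroup N] [Module (ringOn 𝒜 (⊤ : Opens X)) N]
    (f : M →ₗ[ringOn 𝒜 (⊤ : Opens X)] N) (x : M) :
    BaseChange.map (res 𝒜 hW) (BaseChange.map (res 𝒜 (le_top : W ≤ ⊤)) f) (unit₂ 𝒜 hW x) =
      unit₂ 𝒜 hW (f x) := by
  rw [← spreadHom_eq_map, spreadHom_unit₂]

theorem counit_unit₂ {p : ℕ} {i j : ι} (σ : Chain i j p) (m n : ℤ) (h : m + 0 = n + p)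
    (c : F.SMod m) :
    counit F p i j σ m n h (unit₂ 𝒜 (σ.inter_le_last U) c) = c.comp σ n (by omega) := by
  change (1 : ringOn 𝒜 (σ.inter U)) • res 𝒜 (σ.inter_le_last U) 1 • c.comp σ n (by omega) = _
  rw [map_one, one_smul, one_smul]

/-- The restriction of `S(F)` to `U_k`. -/
abbrev sheafifyAt (F : TwistedComplex 𝒜 U) (k : ι) :
    CochainComplex (ModuleCat.{u} (ringOn 𝒜 ((Chain.point k).inter U))) ℤ :=
  ((restr₂ 𝒜 ((Chain.point k).inter_le_last U)).mapHomologicalComplex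
    (ComplexShape.up ℤ)).obj F.sheafify

/-- The restriction of `F_k` to `U_k`. -/
abbrev objAt (F : TwistedComplex 𝒜 U) (k : ι) :
    CochainComplex (ModuleCat.{u} (ringOn 𝒜 ((Chain.point k).inter U))) ℤ :=
  (restrCpx 𝒜 ((Chain.point k).inter_le_first U)).obj (F.obj k)

theorem sheafifyAt_d (k : ι) {n n' : ℤ} (hn : n + 1 = n') (c : F.SMod n) :
    ((F.sheafifyAt k).d n n').hom (F.toPt k n c) = F.toPt k n' (F.sDiff hn c) := by
  rw [← F.sheafify_d hn]
  exact map_map_unit₂ _ (F.sheafify.d n n').hom c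

/-- The morphism from the restriction of `S(F)` to `U_k` to `F_k` that the counit defines. -/
def evAt (F : TwistedComplex 𝒜 U) (k : ι) : F.sheafifyAt k ⟶ F.objAt k where
  f n := ModuleCat.ofHom (counit F 0 k k (Chain.point k) n n (by simp))
  comm' n n' hn := by
    apply ModuleCat.hom_ext
    refine spread_ext 𝒜 _ fun c => ?_
    have hn : n + 1 = n' := hn
    have h1 := congrArg (F.dPt k n n') (counit_unit₂ (F := F) (Chain.point k) n n (by simp) c)
    have h2 := congrArg (counit F 0 k k (Chain.point k) n' n' (by simp)) (sheafifyAt_d k hn c)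
    exact h1.trans ((pt_sDiff hn c k).symm.trans
      ((counit_unit₂ (F := F) (Chain.point k) n' n' (by simp) _).symm.trans h2.symm))

theorem evAt_f (k : ι) (n : ℤ) (c : F.SMod n) :
    ((F.evAt k).f n).hom (F.toPt k n c) = c.pt k :=
  counit_unit₂ (Chain.point k) n n (by simp) c

variable [T2Space X] [ParacompactSpace X] [Finite ι]

/-- Elements of S(F)|_{U_k} all come from global families, so the two criteria on elements are the
injectivity and surjectivity statements for families, with a partition of unity subordinate to the
cover. -/
theorem quasiIso_evAt (h𝒜 : IsSoft 𝒜) (hU : ⨆ i, U i = ⊤) (k : ι) : QuasiIso (F.evAt k) := by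
  cases nonempty_fintype ι
  obtain ⟨ρ, hρ1, hρ⟩ := h𝒜.exists_partition U hU
  have hs : ∀ n, Function.Surjective (F.toPt k n) := fun n =>
    (h𝒜.isRestriction_unit₂ _).surjective
  refine quasiIso_of_elements _ ?_ ?_
  · intro m n n' hm hn a b ha hb
    obtain ⟨c, rfl⟩ := hs n a
    obtain ⟨c', hc'⟩ := toPt_injective h𝒜 hρ hρ1 hm hn c ((sheafifyAt_d k hn c).symm.trans ha) b
      (hb.trans (evAt_f k n c))
    exact ⟨F.toPt k m c', (sheafifyAt_d k hm c').trans hc'.symm⟩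
  · intro m n n' hm hn b hb
    obtain ⟨c, w, hc, hw⟩ := toPt_surjective h𝒜 hρ hρ1 hm hn b hb
    exact ⟨F.toPt k n c, w, (sheafifyAt_d k hn c).trans hc, (evAt_f k n c).trans hw⟩

theorem exists_isPerfectIn_objAt (hF : F.IsPerfect) :
    ∃ N : ℕ, ∀ k, IsPerfectIn (F.objAt k) (-N) N := by
  cases nonempty_fintype ι
  choose N hN using fun k => (hF k).bounded
  -- The sum of the absolute values dominates each of the finitely many bounds.
  refine ⟨∑ k, (N k).natAbs, fun k => ⟨fun n hn => ?_, fun n => BaseChange.finite ((hF k).finite n),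
    fun n => BaseChange.projective ((hF k).projective n)⟩⟩
  have h1 : (N k).natAbs ≤ ∑ k, (N k).natAbs :=
    Finset.single_le_sum (f := fun k => (N k).natAbs) (fun _ _ => Nat.zero_le _)
      (Finset.mem_univ k)
  have h2 : N k < |n| := by
    have h3 : ((N k).natAbs : ℤ) ≤ ((∑ k, (N k).natAbs : ℕ) : ℤ) := by exact_mod_cast h1
    rcases hn with hn | hn
    · rw [abs_of_neg (by omega)]; omega
    · rw [abs_of_pos (by omega)]; omega
  have h3 := hN k n h2
  exact Functor.map_isZero (baseChange (res 𝒜 ((Chain.point k).inter_le_first U)))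
    (ModuleCat.isZero_of_subsingleton ((F.obj k).X n))

/-- Evaluation exhibits F_k as a local model of S(F) over U_k, and the descent of perfect complexes
applies. -/
theorem exists_cohesive (h𝒜 : IsSoft 𝒜) (hU : ⨆ i, U i = ⊤) (hF : F.IsPerfect) :
    ∃ (E : Cpx 𝒜 (⊤ : Opens X)) (φ : E ⟶ F.sheafify), IsCohesive E ∧ QuasiIso φ := by
  obtain ⟨N, hN⟩ := exists_isPerfectIn_objAt hF
  have hG := h𝒜.isDescentFamily (fun k => (Chain.point k).inter U) U
    (fun k => Chain.inter_le_last U _) (by simpa only [Chain.inter_point] using hU)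
  have hG' := fun k => h𝒜.restr₂_preservesHomology ((Chain.point k).inter_le_last U)
  obtain ⟨E, φ, hE, hφ⟩ := exists_perfect_of_local hG F.sheafify F.objAt F.evAt
    (fun k => quasiIso_evAt h𝒜 hU k) N hN
  refine ⟨E, φ, ⟨⟨N, fun n hn => ?_⟩, hE.finite, hE.projective⟩, hφ⟩
  refine ModuleCat.subsingleton_of_isZero (hE.isZero n ?_)
  rcases lt_abs.1 hn with h | h
  · exact Or.inr h
  · exact Or.inl (by omega)

end Comparison

end TwistedComplex

/-! ### The algebra of cochains -/

section Cochains

/-- Functions on proofs of a proposition with values in abelian groups. -/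
instance addCommGroupForallProp (P : Prop) (M : P → Type u) [∀ h, AddCommGroup (M h)] :
    AddCommGroup (∀ h, M h) where
  add f g := fun h => f h + g h
  zero := fun _ => 0
  neg f := fun h => - f h
  sub f g := fun h => f h - g h
  nsmul n f := fun h => n • f h
  zsmul n f := fun h => n • f h
  add_assoc f g k := funext fun h => add_assoc (f h) (g h) (k h)
  zero_add f := funext fun h => zero_add (f h)
  add_zero f := funext fun h => add_zero (f h)
  add_comm f g := funext fun h => add_comm (f h) (g h)
  neg_add_cancel f := funext fun h => neg_add_cancel (f h)
  sub_eq_add_neg f g := funext fun h => sub_eq_add_neg (f h) (g h)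
  nsmul_zero f := funext fun h => zero_nsmul (f h)
  nsmul_succ n f := funext fun h => succ_nsmul (f h) n
  zsmul_zero' f := funext fun h => zero_zsmul (f h)
  zsmul_succ' n f := funext fun h => SubNegMonoid.zsmul_succ' n (f h)
  zsmul_neg' n f := funext fun h => SubNegMonoid.zsmul_neg' n (f h)

variable {X : TopCat.{u}} {𝒜 : TopCat.Sheaf RingCat.{u} X}
  {ι : Type u} {U : ι → Opens X} {E F G H : ∀ i, Cpx 𝒜 (U i)}

/-- The components of Čech degree `p` of the cochains of total degree `d`. -/
abbrev TwHom.Column (E F : ∀ i, Cpx 𝒜 (U i)) (d : ℤ) (p : ℕ) : Type u :=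
  ∀ (i j : ι) (σ : Chain i j p) (m n : ℤ), m + d = n + p →
    (Restr 𝒜 (σ.inter_le_last U) ((E j).X m) →ₗ[ringOn 𝒜 (σ.inter U)]
      Restr 𝒜 (σ.inter_le_first U) ((F i).X n))

instance (d : ℤ) : AddCommGroup (TwHom 𝒜 U E F d) :=
  inferInstanceAs (AddCommGroup (∀ p, TwHom.Column E F d p))

namespace TwHom

variable {d d₁ d₂ d₃ d₁₂ d₂₃ e : ℤ}

theorem ext' {u v : TwHom 𝒜 U E F d} (h : ∀ p i j σ m n hmn, u p i j σ m n hmn = v p i j σ m n hmn) :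
    u = v := by
  funext p i j σ m n hmn
  exact h p i j σ m n hmn

/-- The product of all restrictions of the modules `E_i^m` to `V`. -/
def Total (E : ∀ i, Cpx 𝒜 (U i)) (V : Opens X) : Type u :=
  ∀ (x : {i // V ≤ U i}) (m : ℤ), Restr 𝒜 x.2 ((E x.1).X m)

instance (V : Opens X) : AddCommGroup (Total E V) :=
  inferInstanceAs (AddCommGroup (∀ (x : {i // V ≤ U i}) (m : ℤ), Restr 𝒜 x.2 ((E x.1).X m)))

variable {i j : ι} {K : ℕ}

/-- The restriction to `U_{i₀…i_K}` of the component of `u` at `(i_{f 0}, …, i_{f p})`, with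
values in the restriction of `F_v^n`. -/
def atSubComp (u : TwHom 𝒜 U E F d) (σ : Chain i j K) (f : ℕ → ℕ) (p : ℕ)
    (x : {i // σ.inter U ≤ U i}) (n : ℤ) :
    Restr 𝒜 (σ.inter_le U (f p)) ((E (σ.vertex (f p))).X (n + p - d)) →ₗ[ringOn 𝒜 (σ.inter U)]
      Restr 𝒜 x.2 ((F x.1).X n) :=
  open Classical in
  if h : σ.vertex (f 0) = x.1 then
    shrinkHom 𝒜 (σ.inter_le_sub U f p h rfl) _ (σ.inter_le U (f p)) _ x.2
      (u p x.1 (σ.vertex (f p)) (σ.sub f p h rfl) (n + p - d) n (by omega))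
  else 0

/-- The restriction to `U_{i₀…i_K}` of the component of `u` at `(i_{f 0}, …, i_{f p})`, as a map
between products of modules. -/
def atSub (u : TwHom 𝒜 U E F d) (σ : Chain i j K) (f : ℕ → ℕ) (p : ℕ) :
    Total E (σ.inter U) →ₗ[ℤ] Total F (σ.inter U) :=
  AddMonoidHom.toIntLinearMap
    (AddMonoidHom.mk' (fun (y : Total E (σ.inter U)) => (fun x n =>
      u.atSubComp σ f p x n (y ⟨_, σ.inter_le U (f p)⟩ (n + p - d)) : Total F (σ.inter U)))
    (fun _ _ => funext fun x => funext fun n => map_add (u.atSubComp σ f p x n) _ _))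

theorem atSub_apply_of_ne (u : TwHom 𝒜 U E F d) (σ : Chain i j K) (f : ℕ → ℕ) (p : ℕ)
    (y : Total E (σ.inter U)) (x : {i // σ.inter U ≤ U i}) (n : ℤ) (h : σ.vertex (f 0) ≠ x.1) :
    u.atSub σ f p y x n = 0 := by
  change u.atSubComp σ f p x n _ = 0
  rw [atSubComp, dif_neg h, LinearMap.zero_apply]

theorem atSub_apply (u : TwHom 𝒜 U E F d) (σ : Chain i j K) (f : ℕ → ℕ) {p : ℕ} {v w : ι}
    (hV : σ.inter U ≤ U v) (hW : σ.inter U ≤ U w) {m n : ℤ} (h : m + d = n + p) (τ : Chain v w p)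
    (hτ : σ.inter U ≤ τ.inter U) (H : ∀ x ≤ p, τ.vertex x = σ.vertex (f x))
    (y : Total E (σ.inter U)) :
    u.atSub σ f p y ⟨v, hV⟩ n =
      shrinkHom 𝒜 hτ _ hW _ hV (u p v w τ m n h) (y ⟨w, hW⟩ m) := by
  have hv : σ.vertex (f 0) = v := by rw [← H 0 (Nat.zero_le _), τ.first]
  have hw : w = σ.vertex (f p) := by rw [← H p le_rfl, τ.last p le_rfl]
  obtain rfl : m = n + p - d := by omega
  subst hw
  have hτ' : τ = σ.sub f p hv rfl := by
    ext x
    rcases le_total x p with hx | hx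
    · simp [Chain.sub, min_eq_left hx, H x hx]
    · simp [Chain.sub, min_eq_right hx, τ.last x hx]
  subst hτ'
  change u.atSubComp σ f p ⟨v, hV⟩ n _ = _
  rw [atSubComp, dif_pos hv]

theorem atSub_congr (u : TwHom 𝒜 U E F d) (σ : Chain i j K) {f g : ℕ → ℕ} {p : ℕ}
    (H : ∀ x ≤ p, σ.vertex (f x) = σ.vertex (g x)) : u.atSub σ f p = u.atSub σ g p := by
  refine LinearMap.ext fun y => funext fun x => funext fun n => ?_
  by_cases h : σ.vertex (f 0) = x.1
  · have h' : σ.vertex (g 0) = x.1 := (H 0 (Nat.zero_le _)).symm.trans h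
    rw [atSub_apply u σ f x.2 (σ.inter_le U (f p)) (show n + p - d + d = n + p by omega)
        (σ.sub f p h rfl) (σ.inter_le_sub U f p h rfl)
        (fun z hz => by simp [Chain.sub, min_eq_left hz]),
      atSub_apply u σ g x.2 (σ.inter_le U (f p)) (show n + p - d + d = n + p by omega)
        (σ.sub f p h rfl) (σ.inter_le_sub U f p h rfl)
        (fun z hz => by simp [Chain.sub, min_eq_left hz, H z hz])]
  · rw [atSub_apply_of_ne _ _ _ _ _ _ _ h, atSub_apply_of_ne]
    rwa [← H 0 (Nat.zero_le _)]

/-- The element of the product with a single component. -/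
theorem Total.exists_apply_eq {V : Opens X} (x : {i // V ≤ U i}) (m : ℤ)
    (z : Restr 𝒜 x.2 ((E x.1).X m)) : ∃ y : Total E V, y x m = z := by
  classical
  refine ⟨fun x' m' => if h : x = x' ∧ m = m' then by
    obtain ⟨rfl, rfl⟩ := h
    exact z else 0, ?_⟩
  change dite _ _ _ = z
  rw [dif_pos ⟨rfl, rfl⟩]

/-- This reduces identities of cochains to identities of additive maps between products of modules.
There composition is ordinary composition, and neither the end points of a tuple nor the degrees
occur in the types, so no transports along equalities are needed. -/
theorem ext_atSub {u v : TwHom 𝒜 U E F d}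
    (h : ∀ (p : ℕ) (i j : ι) (σ : Chain i j p), u.atSub σ (fun x => x) p = v.atSub σ (fun x => x) p) :
    u = v := by
  refine ext' fun p i j σ m n hmn => LinearMap.ext fun z => ?_
  obtain ⟨y, rfl⟩ := Total.exists_apply_eq (E := E) ⟨j, σ.inter_le_last U⟩ m z
  have h1 := congrArg (fun g => g y ⟨i, σ.inter_le_first U⟩ n) (h p i j σ)
  simp only at h1
  rw [atSub_apply u σ _ (σ.inter_le_first U) (σ.inter_le_last U) hmn σ le_rfl (fun _ _ => rfl),
    atSub_apply v σ _ (σ.inter_le_first U) (σ.inter_le_last U) hmn σ le_rfl (fun _ _ => rfl),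
    shrinkHom_self, shrinkHom_self] at h1
  exact h1

theorem atSub_add (u v : TwHom 𝒜 U E F d) (σ : Chain i j K) (f : ℕ → ℕ) (p : ℕ) :
    (u + v).atSub σ f p = u.atSub σ f p + v.atSub σ f p := by
  refine LinearMap.ext fun y => funext fun x => funext fun n => ?_
  change _ = u.atSub σ f p y x n + v.atSub σ f p y x n
  by_cases h : σ.vertex (f 0) = x.1
  · have H : ∀ z ≤ p, (σ.sub f p h rfl).vertex z = σ.vertex (f z) :=
      fun z hz => by simp [Chain.sub, min_eq_left hz]
    have e := fun w : TwHom 𝒜 U E F d => atSub_apply w σ f x.2 (σ.inter_le U (f p))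
      (show n + p - d + d = n + p by omega)
      (σ.sub f p h rfl) (σ.inter_le_sub U f p h rfl) H y
    refine (e (u + v)).trans (Eq.trans ?_ (congrArg₂ (· + ·) (e u) (e v)).symm)
    rw [← LinearMap.add_apply, ← shrinkHom_add]
    rfl
  · rw [atSub_apply_of_ne _ _ _ _ _ _ _ h, atSub_apply_of_ne _ _ _ _ _ _ _ h,
      atSub_apply_of_ne _ _ _ _ _ _ _ h, add_zero]

/-- The map `atSub` as an additive map. -/
def atSubHom (σ : Chain i j K) (f : ℕ → ℕ) (p : ℕ) :
    TwHom 𝒜 U E F d →+ (Total E (σ.inter U) →ₗ[ℤ] Total F (σ.inter U)) :=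
  AddMonoidHom.mk' (fun u => u.atSub σ f p) fun u v => atSub_add u v σ f p

theorem atSub_delta (u : TwHom 𝒜 U E F d) (h : d + 1 = e) (σ : Chain i j K) (f : ℕ → ℕ) (p : ℕ) :
    (u.delta h).atSub σ f p = ∑ s ∈ Finset.range (p - 1), (-1 : ℤ) ^ (s + 1) •
      u.atSub σ (fun x => f (skip (s + 1) x)) (p - 1) := by
  refine LinearMap.ext fun y => funext fun x => funext fun n => ?_
  rw [← Fin.sum_univ_eq_sum_range (fun s => (-1 : ℤ) ^ (s + 1) •
      u.atSub σ (fun x => f (skip (s + 1) x)) (p - 1)), LinearMap.sum_apply]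
  have e0 : ∀ (g : Fin (p - 1) → Total F (σ.inter U)), (∑ s, g s) x n = ∑ s, g s x n := fun g => by
    refine (congrFun (Finset.sum_apply x _ _) n).trans (Finset.sum_apply n _ _)
  rw [e0]
  by_cases hx : σ.vertex (f 0) = x.1
  · have H : ∀ z ≤ p, (σ.sub f p hx rfl).vertex z = σ.vertex (f z) :=
      fun z hz => by simp [Chain.sub, min_eq_left hz]
    rw [atSub_apply (u.delta h) σ f x.2 (σ.inter_le U (f p))
      (show n + p - e + e = n + p by omega)
      (σ.sub f p hx rfl) (σ.inter_le_sub U f p hx rfl) H y, delta]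
    change (shrinkHomAdd 𝒜 _ _ _ _ _ _) _ = _
    rw [map_sum, LinearMap.sum_apply]
    refine Finset.sum_congr rfl fun s _ => ?_
    have hs := s.2
    rw [map_zsmul]
    change (-1 : ℤ) ^ ((s : ℕ) + 1) • shrinkHom 𝒜 _ _ _ _ _ _ _ =
      (-1 : ℤ) ^ ((s : ℕ) + 1) • u.atSub σ (fun x => f (skip (s + 1) x)) (p - 1) y x n
    congr 1
    rw [shrinkHom_shrinkHom 𝒜 _ _ ((σ.inter_le_sub U f p hx rfl).trans
      (Chain.inter_le_innerFace U _ s))]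
    refine (atSub_apply u σ _ x.2 (σ.inter_le U (f p)) _ _ _ (fun z hz => ?_) y).symm
    simp only [Chain.innerFace, Chain.sub]
    rw [min_eq_left hz, min_eq_left]
    unfold skip; split_ifs <;> omega
  · rw [atSub_apply_of_ne _ _ _ _ _ _ _ hx]
    refine (Finset.sum_eq_zero fun s _ => ?_).symm
    change (-1 : ℤ) ^ ((s : ℕ) + 1) • u.atSub σ (fun x => f (skip (s + 1) x)) (p - 1) y x n = 0
    rw [atSub_apply_of_ne, smul_zero]
    rwa [skip_zero]

theorem atSub_comp (u : TwHom 𝒜 U F G d₁) (v : TwHom 𝒜 U E F d₂) (h : d₁ + d₂ = d)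
    (σ : Chain i j K) (f : ℕ → ℕ) (p : ℕ) :
    (u.comp v h).atSub σ f p = ∑ t ∈ Finset.range (p + 1),
      ((d₁ - (t : ℕ)) * ((p - t : ℕ) : ℤ)).negOnePow •
        (u.atSub σ f t ∘ₗ v.atSub σ (fun x => f (t + x)) (p - t)) := by
  refine LinearMap.ext fun y => funext fun x => funext fun n => ?_
  rw [← Fin.sum_univ_eq_sum_range (fun t => ((d₁ - (t : ℕ)) * ((p - t : ℕ) : ℤ)).negOnePow •
        (u.atSub σ f t ∘ₗ v.atSub σ (fun x => f (t + x)) (p - t))), LinearMap.sum_apply]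
  have e0 : ∀ (g : Fin (p + 1) → Total G (σ.inter U)), (∑ s, g s) x n = ∑ s, g s x n := fun g => by
    refine (congrFun (Finset.sum_apply x _ _) n).trans (Finset.sum_apply n _ _)
  rw [e0]
  by_cases hx : σ.vertex (f 0) = x.1
  · have H : ∀ z ≤ p, (σ.sub f p hx rfl).vertex z = σ.vertex (f z) :=
      fun z hz => by simp [Chain.sub, min_eq_left hz]
    rw [atSub_apply (u.comp v h) σ f x.2 (σ.inter_le U (f p))
      (show n + p - d + d = n + p by omega)
      (σ.sub f p hx rfl) (σ.inter_le_sub U f p hx rfl) H y, comp]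
    change (shrinkHomAdd 𝒜 _ _ _ _ _ _) _ = _
    rw [map_sum, LinearMap.sum_apply]
    refine Finset.sum_congr rfl fun t _ => ?_
    have ht : (t : ℕ) ≤ p := by omega
    rw [Units.smul_def, Units.smul_def, map_zsmul]
    change ((((d₁ - (t : ℕ)) * ((p - t : ℕ) : ℤ)).negOnePow : ℤˣ) : ℤ) •
        shrinkHom 𝒜 _ _ _ _ _ _ _ =
      ((((d₁ - (t : ℕ)) * ((p - t : ℕ) : ℤ)).negOnePow : ℤˣ) : ℤ) •
        u.atSub σ f t (v.atSub σ (fun x => f (t + x)) (p - t) y) x n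
    congr 1
    have hW : σ.inter U ≤ U ((σ.sub f p hx rfl).vertex t) := by
      rw [H t ht]; exact σ.inter_le U (f t)
    rw [shrinkHom_comp 𝒜 _ _ (σ.inter_le U (f p)) _ hW _ x.2,
      shrinkHom_shrinkHom 𝒜 _ _ ((σ.inter_le_sub U f p hx rfl).trans (Chain.inter_le_front U _ t)),
      shrinkHom_shrinkHom 𝒜 _ _ ((σ.inter_le_sub U f p hx rfl).trans (Chain.inter_le_back U _ t)),
      LinearMap.comp_apply]
    have hf : ∀ z ≤ (t : ℕ), ((σ.sub f p hx rfl).front t).vertex z = σ.vertex (f z) := by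
      intro z hz
      simp only [Chain.front, Chain.sub]
      rw [min_eq_left hz, min_eq_left (by omega)]
    have hb : ∀ z ≤ p - t, ((σ.sub f p hx rfl).back t).vertex z = σ.vertex (f (t + z)) := by
      intro z hz
      simp only [Chain.back, Chain.sub]
      rw [min_eq_left hz, min_eq_left (by omega)]
    rw [atSub_apply u σ f x.2 hW
        (show n + p - d + d₂ - (p - t : ℕ) + d₁ = n + (t : ℕ) by omega) _
        ((σ.inter_le_sub U f p hx rfl).trans (Chain.inter_le_front U _ t)) hf,
      atSub_apply v σ _ hW (σ.inter_le U (f p))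
        (show n + p - d + d₂ = n + p - d + d₂ - (p - t : ℕ) + (p - t : ℕ) by omega) _
        ((σ.inter_le_sub U f p hx rfl).trans (Chain.inter_le_back U _ t)) hb]
  · rw [atSub_apply_of_ne _ _ _ _ _ _ _ hx]
    refine (Finset.sum_eq_zero fun t _ => ?_).symm
    change ((d₁ - (t : ℕ)) * ((p - t : ℕ) : ℤ)).negOnePow •
        u.atSub σ f t (v.atSub σ (fun x => f (t + x)) (p - t) y) x n = 0
    rw [atSub_apply_of_ne _ _ _ _ _ _ _ hx, smul_zero]

end TwHom

end Cochains

/-! ### Associativity, the Leibniz rule and the differential on morphisms. -/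

section CochainAlgebra

theorem sum_range_triangle {N : Type u} [AddCommGroup N] (p : ℕ) (g : ℕ → ℕ → N) :
    ∑ t ∈ Finset.range (p + 1), ∑ s ∈ Finset.range (t + 1), g s t =
      ∑ s ∈ Finset.range (p + 1), ∑ r ∈ Finset.range (p - s + 1), g s (s + r) := by
  rw [Finset.sum_sigma', Finset.sum_sigma']
  refine Finset.sum_nbij' (fun x => ⟨x.2, x.1 - x.2⟩) (fun x => ⟨x.1 + x.2, x.1⟩) ?_ ?_ ?_ ?_ ?_
  · rintro ⟨s, t⟩ h
    simp only [Finset.mem_range, Finset.mem_sigma] at h ⊢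
    omega
  · rintro ⟨T, s⟩ h
    simp only [Finset.mem_range, Finset.mem_sigma] at h ⊢
    omega
  · rintro ⟨T, t⟩ h
    simp only [Finset.mem_range, Finset.mem_sigma] at h
    simp only [Nat.add_sub_cancel' (show t ≤ T by omega)]
  · rintro ⟨T, s⟩ h
    simp
  · rintro ⟨T, t⟩ h
    simp only [Finset.mem_range, Finset.mem_sigma] at h
    simp only [Nat.add_sub_cancel' (show t ≤ T by omega)]

/-- Here t is the place at which a tuple with the entry s + 1 omitted is split. If s < t, the
omitted entry is interior to the front tuple, which gives M after reindexing with T = t + 1;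
otherwise it is interior to the back tuple, which gives C. The rest is a comparison of signs. -/
theorem leibniz_sum {N : Type u} [AddCommGroup N] (d : ℤ) (p : ℕ) (B C M : ℕ → ℕ → N)
    (hM : ∀ s t, s < t → t < p → B s t = M (t + 1) s)
    (hC : ∀ s t, t ≤ s → s < p → B s t = C t (s - t)) :
    ∑ s ∈ Finset.range (p - 1), (-1 : ℤ) ^ (s + 1) • ∑ t ∈ Finset.range (p - 1 + 1),
        ((d - (t : ℤ)) * ((p - 1 - t : ℕ) : ℤ)).negOnePow • B s t =
      ∑ T ∈ Finset.range (p + 1), ((d + 1 - (T : ℤ)) * ((p - T : ℕ) : ℤ)).negOnePow •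
        ∑ s ∈ Finset.range (T - 1), (-1 : ℤ) ^ (s + 1) • M T s +
      d.negOnePow • ∑ t ∈ Finset.range (p + 1), ((d - (t : ℤ)) * ((p - t : ℕ) : ℤ)).negOnePow •
        ∑ s ∈ Finset.range (p - t - 1), (-1 : ℤ) ^ (s + 1) • C t s := by
  simp only [negOnePow_natCast_smul, Finset.smul_sum, smul_smul, ← Int.negOnePow_add]
  have e1 : ∑ x ∈ Finset.range (p - 1), ∑ y ∈ Finset.range (p - 1 + 1),
      (((x + 1 : ℕ) : ℤ) + (d - (y : ℤ)) * ((p - 1 - y : ℕ) : ℤ)).negOnePow • B x y =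
      ∑ x ∈ Finset.range (p - 1) ×ˢ Finset.range p,
      (((x.1 + 1 : ℕ) : ℤ) + (d - (x.2 : ℤ)) * ((p - 1 - x.2 : ℕ) : ℤ)).negOnePow • B x.1 x.2 := by
    rw [Finset.sum_product]
    rcases Nat.eq_zero_or_pos p with rfl | hp
    · simp
    · rw [Nat.sub_add_cancel hp]
  have e2 : ∑ x ∈ (Finset.range (p - 1) ×ˢ Finset.range p) with x.1 < x.2,
      (((x.1 + 1 : ℕ) : ℤ) + (d - (x.2 : ℤ)) * ((p - 1 - x.2 : ℕ) : ℤ)).negOnePow • B x.1 x.2 =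
      ∑ T ∈ Finset.range (p + 1), ∑ s ∈ Finset.range (T - 1),
        ((d + 1 - (T : ℤ)) * ((p - T : ℕ) : ℤ) + ((s + 1 : ℕ) : ℤ)).negOnePow • M T s := by
    rw [Finset.sum_sigma']
    refine Finset.sum_nbij' (fun x => ⟨x.2 + 1, x.1⟩) (fun x => (x.2, x.1 - 1)) ?_ ?_ ?_ ?_ ?_
    · rintro ⟨s, t⟩ h
      simp only [Finset.mem_filter, Finset.mem_product, Finset.mem_range, Finset.mem_sigma] at h ⊢
      omega
    · rintro ⟨T, s⟩ h
      simp only [Finset.mem_filter, Finset.mem_product, Finset.mem_range, Finset.mem_sigma] at h ⊢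
      omega
    · rintro ⟨s, t⟩ h
      simp
    · rintro ⟨T, s⟩ h
      simp only [Finset.mem_range, Finset.mem_sigma] at h
      simp only [Nat.sub_add_cancel (show 1 ≤ T by omega)]
    · rintro ⟨s, t⟩ h
      simp only [Finset.mem_filter, Finset.mem_product, Finset.mem_range] at h
      rw [hM s t h.2 h.1.2]
      congr 1
      rw [Int.negOnePow_eq_iff]
      obtain ⟨k, rfl⟩ : ∃ k, p = t + 1 + k := ⟨p - (t + 1), by omega⟩
      rw [show t + 1 + k - 1 - t = k by omega, show t + 1 + k - (t + 1) = k by omega]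
      push_cast
      exact ⟨0, by ring⟩
  have e3 : ∑ x ∈ (Finset.range (p - 1) ×ˢ Finset.range p) with ¬ x.1 < x.2,
      (((x.1 + 1 : ℕ) : ℤ) + (d - (x.2 : ℤ)) * ((p - 1 - x.2 : ℕ) : ℤ)).negOnePow • B x.1 x.2 =
      ∑ t ∈ Finset.range (p + 1), ∑ s ∈ Finset.range (p - t - 1),
        (d + ((d - (t : ℤ)) * ((p - t : ℕ) : ℤ) + ((s + 1 : ℕ) : ℤ))).negOnePow • C t s := by
    rw [Finset.sum_sigma']
    refine Finset.sum_nbij' (fun x => ⟨x.2, x.1 - x.2⟩) (fun x => (x.2 + x.1, x.1)) ?_ ?_ ?_ ?_ ?_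
    · rintro ⟨s, t⟩ h
      simp only [Finset.mem_filter, Finset.mem_product, Finset.mem_range, Finset.mem_sigma] at h ⊢
      omega
    · rintro ⟨T, s⟩ h
      simp only [Finset.mem_filter, Finset.mem_product, Finset.mem_range, Finset.mem_sigma] at h ⊢
      omega
    · rintro ⟨s, t⟩ h
      simp only [Finset.mem_filter, Finset.mem_product, Finset.mem_range] at h
      exact Prod.ext (show s - t + t = s by omega) rfl
    · rintro ⟨T, s⟩ h
      simp
    · rintro ⟨s, t⟩ h
      simp only [Finset.mem_filter, Finset.mem_product, Finset.mem_range] at h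
      rw [hC s t (by omega) (by omega)]
      congr 1
      rw [Int.negOnePow_eq_iff]
      obtain ⟨r, rfl⟩ : ∃ r, s = t + r := ⟨s - t, by omega⟩
      obtain ⟨k, rfl⟩ : ∃ k, p = t + 1 + k := ⟨p - (t + 1), by omega⟩
      simp only
      rw [show t + 1 + k - 1 - t = k by omega, show t + 1 + k - t = k + 1 by omega,
        show t + r - t = r by omega]
      push_cast
      exact ⟨t - d, by ring⟩
  rw [e1, ← Finset.sum_filter_add_sum_filter_not _ (fun x => x.1 < x.2), e2, e3]

theorem linearMap_sum_comp {M N P : Type*} [AddCommGroup M] [AddCommGroup N] [AddCommGroup P]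
    {S : Type*} (s : Finset S) (g : S → N →ₗ[ℤ] P) (w : M →ₗ[ℤ] N) :
    (∑ a ∈ s, g a) ∘ₗ w = ∑ a ∈ s, g a ∘ₗ w := by
  ext x
  simp [LinearMap.sum_apply]

theorem linearMap_comp_sum {M N P : Type*} [AddCommGroup M] [AddCommGroup N] [AddCommGroup P]
    {S : Type*} (s : Finset S) (u : N →ₗ[ℤ] P) (g : S → M →ₗ[ℤ] N) :
    u ∘ₗ (∑ a ∈ s, g a) = ∑ a ∈ s, u ∘ₗ g a := by
  ext x
  simp [LinearMap.sum_apply]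

variable {X : TopCat.{u}} {𝒜 : TopCat.Sheaf RingCat.{u} X}
  {ι : Type u} {U : ι → Opens X} {E F G H : ∀ i, Cpx 𝒜 (U i)}

namespace TwHom

variable {d d₁ d₂ d₃ d₁₂ d₂₃ e e₁ e₂ : ℤ}

/-- Both sides are sums over the ways to cut a tuple into three pieces of lengths s, r, k, and the
signs agree because (d₁ + d₂ - s - r) k + (d₁ - s) r = (d₁ - s)(r + k) + (d₂ - r) k. -/
theorem comp_assoc (u : TwHom 𝒜 U G H d₁) (v : TwHom 𝒜 U F G d₂) (w : TwHom 𝒜 U E F d₃)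
    (h₁₂ : d₁ + d₂ = d₁₂) (h₂₃ : d₂ + d₃ = d₂₃) (h : d₁₂ + d₃ = d) (h' : d₁ + d₂₃ = d) :
    (u.comp v h₁₂).comp w h = u.comp (v.comp w h₂₃) h' := by
  refine ext_atSub fun p i j σ => ?_
  simp only [atSub_comp, Units.smul_def]
  simp only [linearMap_sum_comp, linearMap_comp_sum, LinearMap.smul_comp, LinearMap.comp_smul,
    Finset.smul_sum, smul_smul]
  rw [sum_range_triangle p (fun s t =>
    ((((d₁₂ - (t : ℤ)) * ((p - t : ℕ) : ℤ)).negOnePow : ℤˣ) *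
      ((((d₁ - (s : ℤ)) * ((t - s : ℕ) : ℤ)).negOnePow : ℤˣ) : ℤ)) •
      ((u.atSub σ (fun x => x) s ∘ₗ v.atSub σ (fun x => s + x) (t - s)) ∘ₗ
        w.atSub σ (fun x => t + x) (p - t)))]
  refine Finset.sum_congr rfl fun s hs => Finset.sum_congr rfl fun r hr => ?_
  have hs := Finset.mem_range.1 hs
  have hr := Finset.mem_range.1 hr
  obtain ⟨k, rfl⟩ : ∃ k, p = s + r + k := ⟨p - (s + r), by omega⟩
  rw [show s + r - s = r by omega, show s + r + k - (s + r) = k by omega,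
    show s + r + k - s = r + k by omega, show r + k - r = k by omega, LinearMap.comp_assoc,
    atSub_congr w σ (f := fun x => s + r + x) (g := fun x => s + (r + x))
      (fun x _ => congrArg _ (add_assoc s r x)), ← Units.val_mul, ← Units.val_mul,
    ← Int.negOnePow_add, ← Int.negOnePow_add]
  congr 3
  subst h₁₂
  push_cast
  ring

theorem delta_comp (u : TwHom 𝒜 U F G d₁) (v : TwHom 𝒜 U E F d₂) (h : d₁ + d₂ = d)
    (hd : d + 1 = e) (h₁ : d₁ + 1 = e₁) (h₂ : d₂ + 1 = e₂) (he : e₁ + d₂ = e)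
    (he' : d₁ + e₂ = e) :
    (u.comp v h).delta hd = (u.delta h₁).comp v he + d₁.negOnePow • u.comp (v.delta h₂) he' := by
  refine ext_atSub fun p i j σ => ?_
  have hsm : (d₁.negOnePow • u.comp (v.delta h₂) he').atSub σ (fun x => x) p =
      d₁.negOnePow • (u.comp (v.delta h₂) he').atSub σ (fun x => x) p := by
    rw [Units.smul_def, Units.smul_def]
    exact map_zsmul (atSubHom σ (fun x => x) p) _ _
  rw [atSub_add, hsm]
  simp only [atSub_comp, atSub_delta]
  subst h₁
  rw [leibniz_sum d₁ p _
    (fun t s => u.atSub σ (fun x => x) t ∘ₗ v.atSub σ (fun x => t + skip (s + 1) x) (p - t - 1))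
    (fun T s => u.atSub σ (fun x => skip (s + 1) x) (T - 1) ∘ₗ v.atSub σ (fun x => T + x) (p - T))]
  · congr 1
    · refine Finset.sum_congr rfl fun T _ => ?_
      rw [linearMap_sum_comp]
      simp only [LinearMap.smul_comp]
    · congr 1
      refine Finset.sum_congr rfl fun T _ => ?_
      rw [linearMap_comp_sum]
      simp only [LinearMap.comp_smul]
  · intro s t hst ht
    rw [Nat.add_sub_cancel, show p - 1 - t = p - (t + 1) by omega,
      atSub_congr v σ (g := fun x => t + 1 + x)]
    intro x _
    congr 1; unfold skip; split_ifs <;> omega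
  · intro s t hts hs
    rw [show p - 1 - t = p - t - 1 by omega,
      atSub_congr v σ (g := fun x => t + skip (s - t + 1) x),
      atSub_congr u σ (g := fun x => x)]
    · intro x _
      congr 1; unfold skip; split_ifs <;> omega
    · intro x _
      congr 1; unfold skip; split_ifs <;> omega

theorem delta_delta (u : TwHom 𝒜 U E F d) (h : d + 1 = d₁) (h₁ : d₁ + 1 = e) :
    (u.delta h).delta h₁ = 0 := by
  refine ext_atSub fun p i j σ => ?_
  rw [show (0 : TwHom 𝒜 U E F e).atSub σ (fun x => x) p = 0 from map_zero (atSubHom σ _ p)]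
  simp only [atSub_delta]
  exact alternating_sum_eq_zero (p - 1)
    (fun s s' => u.atSub σ (fun x => skip (s + 1) (skip (s' + 1) x)) (p - 1 - 1))
    (fun s s' hss => atSub_congr u σ fun x _ => by rw [TwistedComplex.skip_skip hss])

theorem comp_add (u : TwHom 𝒜 U F G d₁) (v v' : TwHom 𝒜 U E F d₂) (h : d₁ + d₂ = d) :
    u.comp (v + v') h = u.comp v h + u.comp v' h := by
  refine ext_atSub fun p i j σ => ?_
  simp only [atSub_add, atSub_comp, LinearMap.comp_add, smul_add, Finset.sum_add_distrib]

theorem add_comp (u u' : TwHom 𝒜 U F G d₁) (v : TwHom 𝒜 U E F d₂) (h : d₁ + d₂ = d) :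
    (u + u').comp v h = u.comp v h + u'.comp v h := by
  refine ext_atSub fun p i j σ => ?_
  simp only [atSub_add, atSub_comp, LinearMap.add_comp, smul_add, Finset.sum_add_distrib]

theorem delta_add (u u' : TwHom 𝒜 U E F d) (h : d + 1 = e) :
    (u + u').delta h = u.delta h + u'.delta h := by
  refine ext_atSub fun p i j σ => ?_
  simp only [atSub_add, atSub_delta, smul_add, Finset.sum_add_distrib]

/-- Composition with `u` from the left. -/
def compLeft (u : TwHom 𝒜 U F G d₁) (h : d₁ + d₂ = d) : TwHom 𝒜 U E F d₂ →+ TwHom 𝒜 U E G d :=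
  AddMonoidHom.mk' (fun v => u.comp v h) fun v v' => comp_add u v v' h

/-- Composition with `v` from the right. -/
def compRight (v : TwHom 𝒜 U E F d₂) (h : d₁ + d₂ = d) : TwHom 𝒜 U F G d₁ →+ TwHom 𝒜 U E G d :=
  AddMonoidHom.mk' (fun u => u.comp v h) fun u u' => add_comp u u' v h

/-- The Čech differential as an additive map. -/
def deltaHom (h : d + 1 = e) : TwHom 𝒜 U E F d →+ TwHom 𝒜 U E F e :=
  AddMonoidHom.mk' (fun u => u.delta h) fun u u' => delta_add u u' h

theorem comp_smul (ε : ℤˣ) (u : TwHom 𝒜 U F G d₁) (v : TwHom 𝒜 U E F d₂) (h : d₁ + d₂ = d) :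
    u.comp (ε • v) h = ε • u.comp v h := by
  rw [Units.smul_def, Units.smul_def]
  exact map_zsmul (compLeft u h) _ v

theorem smul_comp (ε : ℤˣ) (u : TwHom 𝒜 U F G d₁) (v : TwHom 𝒜 U E F d₂) (h : d₁ + d₂ = d) :
    (ε • u).comp v h = ε • u.comp v h := by
  rw [Units.smul_def, Units.smul_def]
  exact map_zsmul (compRight v h) _ u

theorem delta_smul (ε : ℤˣ) (u : TwHom 𝒜 U E F d) (h : d + 1 = e) :
    (ε • u).delta h = ε • u.delta h := by
  rw [Units.smul_def, Units.smul_def]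
  exact map_zsmul (deltaHom h) _ u

theorem comp_sub (u : TwHom 𝒜 U F G d₁) (v v' : TwHom 𝒜 U E F d₂) (h : d₁ + d₂ = d) :
    u.comp (v - v') h = u.comp v h - u.comp v' h := map_sub (compLeft u h) v v'

theorem sub_comp (u u' : TwHom 𝒜 U F G d₁) (v : TwHom 𝒜 U E F d₂) (h : d₁ + d₂ = d) :
    (u - u').comp v h = u.comp v h - u'.comp v h := map_sub (compRight v h) u u'

theorem delta_sub (u u' : TwHom 𝒜 U E F d) (h : d + 1 = e) :
    (u - u').delta h = u.delta h - u'.delta h := map_sub (deltaHom h) u u'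

theorem atSub_id_of_ne {i j : ι} {K : ℕ} (σ : Chain i j K) (f : ℕ → ℕ) {p : ℕ} (hp : p ≠ 0) :
    (id E).atSub σ f p = 0 := by
  refine LinearMap.ext fun y => funext fun x => funext fun n => ?_
  by_cases hx : σ.vertex (f 0) = x.1
  · have e := atSub_apply (id E) σ f x.2 (σ.inter_le U (f p))
      (show n + p - 0 + 0 = n + p by omega)
      (σ.sub f p hx rfl) (σ.inter_le_sub U f p hx rfl)
      (fun z hz => by simp [Chain.sub, min_eq_left hz]) y
    refine e.trans ?_
    rw [id, dif_neg hp]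
    exact congrArg (fun g : _ →ₗ[_] _ => g _)
      (shrinkHomAdd 𝒜 (σ.inter_le_sub U f p hx rfl) _ (σ.inter_le U (f p)) _ x.2).map_zero
  · exact atSub_apply_of_ne _ _ _ _ _ _ _ hx

theorem atSub_id_zero {i j : ι} {K : ℕ} (σ : Chain i j K) (f : ℕ → ℕ)
    (y : Total E (σ.inter U)) (x : {i // σ.inter U ≤ U i}) (n : ℤ) (hx : σ.vertex (f 0) = x.1) :
    (id E).atSub σ f 0 y x n = y x n := by
  have e := atSub_apply (id E) σ f x.2 x.2
      (show n + 0 = n + (0 : ℕ) by omega)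
      (Chain.point x.1) (x.2.trans (Chain.inter_point U x.1).ge)
      (fun z hz => by
        obtain rfl : z = 0 := by omega
        exact hx.symm) y
  refine e.trans ?_
  rw [id, dif_pos rfl]
  change shrinkHom 𝒜 _ _ _ _ _ LinearMap.id _ = _
  have : shrinkHom 𝒜 (x.2.trans (Chain.inter_point U x.1).ge)
      ((Chain.point x.1).inter_le_last U) x.2 ((Chain.point x.1).inter_le_first U) x.2
      (LinearMap.id : Restr 𝒜 _ ((E x.1).X n) →ₗ[_] _) = LinearMap.id :=
    shrinkHom_ext 𝒜 (x.2.trans (Chain.inter_point U x.1).ge)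
      ((Chain.point x.1).inter_le_last U) x.2 x.2 fun z => by
        rw [shrinkHom_shrink, LinearMap.id_apply, LinearMap.id_apply]
  exact congrArg (fun g : _ →ₗ[_] _ => g _) this

theorem id_comp (u : TwHom 𝒜 U E F d) : (id F).comp u (zero_add d) = u := by
  refine ext_atSub fun p i j σ => ?_
  rw [atSub_comp, Finset.sum_eq_single 0]
  · refine LinearMap.ext fun y => funext fun x => funext fun n => ?_
    rw [Nat.cast_zero, sub_zero, zero_mul, Int.negOnePow_zero, one_smul, LinearMap.comp_apply,
      atSub_congr u σ (g := fun x => x) (fun x _ => congrArg _ (zero_add x))]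
    by_cases hx : σ.vertex 0 = x.1
    · exact atSub_id_zero σ _ _ x n hx
    · exact (atSub_apply_of_ne _ _ _ _ _ _ _ hx).trans (atSub_apply_of_ne _ _ _ _ _ _ _ hx).symm
  · intro t _ ht
    rw [atSub_id_of_ne _ _ ht, LinearMap.zero_comp, smul_zero]
  · intro h
    exact absurd (Finset.mem_range.2 (Nat.succ_pos p)) h

theorem comp_id (u : TwHom 𝒜 U E F d) : u.comp (id E) (add_zero d) = u := by
  refine ext_atSub fun p i j σ => ?_
  rw [atSub_comp, Finset.sum_eq_single p]
  · refine LinearMap.ext fun y => funext fun x => funext fun n => ?_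
    rw [Nat.sub_self, Nat.cast_zero, mul_zero, Int.negOnePow_zero, one_smul, LinearMap.comp_apply]
    by_cases hx : σ.vertex 0 = x.1
    · have e := fun y => atSub_apply u σ (fun x => x) x.2 (σ.inter_le U p)
        (show n + p - d + d = n + p by omega)
        (σ.sub (fun x => x) p hx rfl) (σ.inter_le_sub U (fun x => x) p hx rfl)
        (fun z hz => by simp [Chain.sub, min_eq_left hz]) y
      refine (e _).trans ((congrArg _ ?_).trans (e y).symm)
      exact atSub_id_zero σ _ _ _ _ rfl
    · exact (atSub_apply_of_ne _ _ _ _ _ _ _ hx).trans (atSub_apply_of_ne _ _ _ _ _ _ _ hx).symm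
  · intro t ht htp
    have ht := Finset.mem_range.1 ht
    rw [atSub_id_of_ne _ _ (by omega), LinearMap.comp_zero, smul_zero]
  · intro h
    exact absurd (Finset.mem_range.2 (Nat.lt_succ_self p)) h

theorem delta_id (h : 0 + 1 = e) : (id E).delta h = 0 := by
  refine ext_atSub fun p i j σ => ?_
  rw [show (0 : TwHom 𝒜 U E E e).atSub σ (fun x => x) p = 0 from map_zero (atSubHom σ _ p),
    atSub_delta]
  refine Finset.sum_eq_zero fun s hs => ?_
  have hs := Finset.mem_range.1 hs
  rw [atSub_id_of_ne _ _ (by omega), smul_zero]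

end TwHom

namespace TwistedComplex

variable {A B C : TwistedComplex 𝒜 U} {d d₁ d₂ e e₁ e₂ e' : ℤ}

theorem diff_eq (φ : TwHom 𝒜 U A.obj B.obj d) (h : d + 1 = e) :
    diff A B φ h = φ.delta h + B.a.comp φ (by omega) - d.negOnePow • φ.comp A.a h := rfl

theorem delta_a (A : TwistedComplex 𝒜 U) (h : (1 : ℤ) + 1 = e) :
    A.a.delta h = - A.a.comp A.a h := by
  subst h
  rw [eq_neg_iff_add_eq_zero]
  exact TwHom.ext' A.maurer_cartan

theorem diff_add (φ φ' : TwHom 𝒜 U A.obj B.obj d) (h : d + 1 = e) :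
    diff A B (φ + φ') h = diff A B φ h + diff A B φ' h := by
  simp only [diff_eq, TwHom.delta_add, TwHom.comp_add, TwHom.add_comp, smul_add]
  abel

/-- The differential on morphisms as an additive map. -/
def diffHom (A B : TwistedComplex 𝒜 U) (h : d + 1 = e) :
    TwHom 𝒜 U A.obj B.obj d →+ TwHom 𝒜 U A.obj B.obj e :=
  AddMonoidHom.mk' (fun φ => diff A B φ h) fun φ φ' => diff_add φ φ' h

/-- A formal consequence of the Leibniz rule, associativity and the Maurer-Cartan equations of A and
B: δ of a coefficient cochain cancels its square, and the mixed terms b φ a cancel by sign. -/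
theorem diff_diff (φ : TwHom 𝒜 U A.obj B.obj d) (h : d + 1 = e) (h' : e + 1 = e') :
    diff A B (diff A B φ h) h' = 0 := by
  have h1 : (1 : ℤ) + e = e' := by omega
  have hB := TwHom.delta_comp B.a φ (show 1 + d = e by omega) h' (rfl : (1 : ℤ) + 1 = 1 + 1) h
    (by omega) h1
  have hA := TwHom.delta_comp φ A.a h h' h (rfl : (1 : ℤ) + 1 = 1 + 1) h' (by omega)
  rw [delta_a] at hA hB
  have e1 : (1 : ℤ).negOnePow = -1 := rfl
  have e2 : e.negOnePow = - d.negOnePow := by rw [← h, Int.negOnePow_succ]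
  have nc : (- B.a.comp B.a rfl : TwHom 𝒜 U B.obj B.obj (1 + 1)).comp φ
      (show 1 + 1 + d = e' by omega) = - (B.a.comp B.a rfl).comp φ (by omega) :=
    map_neg (TwHom.compRight φ (show 1 + 1 + d = e' by omega)) _
  have cn : φ.comp (- A.a.comp A.a rfl : TwHom 𝒜 U A.obj A.obj (1 + 1))
      (show d + (1 + 1) = e' by omega) =
      - φ.comp (A.a.comp A.a rfl) (by omega) :=
    map_neg (TwHom.compLeft φ (show d + (1 + 1) = e' by omega)) _
  rw [nc, TwHom.comp_assoc B.a B.a φ (rfl : (1 : ℤ) + 1 = 1 + 1) (show 1 + d = e by omega) (by omega) h1] at hB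
  rw [cn, ← TwHom.comp_assoc φ A.a A.a h (rfl : (1 : ℤ) + 1 = 1 + 1) h' (by omega)] at hA
  rw [diff_eq (diff A B φ h), diff_eq φ h]
  simp only [TwHom.delta_add, TwHom.delta_sub, TwHom.delta_smul, TwHom.comp_add, TwHom.comp_sub,
    TwHom.comp_smul, TwHom.add_comp, TwHom.sub_comp, TwHom.smul_comp, TwHom.delta_delta, hA, hB,
    TwHom.comp_assoc B.a φ A.a (show 1 + d = e by omega) h h' h1]
  rw [e1, e2]
  -- After the substitution all signs depend only on the parity of d.
  rcases Int.units_eq_one_or d.negOnePow with hd | hd <;> rw [hd] <;>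
    simp only [one_smul, Units.neg_smul, smul_neg, neg_neg, smul_add, smul_sub] <;> abel

/-- The coefficient of the middle object B enters as u b v from both factors, with opposite signs.
-/
theorem diff_comp (u : TwHom 𝒜 U B.obj C.obj d₁) (v : TwHom 𝒜 U A.obj B.obj d₂)
    (h : d₁ + d₂ = d) (hd : d + 1 = e) (h₁ : d₁ + 1 = e₁) (h₂ : d₂ + 1 = e₂) (he : e₁ + d₂ = e)
    (he' : d₁ + e₂ = e) :
    diff A C (u.comp v h) hd =
      (diff B C u h₁).comp v he + d₁.negOnePow • u.comp (diff A B v h₂) he' := by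
  rw [diff_eq, diff_eq, diff_eq, TwHom.delta_comp u v h hd h₁ h₂ he he', TwHom.sub_comp,
    TwHom.add_comp, TwHom.comp_sub, TwHom.comp_add, TwHom.smul_comp, TwHom.comp_smul,
    TwHom.comp_assoc C.a u v (show 1 + d₁ = e₁ by omega) h he (by omega),
    TwHom.comp_assoc u B.a v h₁ (show 1 + d₂ = e₂ by omega) he he',
    TwHom.comp_assoc u v A.a h h₂ hd he',
    show d.negOnePow = d₁.negOnePow * d₂.negOnePow by rw [← h, Int.negOnePow_add], mul_smul,
    smul_sub, smul_add]
  abel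

theorem diff_id (A : TwistedComplex 𝒜 U) (h : 0 + 1 = e) : diff A A (TwHom.id A.obj) h = 0 := by
  obtain rfl : e = 1 := by omega
  rw [diff_eq, TwHom.delta_id, Int.negOnePow_zero, one_smul]
  have h1 := TwHom.id_comp A.a
  have h2 := TwHom.comp_id A.a
  rw [zero_add, sub_eq_zero]
  exact h2.trans h1.symm

end TwistedComplex

end CochainAlgebra

/-! ### The filtration by the Čech degree -/

section Filtration

/-- Successive approximation: let `D` be an additive map between filtered abelian groups that
respects the filtrations, the source being complete and the target separated. If every element of
`Z` is in the image of `D` up to terms of higher filtration, then `Z` is contained in the image. -/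
theorem exists_of_approximation {A B : Type*} [AddCommGroup A] [AddCommGroup B]
    (FA : ℕ → AddSubgroup A) (FB : ℕ → AddSubgroup B)
    (complete : ∀ y : ℕ → A, (∀ n, y n ∈ FA n) → ∃ z, ∀ n, z - ∑ k ∈ Finset.range n, y k ∈ FA n)
    (exhaustive : ∀ x, x ∈ FB 0) (separated : ∀ x, (∀ n, x ∈ FB n) → x = 0)
    (D : A →+ B) (hD : ∀ n, ∀ y ∈ FA n, D y ∈ FB n) (Z : AddSubgroup B) (hZ : ∀ y, D y ∈ Z)
    (step : ∀ n, ∀ x ∈ Z, x ∈ FB n → ∃ y ∈ FA n, x - D y ∈ FB (n + 1)) (x : B) (hx : x ∈ Z) :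
    ∃ y, D y = x := by
  choose! s hs hs' using step
  -- The residue after n corrections; each correction s n (r n) raises its filtration by one.
  let r : ℕ → B := fun n => Nat.rec x (fun n r => r - D (s n r)) n
  have hr : ∀ n, r (n + 1) = r n - D (s n (r n)) := fun n => rfl
  have h1 : ∀ n, r n ∈ Z ∧ r n ∈ FB n := by
    intro n
    induction n with
    | zero => exact ⟨hx, exhaustive x⟩
    | succ n ih =>
      rw [hr]
      exact ⟨Z.sub_mem ih.1 (hZ _), hs' n _ ih.1 ih.2⟩
  obtain ⟨z, hz⟩ := complete (fun n => s n (r n)) (fun n => hs n _ (h1 n).1 (h1 n).2)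
  have h2 : ∀ n, D (∑ k ∈ Finset.range n, s k (r k)) = x - r n := by
    intro n
    induction n with
    | zero => rw [Finset.sum_range_zero, map_zero]; exact (sub_self x).symm
    | succ n ih =>
      rw [Finset.sum_range_succ, map_add, ih, hr]
      abel
  refine ⟨z, ?_⟩
  rw [← sub_eq_zero]
  refine separated _ fun n => ?_
  -- D z - x is D of the tail of the series minus the residue r n, and both lie in the n-th step of
  -- the filtration.
  have h3 := sub_mem (hD n _ (hz n)) (h1 n).2
  rwa [map_sub, h2, sub_sub, sub_add_cancel] at h3

variable {X : TopCat.{u}} {𝒜 : TopCat.Sheaf RingCat.{u} X}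
  {ι : Type u} {U : ι → Opens X} {E F G : ∀ i, Cpx 𝒜 (U i)}

namespace TwHom

variable {d d₁ d₂ e : ℤ}

/-- The cochains whose components of Čech degree less than `p` vanish. -/
def filtration (E F : ∀ i, Cpx 𝒜 (U i)) (d : ℤ) (p : ℕ) : AddSubgroup (TwHom 𝒜 U E F d) where
  carrier := {u | ∀ q < p, ∀ i j σ m n h, u q i j σ m n h = 0}
  zero_mem' := fun _ _ _ _ _ _ _ _ => rfl
  add_mem' {u v} hu hv := fun q hq i j σ m n h => by
    change u q i j σ m n h + v q i j σ m n h = 0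
    rw [hu q hq, hv q hq, add_zero]
  neg_mem' {u} hu := fun q hq i j σ m n h => by
    change - u q i j σ m n h = 0
    rw [hu q hq, neg_zero]

theorem mem_filtration_zero (u : TwHom 𝒜 U E F d) : u ∈ filtration E F d 0 :=
  fun q hq => absurd hq (Nat.not_lt_zero q)

theorem eq_zero_of_mem_filtration {u : TwHom 𝒜 U E F d} (hu : ∀ n, u ∈ filtration E F d n) :
    u = 0 :=
  ext' fun p => hu (p + 1) p (Nat.lt_succ_self p)

/-- Completeness holds because the component of Čech degree p of the series receives contributions
only from the terms with k ≤ p; the sum is defined degree by degree. -/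
theorem exists_sub_sum_mem_filtration (y : ℕ → TwHom 𝒜 U E F d)
    (hy : ∀ n, y n ∈ filtration E F d n) :
    ∃ z, ∀ n, z - ∑ k ∈ Finset.range n, y k ∈ filtration E F d n := by
  refine ⟨fun p => (∑ k ∈ Finset.range (p + 1), y k) p, fun n q hq i j σ m l h => ?_⟩
  have h1 : ∑ k ∈ Finset.range n, y k - ∑ k ∈ Finset.range (q + 1), y k ∈
      filtration E F d (q + 1) := by
    rw [← Finset.sum_sdiff (Finset.range_mono hq), add_sub_cancel_right]
    refine AddSubgroup.sum_mem _ fun k hk => ?_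
    rw [Finset.mem_sdiff, Finset.mem_range, Finset.mem_range] at hk
    exact fun q' hq' => hy k q' (by omega)
  have h2 := neg_mem h1 q (Nat.lt_succ_self q) i j σ m l h
  rwa [neg_sub] at h2

theorem filtration_smul {p : ℕ} (ε : ℤˣ) {u : TwHom 𝒜 U E F d} (hu : u ∈ filtration E F d p) :
    ε • u ∈ filtration E F d p := by
  rcases Int.units_eq_one_or ε with rfl | rfl
  · rwa [one_smul]
  · rw [Units.neg_smul, one_smul]
    exact neg_mem hu

theorem filtration_comp {a b c : ℕ} {u : TwHom 𝒜 U F G d₁} {v : TwHom 𝒜 U E F d₂}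
    (hu : u ∈ filtration F G d₁ a) (hv : v ∈ filtration E F d₂ b) (h : d₁ + d₂ = d)
    (hc : c = a + b) : u.comp v h ∈ filtration E G d c := by
  intro q hq i j σ m n hmn
  refine Finset.sum_eq_zero fun t _ => ?_
  by_cases ht : (t : ℕ) < a
  · rw [hu t ht]
    have : shrinkHom 𝒜 (σ.inter_le_front U t) ((σ.front t).inter_le_last U) (σ.inter_le U t)
        ((σ.front t).inter_le_first U) (σ.inter_le_first U)
        (0 : Restr 𝒜 _ ((F (σ.vertex t)).X (m + d₂ - (q - t : ℕ))) →ₗ[_] Restr 𝒜 _ ((G i).X n)) = 0 :=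
      (shrinkHomAdd 𝒜 _ _ _ _ _).map_zero
    rw [this, LinearMap.zero_comp, smul_zero]
  · rw [hv (q - t) (by omega)]
    have : shrinkHom 𝒜 (σ.inter_le_back U t) ((σ.back t).inter_le_last U) (σ.inter_le_last U)
        ((σ.back t).inter_le_first U) (σ.inter_le U t)
        (0 : Restr 𝒜 _ ((E j).X m) →ₗ[_] Restr 𝒜 _ ((F (σ.vertex t)).X (m + d₂ - (q - t : ℕ)))) = 0 :=
      (shrinkHomAdd 𝒜 _ _ _ _ _).map_zero
    rw [this, LinearMap.comp_zero, smul_zero]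

theorem filtration_delta {p : ℕ} {u : TwHom 𝒜 U E F d} (hu : u ∈ filtration E F d p)
    (h : d + 1 = e) : u.delta h ∈ filtration E F e p := by
  intro q hq i j σ m n hmn
  refine Finset.sum_eq_zero fun s _ => ?_
  rw [hu (q - 1) (by omega)]
  have : shrinkHom 𝒜 (σ.inter_le_innerFace U s) ((σ.innerFace s).inter_le_last U)
      (σ.inter_le_last U) ((σ.innerFace s).inter_le_first U) (σ.inter_le_first U)
      (0 : Restr 𝒜 _ ((E j).X m) →ₗ[_] Restr 𝒜 _ ((F i).X n)) = 0 :=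
    (shrinkHomAdd 𝒜 _ _ _ _ _).map_zero
  rw [this, smul_zero]

theorem mem_filtration_one {u : TwHom 𝒜 U E F d}
    (h : ∀ i m n hmn, u 0 i i (Chain.point i) m n hmn = 0) : u ∈ filtration E F d 1 := by
  intro q hq i j σ m n hmn
  obtain rfl : q = 0 := by omega
  obtain rfl : i = j := σ.first.symm.trans (σ.last 0 le_rfl)
  obtain rfl := Chain.eq_point σ
  exact h i m n hmn

theorem comp_point (u : TwHom 𝒜 U F G d₁) (v : TwHom 𝒜 U E F d₂) (h : d₁ + d₂ = d) (i : ι)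
    {m k n : ℤ} (hk : m + d₂ = k) (hn : k + d₁ = n) (hmn : m + d = n + (0 : ℕ)) :
    u.comp v h 0 i i (Chain.point i) m n hmn =
      u 0 i i (Chain.point i) k n (by omega) ∘ₗ v 0 i i (Chain.point i) m k (by omega) := by
  obtain rfl : k = m + d₂ - (0 - 0 : ℕ) := by omega
  refine (Fin.sum_univ_one _).trans ?_
  have key : ((d₁ - (0 : ℕ)) * ((0 : ℕ) : ℤ)).negOnePow •
    (shrinkHom 𝒜 le_rfl ((Chain.point i).inter_le_last U) ((Chain.point i).inter_le_last U)
        ((Chain.point i).inter_le_first U) ((Chain.point i).inter_le_first U)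
        (u 0 i i (Chain.point i) (m + d₂ - (0 - 0 : ℕ)) n (by omega)) ∘ₗ
      shrinkHom 𝒜 le_rfl ((Chain.point i).inter_le_last U) ((Chain.point i).inter_le_last U)
        ((Chain.point i).inter_le_first U) ((Chain.point i).inter_le_first U)
        (v 0 i i (Chain.point i) m (m + d₂ - (0 - 0 : ℕ)) (by omega))) =
      u 0 i i (Chain.point i) (m + d₂ - (0 - 0 : ℕ)) n (by omega) ∘ₗ
        v 0 i i (Chain.point i) m (m + d₂ - (0 - 0 : ℕ)) (by omega) := by
    rw [shrinkHom_self, shrinkHom_self,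
      show ((d₁ - (0 : ℕ)) * ((0 : ℕ) : ℤ)).negOnePow = 1 by simp, one_smul]
  exact key

theorem delta_point (u : TwHom 𝒜 U E F d) (h : d + 1 = e) (i : ι) (m n : ℤ)
    (hmn : m + e = n + (0 : ℕ)) : u.delta h 0 i i (Chain.point i) m n hmn = 0 :=
  Finset.sum_eq_zero fun s => absurd s.2 (Nat.not_lt_zero _)

/-- The cochain that is concentrated in Čech degree zero and given by `g` there. -/
def ofPoint (g : ∀ (i : ι) (m n : ℤ), m + d = n →
    (Restr 𝒜 ((Chain.point i).inter_le_last U) ((E i).X m) →ₗ[ringOn 𝒜 ((Chain.point i).inter U)]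
      Restr 𝒜 ((Chain.point i).inter_le_first U) ((F i).X n))) : TwHom 𝒜 U E F d
  | 0, i, j, σ, m, n, h => by
    obtain rfl : i = j := σ.first.symm.trans (σ.last 0 le_rfl)
    obtain rfl := Chain.eq_point σ
    exact g i m n (by omega)
  | _ + 1, _, _, _, _, _, _ => 0

end TwHom

end Filtration

namespace TwistedComplex

/-! ### Homotopy equivalences of twisted complexes are detected in Čech degree zero -/

section Detection

variable {X : TopCat.{u}} {𝒜 : TopCat.Sheaf RingCat.{u} X}
  {ι : Type u} {U : ι → Opens X} {E F G : TwistedComplex 𝒜 U}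

theorem filtration_diff {d e : ℤ} {p : ℕ} {u : TwHom 𝒜 U E.obj F.obj d}
    (hu : u ∈ TwHom.filtration E.obj F.obj d p) (h : d + 1 = e) :
    diff E F u h ∈ TwHom.filtration E.obj F.obj e p := by
  rw [diff_eq]
  exact sub_mem (add_mem (TwHom.filtration_delta hu h)
    (TwHom.filtration_comp (TwHom.mem_filtration_zero F.a) hu _ (Nat.zero_add p).symm))
    (TwHom.filtration_smul _ (TwHom.filtration_comp hu (TwHom.mem_filtration_zero E.a) _ rfl))

theorem diff_comp_closed {d e : ℤ} {θ : TwHom 𝒜 U E.obj F.obj 0}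
    (hθ : diff E F θ (zero_add 1) = 0) (v : TwHom 𝒜 U G.obj E.obj d) (h : d + 1 = e) :
    diff G F (θ.comp v (zero_add d)) h = θ.comp (diff G E v h) (zero_add e) := by
  have h0 : TwHom.comp (0 : TwHom 𝒜 U E.obj F.obj 1) v (show 1 + d = e by omega) = 0 :=
    map_zero (TwHom.compRight v (show 1 + d = e by omega))
  rw [diff_comp θ v (zero_add d) h (zero_add 1) h (by omega) (zero_add e), hθ,
    Int.negOnePow_zero, one_smul, h0, zero_add]

/-- A homotopy inverse of `θ` up to terms of positive Čech degree. -/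
structure ApproxInverse (θ : TwHom 𝒜 U E.obj F.obj 0) where
  /-- The inverse. -/
  inv : TwHom 𝒜 U F.obj E.obj 0
  /-- The homotopy on the target. -/
  s : TwHom 𝒜 U F.obj F.obj (-1)
  /-- The homotopy on the source. -/
  s' : TwHom 𝒜 U E.obj E.obj (-1)
  diff_inv : diff F E inv (zero_add 1) ∈ TwHom.filtration F.obj E.obj 1 1
  diff_s : diff F F s (neg_add_cancel 1) + θ.comp inv (add_zero 0) - TwHom.id F.obj ∈
    TwHom.filtration F.obj F.obj 0 1
  diff_s' : diff E E s' (neg_add_cancel 1) + inv.comp θ (add_zero 0) - TwHom.id E.obj ∈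
    TwHom.filtration E.obj E.obj 0 1

variable {c d e f : ℤ}

/-- The pair (α, β) is a cycle of the cone of composition with θ. With ψ the approximate inverse and
s, s' the homotopies, α₁ = ψ β - s' α satisfies d α₁ = -α up to filtration n + 1. The remaining
defect γ = β - θ α₁ is closed to the same order, so it is accounted for by θ ψ γ and d(s γ), again
up to higher filtration. -/
theorem ApproxInverse.exists_approx_primitive {θ : TwHom 𝒜 U E.obj F.obj 0} (hθ : diff E F θ (zero_add 1) = 0)
    (ψ : ApproxInverse θ) (hc : c + 1 = d) (hd : d + 1 = e) (he : e + 1 = f) {n : ℕ}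
    {α : TwHom 𝒜 U G.obj E.obj e} {β : TwHom 𝒜 U G.obj F.obj d}
    (hα : diff G E α he = 0) (hβ : θ.comp α (zero_add e) + diff G F β hd = 0)
    (hαn : α ∈ TwHom.filtration G.obj E.obj e n) (hβn : β ∈ TwHom.filtration G.obj F.obj d n) :
    ∃ α' ∈ TwHom.filtration G.obj E.obj d n, ∃ β' ∈ TwHom.filtration G.obj F.obj c n,
      α + diff G E α' hd ∈ TwHom.filtration G.obj E.obj e (n + 1) ∧
      β - (θ.comp α' (zero_add d) + diff G F β' hc) ∈ TwHom.filtration G.obj F.obj d (n + 1) := by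
  have m0 : ∀ {A B : TwistedComplex 𝒜 U} {k : ℤ} (u : TwHom 𝒜 U A.obj B.obj k),
    u ∈ TwHom.filtration A.obj B.obj k 0 := fun u => TwHom.mem_filtration_zero u
  set r₀ := diff F E ψ.inv (zero_add 1) with hr₀
  set r := diff F F ψ.s (neg_add_cancel 1) + θ.comp ψ.inv (add_zero 0) - TwHom.id F.obj with hr
  set r' := diff E E ψ.s' (neg_add_cancel 1) + ψ.inv.comp θ (add_zero 0) - TwHom.id E.obj with hr'
  have m₀ : r₀ ∈ _ := ψ.diff_inv
  have m : r ∈ _ := ψ.diff_s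
  have m' : r' ∈ _ := ψ.diff_s'
  have ds : diff F F ψ.s (neg_add_cancel 1) = r - θ.comp ψ.inv (add_zero 0) + TwHom.id F.obj := by
    rw [hr]; abel
  have ds' : diff E E ψ.s' (neg_add_cancel 1) =
      r' - ψ.inv.comp θ (add_zero 0) + TwHom.id E.obj := by
    rw [hr']; abel
  have hβ' : diff G F β hd = - θ.comp α (zero_add e) := (neg_eq_of_add_eq_zero_right hβ).symm
  have dinv : ∀ {k l : ℤ} (v : TwHom 𝒜 U G.obj F.obj k) (h : k + 1 = l),
      diff G E (ψ.inv.comp v (zero_add k)) h =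
        r₀.comp v (by omega) + ψ.inv.comp (diff G F v h) (zero_add l) := by
    intro k l v h
    rw [diff_comp ψ.inv v (zero_add k) h (zero_add 1) h (by omega) (zero_add l),
      Int.negOnePow_zero, one_smul]
  set α₁ := ψ.inv.comp β (zero_add d) - ψ.s'.comp α (show -1 + e = d by omega) with hα₁
  have mα₁ : α₁ ∈ TwHom.filtration G.obj E.obj d n :=
    sub_mem (TwHom.filtration_comp (m0 _) hβn _ (Nat.zero_add n).symm)
      (TwHom.filtration_comp (m0 _) hαn _ (Nat.zero_add n).symm)
  have dα₁ : diff G E α₁ hd =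
      r₀.comp β (by omega) - r'.comp α (zero_add e) - α := by
    have h1 : diff G E α₁ hd = diff G E (ψ.inv.comp β (zero_add d)) hd -
        diff G E (ψ.s'.comp α (show -1 + e = d by omega)) hd := map_sub (diffHom G E hd) _ _
    have h2 : ψ.s'.comp (0 : TwHom 𝒜 U G.obj E.obj f) (show -1 + f = e by omega) = 0 :=
      map_zero (TwHom.compLeft ψ.s' (show -1 + f = e by omega))
    have h3 : ψ.inv.comp (- θ.comp α (zero_add e)) (zero_add e) =
        - ψ.inv.comp (θ.comp α (zero_add e)) (zero_add e) :=
      map_neg (TwHom.compLeft ψ.inv (zero_add e)) _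
    rw [h1, dinv, hβ', h3, diff_comp ψ.s' α (show -1 + e = d by omega) hd (neg_add_cancel 1) he
      (zero_add e) (by omega), hα, h2, smul_zero, add_zero, ds', TwHom.add_comp, TwHom.sub_comp,
      TwHom.id_comp, TwHom.comp_assoc ψ.inv θ α (add_zero 0) (zero_add e) (zero_add e) (zero_add e)]
    abel
  set e₁ := r₀.comp β (show 1 + d = e by omega) - r'.comp α (zero_add e) with he₁
  have me₁ : e₁ ∈ TwHom.filtration G.obj E.obj e (n + 1) :=
    sub_mem (TwHom.filtration_comp m₀ hβn _ (Nat.add_comm n 1))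
      (TwHom.filtration_comp m' hαn _ (Nat.add_comm n 1))
  -- The defect of α₁ in the second component; its differential is -θ e₁, which has filtration n +
  -- 1.
  set γ := β - θ.comp α₁ (zero_add d) with hγ
  have mγ : γ ∈ TwHom.filtration G.obj F.obj d n :=
    sub_mem hβn (TwHom.filtration_comp (m0 _) mα₁ _ (Nat.zero_add n).symm)
  have dγ : diff G F γ hd = - θ.comp e₁ (zero_add e) := by
    have h1 : diff G F γ hd = diff G F β hd - diff G F (θ.comp α₁ (zero_add d)) hd :=
      map_sub (diffHom G F hd) _ _
    rw [h1, diff_comp_closed hθ, dα₁, hβ', TwHom.comp_sub]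
    abel
  have mdγ : diff G F γ hd ∈ TwHom.filtration G.obj F.obj e (n + 1) := by
    rw [dγ]
    exact neg_mem (TwHom.filtration_comp (m0 _) me₁ _ (Nat.zero_add _).symm)
  refine ⟨α₁ + ψ.inv.comp γ (zero_add d),
    add_mem mα₁ (TwHom.filtration_comp (m0 _) mγ _ (Nat.zero_add n).symm),
    ψ.s.comp γ (show -1 + d = c by omega),
    TwHom.filtration_comp (m0 _) mγ _ (Nat.zero_add n).symm, ?_, ?_⟩
  · rw [diff_add, dα₁, dinv]
    have h1 : α + (e₁ - α + (r₀.comp γ (by omega) + ψ.inv.comp (diff G F γ hd) (zero_add e))) =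
        e₁ + (r₀.comp γ (by omega) + ψ.inv.comp (diff G F γ hd) (zero_add e)) := by abel
    rw [h1]
    exact add_mem me₁ (add_mem (TwHom.filtration_comp m₀ mγ _ (Nat.add_comm n 1))
      (TwHom.filtration_comp (m0 _) mdγ _ (Nat.zero_add _).symm))
  · rw [diff_comp ψ.s γ (show -1 + d = c by omega) hc (neg_add_cancel 1) hd (zero_add d)
      (by omega), ds, TwHom.add_comp, TwHom.sub_comp, TwHom.id_comp,
      TwHom.comp_assoc θ ψ.inv γ (add_zero 0) (zero_add d) (zero_add d) (zero_add d),
      TwHom.comp_add]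
    have h1 : ∀ x y z w : TwHom 𝒜 U G.obj F.obj d, γ = β - x →
        β - (x + y + (z - y + γ + w)) = - (z + w) := by
      intro x y z w h
      rw [h]; abel
    rw [h1 _ _ _ _ hγ]
    exact neg_mem (add_mem (TwHom.filtration_comp m mγ _ (Nat.add_comm n 1))
      (TwHom.filtration_smul _ (TwHom.filtration_comp (m0 _) mdγ _ (Nat.zero_add _).symm)))

/-- If `θ` has an approximate inverse, then the cone of the composition with `θ` is acyclic. -/
theorem ApproxInverse.exists_primitive {θ : TwHom 𝒜 U E.obj F.obj 0}
    (hθ : diff E F θ (zero_add 1) = 0) (ψ : ApproxInverse θ) (hc : c + 1 = d) (hd : d + 1 = e)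
    (he : e + 1 = f) (α : TwHom 𝒜 U G.obj E.obj e) (β : TwHom 𝒜 U G.obj F.obj d)
    (hα : diff G E α he = 0) (hβ : θ.comp α (zero_add e) + diff G F β hd = 0) :
    ∃ (α' : TwHom 𝒜 U G.obj E.obj d) (β' : TwHom 𝒜 U G.obj F.obj c),
      diff G E α' hd = - α ∧ θ.comp α' (zero_add d) + diff G F β' hc = β := by
  -- D and D' are consecutive differentials (α, β) ↦ (∓dα, θ α + dβ) of the cone; the sign of the
  -- first entry of D' is omitted, as only its kernel is used.
  let D : TwHom 𝒜 U G.obj E.obj d × TwHom 𝒜 U G.obj F.obj c →+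
      TwHom 𝒜 U G.obj E.obj e × TwHom 𝒜 U G.obj F.obj d :=
    ((-(diffHom G E hd)).comp (AddMonoidHom.fst _ _)).prod
      ((TwHom.compLeft θ (zero_add d)).comp (AddMonoidHom.fst _ _) +
        (diffHom G F hc).comp (AddMonoidHom.snd _ _))
  have D1 : ∀ y, (D y).1 = - diff G E y.1 hd := fun _ => rfl
  have D2 : ∀ y, (D y).2 = θ.comp y.1 (zero_add d) + diff G F y.2 hc := fun _ => rfl
  let D' : TwHom 𝒜 U G.obj E.obj e × TwHom 𝒜 U G.obj F.obj d →+
      TwHom 𝒜 U G.obj E.obj f × TwHom 𝒜 U G.obj F.obj e :=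
    ((diffHom G E he).comp (AddMonoidHom.fst _ _)).prod
      ((TwHom.compLeft θ (zero_add e)).comp (AddMonoidHom.fst _ _) +
        (diffHom G F hd).comp (AddMonoidHom.snd _ _))
  have hD' : ∀ x, x ∈ D'.ker ↔ diff G E x.1 he = 0 ∧
      θ.comp x.1 (zero_add e) + diff G F x.2 hd = 0 := fun x => Prod.ext_iff
  suffices h : ∃ y, D y = (α, β) by
    obtain ⟨y, hy⟩ := h
    exact ⟨y.1, y.2, neg_eq_iff_eq_neg.1 (congrArg Prod.fst hy), congrArg Prod.snd hy⟩
  refine exists_of_approximation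
    (fun n => (TwHom.filtration G.obj E.obj d n).prod (TwHom.filtration G.obj F.obj c n))
    (fun n => (TwHom.filtration G.obj E.obj e n).prod (TwHom.filtration G.obj F.obj d n))
    ?_ ?_ ?_ D ?_ D'.ker ?_ ?_ (α, β) ((hD' _).2 ⟨hα, hβ⟩)
  · intro y hy
    obtain ⟨z, hz⟩ := TwHom.exists_sub_sum_mem_filtration (fun n => (y n).1) fun n => (hy n).1
    obtain ⟨w, hw⟩ := TwHom.exists_sub_sum_mem_filtration (fun n => (y n).2) fun n => (hy n).2
    refine ⟨(z, w), fun n => ⟨?_, ?_⟩⟩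
    · have := hz n
      rwa [← Prod.fst_sum] at this
    · have := hw n
      rwa [← Prod.snd_sum] at this
  · exact fun x => ⟨TwHom.mem_filtration_zero _, TwHom.mem_filtration_zero _⟩
  · exact fun x hx => Prod.ext (TwHom.eq_zero_of_mem_filtration fun n => (hx n).1)
      (TwHom.eq_zero_of_mem_filtration fun n => (hx n).2)
  · rintro n y ⟨h1, h2⟩
    exact ⟨AddSubgroup.neg_mem _ (filtration_diff h1 hd), add_mem (TwHom.filtration_comp
      (TwHom.mem_filtration_zero θ) h1 (zero_add d) (Nat.zero_add n).symm)
      (filtration_diff h2 hc)⟩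
  · intro y
    rw [hD', D1, D2]
    have h1 : diff G E (- diff G E y.1 hd) he = - diff G E (diff G E y.1 hd) he :=
      map_neg (diffHom G E he) _
    have h2 : θ.comp (- diff G E y.1 hd) (zero_add e) = - θ.comp (diff G E y.1 hd) (zero_add e) :=
      map_neg (TwHom.compLeft θ (zero_add e)) _
    rw [h1, h2, diff_diff, neg_zero, diff_add, diff_diff, diff_comp_closed hθ, add_zero, neg_add_cancel]
    exact ⟨rfl, rfl⟩
  · rintro n x hx ⟨h1, h2⟩
    rw [hD'] at hx
    obtain ⟨α', hα', β', hβ', h3, h4⟩ := ψ.exists_approx_primitive hθ hc hd he hx.1 hx.2 h1 h2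
    refine ⟨(α', β'), ⟨hα', hβ'⟩, ?_, h4⟩
    change x.1 - - diff G E α' hd ∈ _
    rwa [sub_neg_eq_add]

/-- Acyclicity of the cone is applied twice: to the cycle (0, id_F), whose primitive is a closed χ
with a homotopy from θ χ to the identity, and to a cycle that expresses χ θ - id as a boundary. -/
theorem ApproxInverse.isHomotopyEquiv {θ : TwHom 𝒜 U E.obj F.obj 0}
    (hθ : diff E F θ (zero_add 1) = 0) (ψ : ApproxInverse θ) : IsHomotopyEquiv E F θ := by
  have z : ∀ {A B C : TwistedComplex 𝒜 U} {k l n : ℤ} (u : TwHom 𝒜 U B.obj C.obj k)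
      (h : k + l = n), u.comp (0 : TwHom 𝒜 U A.obj B.obj l) h = 0 :=
    fun u h => map_zero (TwHom.compLeft u h)
  obtain ⟨χ, β, hχ, hβ⟩ := ψ.exists_primitive hθ (neg_add_cancel 1) (zero_add 1)
    (show (1 : ℤ) + 1 = 2 from rfl) (0 : TwHom 𝒜 U F.obj E.obj 1) (TwHom.id F.obj)
    (map_zero (diffHom F E _)) (by rw [z, zero_add, diff_id])
  rw [neg_zero] at hχ
  have hβ' : diff F F β (neg_add_cancel 1) = TwHom.id F.obj - θ.comp χ (zero_add 0) :=
    eq_sub_of_add_eq' hβ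
  -- The pair (χ θ - id, β θ) is a cycle because dβ = id - θ χ; the first component of its primitive
  -- is the homotopy on E, up to sign.
  obtain ⟨ξ, _, hξ, -⟩ := ψ.exists_primitive hθ (show (-2 : ℤ) + 1 = -1 from rfl)
    (neg_add_cancel 1) (zero_add 1) (χ.comp θ (add_zero 0) - TwHom.id E.obj)
    (β.comp θ (add_zero (-1)))
    (by
      have h1 : diff E E (χ.comp θ (add_zero 0) - TwHom.id E.obj) (zero_add 1) =
          diff E E (χ.comp θ (add_zero 0)) (zero_add 1) - diff E E (TwHom.id E.obj) (zero_add 1) :=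
        map_sub (diffHom E E (zero_add 1)) _ _
      have h2 : TwHom.comp (0 : TwHom 𝒜 U F.obj E.obj 1) θ (add_zero 1) = 0 :=
        map_zero (TwHom.compRight θ (add_zero 1))
      rw [h1, diff_id, sub_zero, diff_comp χ θ (add_zero 0) (zero_add 1) (zero_add 1) (zero_add 1)
        (add_zero 1) (zero_add 1), hχ, hθ, h2, z, smul_zero, add_zero])
    (by
      rw [diff_comp β θ (add_zero (-1)) (neg_add_cancel 1) (neg_add_cancel 1) (zero_add 1)
        (add_zero 0) (neg_add_cancel 1), hθ, z, smul_zero, add_zero, hβ', TwHom.sub_comp,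
        TwHom.id_comp, TwHom.comp_sub, TwHom.comp_assoc θ χ θ (add_zero 0) (add_zero 0)
          (add_zero 0) (add_zero 0), TwHom.comp_id]
      abel)
  refine ⟨fun p i j σ m n h => ?_, χ, fun p i j σ m n h => ?_, ⟨- ξ, fun p i j σ m n h => ?_⟩,
    - β, fun p i j σ m n h => ?_⟩
  · exact congrArg (fun u : TwHom 𝒜 U E.obj F.obj 1 => u p i j σ m n h) hθ
  · exact congrArg (fun u : TwHom 𝒜 U F.obj E.obj 1 => u p i j σ m n h) hχ
  · have h1 : diff E E (-ξ) (neg_add_cancel 1) = - diff E E ξ (neg_add_cancel 1) :=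
      map_neg (diffHom E E (neg_add_cancel 1)) ξ
    rw [hξ, neg_neg] at h1
    exact congrArg (fun u : TwHom 𝒜 U E.obj E.obj 0 => u p i j σ m n h) h1.symm
  · have h1 : diff F F (-β) (neg_add_cancel 1) = - diff F F β (neg_add_cancel 1) :=
      map_neg (diffHom F F (neg_add_cancel 1)) β
    rw [hβ', neg_sub] at h1
    exact congrArg (fun u : TwHom 𝒜 U F.obj F.obj 0 => u p i j σ m n h) h1.symm

end Detection

end TwistedComplex

namespace TwistedComplex

/-! ### Approximate inverses from homotopy inverses in Čech degree zero. -/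

section PointwiseInverse

variable {X : TopCat.{u}} {𝒜 : TopCat.Sheaf RingCat.{u} X}
  {ι : Type u} {U : ι → Opens X} {E F : TwistedComplex 𝒜 U}

theorem diff_point {d e : ℤ} (φ : TwHom 𝒜 U E.obj F.obj d) (h : d + 1 = e) (i : ι)
    {m k k' n : ℤ} (hk : m + d = k) (hn : k + 1 = n) (hk' : m + 1 = k') (hn' : k' + d = n)
    (hmn : m + e = n + (0 : ℕ)) :
    diff E F φ h 0 i i (Chain.point i) m n hmn =
      BaseChange.map (res 𝒜 ((Chain.point i).inter_le_first U)) ((F.obj i).d k n).hom ∘ₗ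
          φ 0 i i (Chain.point i) m k (by omega) -
        d.negOnePow • (φ 0 i i (Chain.point i) k' n (by omega) ∘ₗ
          BaseChange.map (res 𝒜 ((Chain.point i).inter_le_first U)) ((E.obj i).d m k').hom) := by
  have h1 := TwHom.comp_point F.a φ (show 1 + d = e by omega) i hk hn hmn
  have h2 := TwHom.comp_point φ E.a h i hk' hn' hmn
  rw [F.a_zero] at h1
  rw [E.a_zero] at h2
  have h3 := TwHom.delta_point φ h i m n hmn
  rw [diff, h1, h2, h3, zero_add]

/-- In Čech degree zero the differential of a cochain s of degree -1 is ds + sd. A homotopy H from f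
to the identity satisfies f = dH + Hd + id, which is why s is minus H. -/
theorem diff_ofPoint_homotopy (A : TwistedComplex 𝒜 U) {f : ∀ i, A.objAt i ⟶ A.objAt i}
    (H : ∀ i, Homotopy (f i) (𝟙 (A.objAt i))) (w : TwHom 𝒜 U A.obj A.obj 0)
    (hw : ∀ i n, w 0 i i (Chain.point i) n n (by simp) = ((f i).f n).hom) :
    diff A A (TwHom.ofPoint fun i m n _ => - ((H i).hom m n).hom) (neg_add_cancel 1) + w -
      TwHom.id A.obj ∈ TwHom.filtration A.obj A.obj 0 1 :=
  TwHom.mem_filtration_one fun i m n hmn => by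
    obtain rfl : m = n := by omega
    refine LinearMap.ext fun x => ?_
    have h1 := diff_point (E := A) (F := A) (TwHom.ofPoint fun i m n _ =>
      - ((H i).hom m n).hom) (neg_add_cancel 1) i
      (show m + -1 = m - 1 by omega) (sub_add_cancel m 1) rfl (show m + 1 + -1 = m by omega) hmn
    have h2 := homotopy_apply (H i) (sub_add_cancel m 1) rfl x
    have h3 := congrArg (fun k : _ →ₗ[_] _ => k x) (hw i m)
    have h4 := congrArg (fun k : _ →ₗ[_] _ => k x) h1
    have e1 : (-1 : ℤ).negOnePow = -1 := rfl
    rw [e1, Units.neg_smul, one_smul, sub_neg_eq_add] at h4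
    have h5 : ∀ a b c y z : Restr 𝒜 ((Chain.point i).inter_le_first U) ((A.obj i).X m),
        a = - b + - c → y = c + b + z → a + y - z = 0 := by
      rintro a b c y z rfl rfl
      abel
    refine h5 _ _ _ _ _ (h4.trans ?_) (h3.trans h2)
    exact congrArg₂ (· + ·) (map_neg ((A.objAt i).d (m - 1) m).hom _) rfl

/-- Homotopy inverses in Čech degree zero define an approximate inverse. -/
def approxInverseOfPoint (θ : TwHom 𝒜 U E.obj F.obj 0)
    (g : ∀ i, HomotopyEquiv (E.objAt i) (F.objAt i))
    (hg : ∀ i n, ((g i).hom.f n).hom = θ 0 i i (Chain.point i) n n (by simp)) :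
    ApproxInverse θ where
  inv := TwHom.ofPoint fun i m n h => by
    obtain rfl : m = n := by omega
    exact ((g i).inv.f m).hom
  s := TwHom.ofPoint fun i m n _ => - ((g i).homotopyInvHomId.hom m n).hom
  s' := TwHom.ofPoint fun i m n _ => - ((g i).homotopyHomInvId.hom m n).hom
  diff_inv := TwHom.mem_filtration_one fun i m n hmn => by
    obtain rfl : n = m + 1 := by omega
    rw [diff_point _ _ i (add_zero m) rfl rfl (add_zero _), Int.negOnePow_zero, one_smul,
      sub_eq_zero]
    exact congrArg ModuleCat.Hom.hom ((g i).inv.comm m (m + 1))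
  diff_s := diff_ofPoint_homotopy F (fun i => (g i).homotopyInvHomId) _ fun i n => by
    rw [TwHom.comp_point _ _ _ i (add_zero n) (add_zero n), ← hg]
    rfl
  diff_s' := diff_ofPoint_homotopy E (fun i => (g i).homotopyHomInvId) _ fun i n => by
    rw [TwHom.comp_point _ _ _ i (add_zero n) (add_zero n), ← hg]
    rfl

end PointwiseInverse

end TwistedComplex

namespace TwistedComplex

/-! ### The composite of the counit with the image of a morphism to the sheafification -/

section Evaluation

variable {X : TopCat.{u}} {𝒜 : TopCat.Sheaf RingCat.{u} X}
  {ι : Type u} {U : ι → Opens X} {F : TwistedComplex 𝒜 U} {E : Cpx 𝒜 (⊤ : Opens X)}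

/-- The image of an element under `φ`. -/
def image (φ : E ⟶ F.sheafify) {m : ℤ} (x : E.X m) : F.SMod m := (φ.f m).hom x

/-- The component at `(i₀, …, i_p)` of the image of an element under `φ`. -/
def evalComp (φ : E ⟶ F.sheafify) {p : ℕ} {i j : ι} (σ : Chain i j p) (m n : ℤ) (h : n + p = m) :
    E.X m →+ Restr 𝒜 (σ.inter_le_first U) ((F.obj i).X n) :=
  AddMonoidHom.mk' (fun x => (image φ x).comp σ n h) fun x y => by
    rw [image, map_add]
    rfl

/-- The morphism `T(E) → F` that is adjoint to `φ : E → S(F)`. -/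
def eval (φ : E ⟶ F.sheafify) : TwHom 𝒜 U (twist U E).obj F.obj 0 :=
  fun _ _ _ σ m n h => spread 𝒜 (σ.inter_le_last U) (evalComp φ σ m n (by omega)) fun r x => by
    change (image φ (r • x)).comp σ n _ = _
    rw [image, map_smul]
    rfl

theorem eval_unit₂ (φ : E ⟶ F.sheafify) {p : ℕ} {i j : ι} (σ : Chain i j p) (m n : ℤ)
    (h : m + 0 = n + p) (x : E.X m) :
    eval φ p i j σ m n h (unit₂ 𝒜 (σ.inter_le_last U) x) =
      (image φ x).comp σ n (by omega) := by
  change (1 : ringOn 𝒜 (σ.inter U)) • res 𝒜 (σ.inter_le_last U) 1 •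
    (image φ x).comp σ n (by omega) = _
  rw [map_one, one_smul, one_smul]

theorem shrink_unit₂ {V V' W : Opens X} {N : Type u} [AddCommGroup N]
    [Module (ringOn 𝒜 (⊤ : Opens X)) N] (h : V' ≤ V) (hV : V ≤ W) (hV' : V' ≤ W) (x : N) :
    shrink 𝒜 h hV hV' (unit₂ 𝒜 hV x) = unit₂ 𝒜 hV' x := by
  change shrink 𝒜 h hV hV' (BaseChange.tmul (res 𝒜 hV) 1 _) = _
  rw [shrink_tmul, map_one]
  rfl

/-- The family of the images of `ξ_m ∈ E^m` in all restrictions. -/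
def unitTotal (ξ : ∀ m, E.X m) (V : Opens X) : TwHom.Total (twist U E).obj V :=
  fun x m => unit₂ 𝒜 x.2 (ξ m)

variable {i j : ι} {K : ℕ} (σ : Chain i j K) (f : ℕ → ℕ) (ξ : ∀ m, E.X m)

theorem atSub_twist {p : ℕ} (x : {i // σ.inter U ≤ U i}) (hx : σ.vertex (f 0) = x.1) (m n : ℤ)
    (h : m + 1 = n + p) :
    (twist U E).a.atSub σ f p (unitTotal ξ (σ.inter U)) x n =
      unit₂ 𝒜 x.2 (twistCoeff E p m n (ξ m)) := by
  have h1 := TwHom.atSub_apply (twist U E).a σ f x.2 (σ.inter_le U (f p)) h (σ.sub f p hx rfl)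
    (σ.inter_le_sub U f p hx rfl) (fun z hz => by simp [Chain.sub, min_eq_left hz])
    (unitTotal ξ (σ.inter U))
  refine h1.trans ?_
  have h2 := shrinkHom_spreadHom 𝒜 (σ.inter_le_sub U f p hx rfl)
    ((σ.sub f p hx rfl).inter_le_last U) (σ.inter_le U (f p))
    ((σ.sub f p hx rfl).inter_le_first U) x.2 (twistCoeff E p m n)
  exact (congrArg (fun k : _ →ₗ[_] _ => k (unit₂ 𝒜 (σ.inter_le U (f p)) (ξ m))) h2).trans
    (spreadHom_unit₂ 𝒜 _ _ _ _)

theorem cAt_of_ne {n : ℤ} (c : F.SMod n) (p : ℕ) {v : ι} (hV : σ.inter U ≤ U v) {q : ℤ}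
    (h : σ.vertex (f 0) ≠ v) : cAt σ c f p hV q = 0 := by
  rw [cAt, dif_neg fun h' => h h'.1]

theorem atSub_eval (φ : E ⟶ F.sheafify) {p : ℕ} (x : {i // σ.inter U ≤ U i}) (m n : ℤ)
    (h : n + p = m) :
    (eval φ).atSub σ f p (unitTotal ξ (σ.inter U)) x n =
      cAt σ (image φ (ξ m)) f p x.2 n := by
  by_cases hx : σ.vertex (f 0) = x.1
  · have h1 := TwHom.atSub_apply (eval φ) σ f x.2 (σ.inter_le U (f p))
      (show m + 0 = n + p by omega) (σ.sub f p hx rfl)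
      (σ.inter_le_sub U f p hx rfl) (fun z hz => by simp [Chain.sub, min_eq_left hz])
      (unitTotal ξ (σ.inter U))
    refine h1.trans ?_
    have h0 := cAt_eq (image φ (ξ m)) f x.2 hx h (σ.sub f p hx rfl)
      (σ.inter_le_sub U f p hx rfl) (fun z hz => by simp [Chain.sub, min_eq_left hz])
    refine Eq.trans ?_ h0
    have h2 := shrink_unit₂ (𝒜 := 𝒜) (σ.inter_le_sub U f p hx rfl)
      ((σ.sub f p hx rfl).inter_le_last U) (σ.inter_le U (f p)) (ξ m)
    have h3 := shrinkHom_shrink 𝒜 (σ.inter_le_sub U f p hx rfl)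
      ((σ.sub f p hx rfl).inter_le_last U) (σ.inter_le U (f p))
      ((σ.sub f p hx rfl).inter_le_first U) x.2
      (eval φ p x.1 _ (σ.sub f p hx rfl) m n (by omega)) (unit₂ 𝒜 _ (ξ m))
    rw [eval_unit₂] at h3
    exact (congrArg _ h2.symm).trans h3
  · exact (TwHom.atSub_apply_of_ne _ _ _ _ _ _ _ hx).trans (cAt_of_ne σ f _ _ _ hx).symm

theorem atSub_apply_congr {A B : ∀ i, Cpx 𝒜 (U i)} {d : ℤ} (u : TwHom 𝒜 U A B d) (p : ℕ)
    (y y' : TwHom.Total A (σ.inter U)) (x : {i // σ.inter U ≤ U i}) {m n : ℤ} (h : m + d = n + p)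
    (hy : y ⟨σ.vertex (f p), σ.inter_le U (f p)⟩ m = y' ⟨σ.vertex (f p), σ.inter_le U (f p)⟩ m) :
    u.atSub σ f p y x n = u.atSub σ f p y' x n := by
  obtain rfl : m = n + p - d := by omega
  exact congrArg (u.atSubComp σ f p x n) hy

/-- The restrictions of E are generated by the images of global elements, so a cochain out of T(E)
is determined by its values on families ξ of such elements. -/
theorem ext_unitTotal {A : ∀ i, Cpx 𝒜 (U i)} {d : ℤ} {u v : TwHom 𝒜 U (twist U E).obj A d}
    (h : ∀ (p : ℕ) (i j : ι) (σ : Chain i j p) (ξ : ∀ m, E.X m) (n : ℤ),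
      u.atSub σ (fun x => x) p (unitTotal ξ (σ.inter U)) ⟨i, σ.inter_le_first U⟩ n =
        v.atSub σ (fun x => x) p (unitTotal ξ (σ.inter U)) ⟨i, σ.inter_le_first U⟩ n) :
    u = v := by
  classical
  refine TwHom.ext' fun p i j σ m n hmn => spread_ext 𝒜 _ fun z => ?_
  obtain ⟨ξ, rfl⟩ : ∃ ξ : ∀ m, E.X m, ξ m = z := ⟨Function.update 0 m z, Function.update_self ..⟩
  have h1 := h p i j σ ξ n
  rw [TwHom.atSub_apply u σ _ (σ.inter_le_first U) (σ.inter_le_last U) hmn σ le_rfl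
      (fun _ _ => rfl),
    TwHom.atSub_apply v σ _ (σ.inter_le_first U) (σ.inter_le_last U) hmn σ le_rfl
      (fun _ _ => rfl), shrinkHom_self, shrinkHom_self] at h1
  exact h1

theorem atSub_twistMap_of_ne {E' : Cpx 𝒜 (⊤ : Opens X)} (φ : E ⟶ E') {p : ℕ} (hp : p ≠ 0) :
    (twistMap U φ).atSub σ f p = 0 := by
  refine LinearMap.ext fun y => funext fun x => funext fun n => ?_
  by_cases hx : σ.vertex (f 0) = x.1
  · have h1 := TwHom.atSub_apply (twistMap U φ) σ f x.2 (σ.inter_le U (f p))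
      (show n + p + 0 = n + p by omega)
      (σ.sub f p hx rfl) (σ.inter_le_sub U f p hx rfl)
      (fun z hz => by simp [Chain.sub, min_eq_left hz]) y
    refine h1.trans ?_
    have h0 : twistMap U φ p x.1 (σ.vertex (f p)) (σ.sub f p hx rfl) (n + p) n (by omega) = 0 :=
      dif_neg hp
    rw [h0]
    exact congrArg (fun g : _ →ₗ[_] _ => g _)
      (shrinkHomAdd 𝒜 (σ.inter_le_sub U f p hx rfl) _ (σ.inter_le U (f p)) _ x.2).map_zero
  · exact TwHom.atSub_apply_of_ne _ _ _ _ _ _ _ hx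

theorem atSub_twistMap_zero {E' : Cpx 𝒜 (⊤ : Opens X)} (φ : E ⟶ E')
    (x : {i // σ.inter U ≤ U i}) (hx : σ.vertex (f 0) = x.1) (n : ℤ) :
    (twistMap U φ).atSub σ f 0 (unitTotal ξ (σ.inter U)) x n =
      unit₂ 𝒜 x.2 ((φ.f n).hom (ξ n)) := by
  have h1 := TwHom.atSub_apply (twistMap U φ) σ f x.2 (σ.inter_le U (f 0))
    (show n + 0 = n + (0 : ℕ) by omega) (σ.sub f 0 hx rfl)
    (σ.inter_le_sub U f 0 hx rfl) (fun z hz => by simp [Chain.sub, Nat.le_zero.1 hz])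
    (unitTotal ξ (σ.inter U))
  refine h1.trans ?_
  have h2 := shrinkHom_spreadHom 𝒜 (σ.inter_le_sub U f 0 hx rfl)
    ((σ.sub f 0 hx rfl).inter_le_last U) (σ.inter_le U (f 0))
    ((σ.sub f 0 hx rfl).inter_le_first U) x.2 (φ.f n ≫ (E'.XIsoOfEq (rfl : n = n)).hom).hom
  refine (congrArg (fun k : _ →ₗ[_] _ => k (unit₂ 𝒜 (σ.inter_le U (f 0)) (ξ n))) h2).trans
    ((spreadHom_unit₂ 𝒜 _ _ _ _).trans ?_)
  rw [HomologicalComplex.XIsoOfEq_rfl, Iso.refl_hom, Category.comp_id]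

theorem total_sum_apply {A : ∀ i, Cpx 𝒜 (U i)} {V : Opens X} {S : Type*} (s : Finset S)
    (y : S → TwHom.Total A V) (x : {i // V ≤ U i}) (n : ℤ) :
    (∑ a ∈ s, y a) x n = ∑ a ∈ s, y a x n :=
  (congrFun (Finset.sum_apply x _ _) n).trans (Finset.sum_apply n _ _)

/-- T(φ) is concentrated in Čech degree zero, so in the composition only the term with the whole
tuple in the counit survives. -/
theorem counit_comp_twistMap (φ : E ⟶ F.sheafify) :
    (counit F).comp (twistMap U φ) (add_zero 0) = eval φ := by
  refine ext_unitTotal fun p i j σ ξ n => ?_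
  rw [TwHom.atSub_comp, Finset.sum_eq_single p]
  · rw [Nat.sub_self, Nat.cast_zero, mul_zero, Int.negOnePow_zero, one_smul, LinearMap.comp_apply,
      atSub_eval σ _ ξ φ _ (n + p) n rfl]
    refine (atSub_apply_congr σ _ (counit F) p _
      (unitTotal (fun m => (φ.f m).hom (ξ m)) (σ.inter U)) _ (show n + p + 0 = n + p by omega)
      (atSub_twistMap_zero σ _ ξ φ _ rfl _)).trans ?_
    exact atSub_eval σ _ (fun m => (φ.f m).hom (ξ m)) (𝟙 F.sheafify) _ (n + p) n rfl
  · intro t ht htp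
    have ht := Finset.mem_range.1 ht
    rw [atSub_twistMap_of_ne σ _ φ (show p - t ≠ 0 by omega), LinearMap.comp_zero, smul_zero]
  · exact fun h => absurd (Finset.mem_range.2 (Nat.lt_succ_self p)) h

/-- The coefficients of T(E) vanish in Čech degree at least two. The differential of E gives one
term; the identity in Čech degree one gives the component at (i₀, …, i_{p-1}), that is, the face
that omits the last index. -/
theorem atSub_eval_comp_twist (φ : E ⟶ F.sheafify) (p : ℕ) (hV : σ.inter U ≤ U i) (m n : ℤ)
    (h : m + 1 = n + p) :
    ((eval φ).comp (twist U E).a (zero_add 1)).atSub σ (fun x => x) p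
        (unitTotal ξ (σ.inter U)) ⟨i, hV⟩ n =
      cAt σ (image φ ((E.d m (m + 1)).hom (ξ m))) (fun x => x) p hV n +
      if p = 0 then 0 else - (-1 : ℤ) ^ p •
        cAt σ (image φ (ξ m)) (fun x => x) (p - 1) hV n := by
  have hlast : (eval φ).atSub σ (fun x => x) p
      ((twist U E).a.atSub σ (fun x => p + x) 0 (unitTotal ξ (σ.inter U))) ⟨i, hV⟩ n =
      cAt σ (image φ ((E.d m (m + 1)).hom (ξ m))) (fun x => x) p hV n := by
    classical
    have e1 := atSub_eval σ (fun x => x) (Function.update ξ (m + 1) ((E.d m (m + 1)).hom (ξ m))) φ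
      (p := p) ⟨i, hV⟩ (m + 1) n h.symm
    rw [Function.update_self] at e1
    refine Eq.trans (atSub_apply_congr σ _ (eval φ) p _ _ _ (m := m + 1) (by omega) ?_) e1
    refine (atSub_twist σ _ ξ _ rfl m (m + 1) (by simp)).trans ?_
    change _ = unit₂ 𝒜 _ (Function.update ξ (m + 1) ((E.d m (m + 1)).hom (ξ m)) (m + 1))
    rw [Function.update_self, twistCoeff_zero]
  have hprev : ∀ q, p = q + 1 → (eval φ).atSub σ (fun x => x) q
      ((twist U E).a.atSub σ (fun x => q + x) 1 (unitTotal ξ (σ.inter U))) ⟨i, hV⟩ n =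
      cAt σ (image φ (ξ m)) (fun x => x) q hV n := by
    intro q hq
    refine Eq.trans (atSub_apply_congr σ _ (eval φ) q _ (unitTotal ξ (σ.inter U)) _ (m := m)
      (by omega) ?_) (atSub_eval σ (fun x => x) ξ φ (p := q) ⟨i, hV⟩ m n (by omega))
    refine (atSub_twist σ _ ξ _ rfl m m (by simp)).trans ?_
    rw [twistCoeff_one_self]
    rfl
  have hzero : ∀ t q, 2 ≤ q → t + q = p → (eval φ).atSub σ (fun x => x) t
      ((twist U E).a.atSub σ (fun x => t + x) q (unitTotal ξ (σ.inter U))) ⟨i, hV⟩ n = 0 := by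
    intro t q hq htq
    refine Eq.trans (atSub_apply_congr σ _ (eval φ) t _ 0 _ (m := n + t) (by omega) ?_)
      (congrArg (fun y : TwHom.Total F.obj (σ.inter U) => y ⟨i, hV⟩ n) (map_zero _))
    refine (atSub_twist σ _ ξ _ rfl (n + t + q - 1) (n + t) (by omega)).trans ?_
    rw [twistCoeff_of_two_le E hq, LinearMap.zero_apply]
    exact map_zero _
  rw [TwHom.atSub_comp, LinearMap.sum_apply, total_sum_apply, Finset.sum_range_succ, add_comm]
  congr 1
  · rw [Nat.sub_self, Nat.cast_zero, mul_zero, Int.negOnePow_zero, one_smul]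
    exact hlast
  · rcases p with _ | q
    · rfl
    · rw [if_neg (Nat.succ_ne_zero q), Finset.sum_range_succ, Finset.sum_eq_zero, zero_add]
      · rw [Nat.add_sub_cancel_left]
        have e2 : ((0 - (q : ℤ)) * ((1 : ℕ) : ℤ)).negOnePow = ((q : ℤ)).negOnePow := by
          rw [Nat.cast_one, mul_one, zero_sub, Int.negOnePow_neg]
        rw [e2, Units.smul_def, Int.coe_negOnePow_natCast, pow_succ, mul_neg_one, neg_neg]
        exact congrArg ((-1 : ℤ) ^ q • ·) (hprev q rfl)
      · intro t ht
        have ht := Finset.mem_range.1 ht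
        exact (congrArg (((0 - (t : ℤ)) * ((q + 1 - t : ℕ) : ℤ)).negOnePow • ·)
          (hzero t (q + 1 - t) (by omega) (by omega))).trans (smul_zero _)

/-- Evaluated on ξ, this is the identity φ(dξ) = d φ(ξ) at one tuple. The Čech differential on
morphisms omits only inner indices while that of S(F) also omits the last one; the missing face is
supplied by the coefficient a^{1,0} = id of T(E). -/
theorem diff_eval (φ : E ⟶ F.sheafify) : diff (twist U E) F (eval φ) (zero_add 1) = 0 := by
  refine ext_unitTotal fun p i j σ ξ n => ?_
  have hV := σ.inter_le_first U
  obtain ⟨m, h⟩ : ∃ m : ℤ, m + 1 = n + p := ⟨n + p - 1, by omega⟩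
  set c : F.SMod m := image φ (ξ m) with hc
  have hcomm : image φ ((E.d m (m + 1)).hom (ξ m)) = F.sDiff rfl c := by
    rw [← F.sheafify_d rfl]
    exact (congrArg (fun k => k.hom (ξ m)) (φ.comm m (m + 1))).symm
  have h1 := atSub_eval_comp_twist σ ξ φ p hV m n h
  rw [hcomm, cAt_sDiff (rfl : m + 1 = m + 1) c _ _ hV n σ.first h.symm] at h1
  have h2 : ((eval φ).delta (zero_add 1)).atSub σ (fun x => x) p
      (unitTotal ξ (σ.inter U)) ⟨i, hV⟩ n = ∑ s ∈ Finset.range (p - 1), (-1 : ℤ) ^ (s + 1) •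
        cAt σ c (fun x => skip (s + 1) x) (p - 1) hV n := by
    rw [TwHom.atSub_delta, LinearMap.sum_apply, total_sum_apply]
    refine Finset.sum_congr rfl fun s hs => ?_
    have hs := Finset.mem_range.1 hs
    exact congrArg ((-1 : ℤ) ^ (s + 1) • ·) (atSub_eval σ _ ξ φ ⟨i, hV⟩ m n (by omega))
  have h3 : (F.a.comp (eval φ) (add_zero 1)).atSub σ (fun x => x) p
      (unitTotal ξ (σ.inter U)) ⟨i, hV⟩ n = ∑ t ∈ Finset.range (p + 1),
        ((1 - (t : ℕ)) * ((p - t : ℕ) : ℤ)).negOnePow •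
        aAt σ (fun x => x) t hV (σ.inter_le U t) (n + t - 1) n
          (cAt σ c (fun x => t + x) (p - t) (σ.inter_le U t) (n + t - 1)) := by
    rw [TwHom.atSub_comp, LinearMap.sum_apply, total_sum_apply]
    refine Finset.sum_congr rfl fun t ht => ?_
    have ht := Finset.mem_range.1 ht
    refine congrArg (fun z : Restr 𝒜 hV ((F.obj i).X n) =>
      ((1 - (t : ℕ)) * ((p - t : ℕ) : ℤ)).negOnePow • z) ?_
    have e1 := TwHom.atSub_apply F.a σ (fun x => x) hV (σ.inter_le U t)
      (show n + t - 1 + 1 = n + t by omega) (σ.front t) (σ.inter_le_front U t)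
      (fun z hz => by simp [Chain.front, Chain.sub, min_eq_left hz])
      ((eval φ).atSub σ (fun x => t + x) (p - t) (unitTotal ξ (σ.inter U)))
    rw [aAt_eq (fun x => x) hV (σ.inter_le U t) _ (σ.front t) (σ.inter_le_front U t)
      (fun z hz => by simp [Chain.front, Chain.sub, min_eq_left hz])] at e1
    exact e1.trans (congrArg _ (atSub_eval σ _ ξ φ ⟨σ.vertex t, _⟩ m (n + t - 1) (by omega)))
  have h4 : ∀ u v w : TwHom 𝒜 U (twist U E).obj F.obj 1,
      (u + v - w).atSub σ (fun x => x) p (unitTotal ξ (σ.inter U)) ⟨i, hV⟩ n =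
      u.atSub σ (fun x => x) p (unitTotal ξ (σ.inter U)) ⟨i, hV⟩ n +
      v.atSub σ (fun x => x) p (unitTotal ξ (σ.inter U)) ⟨i, hV⟩ n -
      w.atSub σ (fun x => x) p (unitTotal ξ (σ.inter U)) ⟨i, hV⟩ n := by
    intro u v w
    have := map_sub (TwHom.atSubHom σ (fun x => x) p) (u + v) w
    rw [map_add] at this
    exact congrArg (fun k => k (unitTotal ξ (σ.inter U)) ⟨i, hV⟩ n) this
  have h5 : (0 : TwHom 𝒜 U (twist U E).obj F.obj 1).atSub σ (fun x => x) p
      (unitTotal ξ (σ.inter U)) ⟨i, hV⟩ n = 0 :=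
    congrArg (fun k => k (unitTotal ξ (σ.inter U)) ⟨i, hV⟩ n)
      (map_zero (TwHom.atSubHom (E := (twist U E).obj) (F := F.obj) (d := 1) σ (fun x => x) p))
  rw [h5, diff_eq, Int.negOnePow_zero, one_smul, h4, h1, h2, h3]
  rcases p with _ | q
  · simp
  -- The last summand of the Čech differential of S(F) is the face without the final index, which
  -- cancels the term from the identity coefficient.
  · have h6 : cAt σ c (fun x => skip (q + 1) x) q hV n = cAt σ c (fun x => x) q hV n :=
      cAt_congr c hV fun x hx => by rw [skip, if_pos (by omega)]
    rw [if_neg (Nat.succ_ne_zero q), Nat.add_sub_cancel, Finset.sum_range_succ _ q, h6, neg_smul]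
    abel

end Evaluation

end TwistedComplex

namespace TwistedComplex

/-! ### The comparison is a homotopy equivalence -/

section Conclusion

variable {X : TopCat.{u}} {𝒜 : TopCat.Sheaf RingCat.{u} X}
  {ι : Type u} {U : ι → Opens X} {F : TwistedComplex 𝒜 U} {E : Cpx 𝒜 (⊤ : Opens X)}

theorem isPerfect_twist (hE : IsCohesive E) : (twist U E).IsPerfect := by
  intro i
  obtain ⟨N, hN⟩ := hE.bounded
  refine ⟨⟨N, fun n hn => ?_⟩, fun n => BaseChange.finite (hE.finite n),
    fun n => BaseChange.projective (hE.projective n)⟩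
  have := hN n hn
  exact ModuleCat.subsingleton_of_isZero (Functor.map_isZero (baseChange (res 𝒜 (le_top : U i ≤ ⊤)))
    (ModuleCat.isZero_of_subsingleton (E.X n)))

/-- The component of Čech degree zero of the morphism adjoint to `φ`. -/
def evalAt (φ : E ⟶ F.sheafify) (k : ι) : (twist U E).objAt k ⟶ F.objAt k :=
  ((restr₂ 𝒜 ((Chain.point k).inter_le_last U)).mapHomologicalComplex
    (ComplexShape.up ℤ)).map φ ≫ F.evAt k

theorem evalAt_f (φ : E ⟶ F.sheafify) (k : ι) (n : ℤ) :
    ((evalAt φ k).f n).hom = eval φ 0 k k (Chain.point k) n n (by simp) := by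
  refine spread_ext 𝒜 _ fun x => ?_
  refine Eq.trans ?_ (eval_unit₂ φ (Chain.point k) n n (by simp) x).symm
  exact (congrArg ((F.evAt k).f n).hom (map_map_unit₂ ((Chain.point k).inter_le_last U)
    (φ.f n).hom x)).trans (evAt_f k n (image φ x))

/-- Over U_k the Čech degree zero part is the restriction of φ, a quasi-isomorphism by exactness,
followed by evaluation. Source and target are bounded complexes of projectives, hence K-projective,
so the quasi-isomorphism is a homotopy equivalence, and these inverses form an approximate inverse
of the twisted morphism. -/
theorem isHomotopyEquiv_eval [T2Space X] [ParacompactSpace X] [Finite ι] (h𝒜 : IsSoft 𝒜)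
    (hU : ⨆ i, U i = ⊤) (hF : F.IsPerfect) (hE : IsCohesive E) (φ : E ⟶ F.sheafify)
    (hφ : QuasiIso φ) : IsHomotopyEquiv (twist U E) F (eval φ) := by
  obtain ⟨N, hN⟩ := exists_isPerfectIn_objAt hF
  obtain ⟨N', hN'⟩ := exists_isPerfectIn_objAt (isPerfect_twist (U := U) hE)
  have h : ∀ k, ∃ g : HomotopyEquiv ((twist U E).objAt k) (F.objAt k), g.hom = evalAt φ k := by
    intro k
    have := (hN k).isKProjective
    have := (hN' k).isKProjective
    have := h𝒜.restr₂_preservesHomology ((Chain.point k).inter_le_last U)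
    have := quasiIso_evAt (F := F) h𝒜 hU k
    have h1 : QuasiIso (((restr₂ 𝒜 ((Chain.point k).inter_le_last U)).mapHomologicalComplex
      (ComplexShape.up ℤ)).map φ) := inferInstance
    have hq : QuasiIso (evalAt φ k) := quasiIso_comp
      (((restr₂ 𝒜 ((Chain.point k).inter_le_last U)).mapHomologicalComplex
      (ComplexShape.up ℤ)).map φ) (F.evAt k)
    exact (CochainComplex.IsKProjective.quasiIso_iff _).1 hq
  choose g hg using h
  exact (approxInverseOfPoint (eval φ) g fun i n => by rw [hg, evalAt_f]).isHomotopyEquiv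
    (diff_eval φ)

end Conclusion

end TwistedComplex

end TwistedDescent

end

theorem proposition4p1 {X : TopCat.{u}} [T2Space X] [ParacompactSpace X]
    (𝒜 : TopCat.Sheaf RingCat.{u} X) (h𝒜 : IsSoft 𝒜)
    {ι : Type u} [Finite ι] (U : ι → Opens X) (hU : IsGoodCover U)
    (F : TwistedComplex 𝒜 U) (hF : F.IsPerfect) :
    ∃ (E : Cpx 𝒜 (⊤ : Opens X)) (φ : E ⟶ F.sheafify),
      IsCohesive E ∧ QuasiIso φ ∧
      TwistedComplex.IsHomotopyEquiv (twist U E) F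
        ((counit F).comp (twistMap U φ) (add_zero 0)) := by
  obtain ⟨E, φ, hE, hφ⟩ := TwistedComplex.exists_cohesive h𝒜 hU.covers hF
  refine ⟨E, φ, hE, hφ, ?_⟩
  rw [TwistedComplex.counit_comp_twistMap]
  exact TwistedComplex.isHomotopyEquiv_eval h𝒜 hU.covers hF hE φ hφ
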